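/- Let $M$ be a compact smooth $n$-dimensional manifold without boundary and let $(g(t),H(t))$, $t\in J$ ($J$ a nondegenerate interval, e.g. $[0,T]$), be a smooth family of Riemannian metrics and $3$-forms on $M$ solving the generalized Ricci flow (GRF) $$\frac{\partial}{\partial t}g_{ij}=-2R_{ij}+\tfrac12 H_{ikl}H_{j}{}^{kl},\qquad \frac{\partial}{\partial t}H=\square_{g(t)}H,\qquad \square_{g}=-(dd^{*}+d^{*}d),$$ where $d^*$ is the codifferential of $g(t)$. Let $\nabla$ be the Levi-Civita connection of $g(t)$, $\Delta=g^{ij}\nabla_i\nabla_j$, ${\rm Rm}=\{R_{ijkl}\}$ the Riemann curvature tensor, $R_{ij}=g^{kl}R_{ikjl}$, $\nabla^m$ the $m$-th covariant derivative, and $|T|^2=g^{i_1j_1}\cdots g^{i_kj_k}T_{i_1\cdots i_k}T_{j_1\cdots j_k}$. For covariant tensors, $A\ast B$ (resp. $A\ast B\ast C$) denotes a linear combination of tensors obtained from $A\otimes B$ (resp. $A\otimes B\otimes C$) by permuting indices and contracting pairs of indices with $g^{-1}$. The coefficients in these linear combinations depend only on $n$, $l$ and the orders $i,j$ (resp. $i,j,k$)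 of the derivatives that occur, and not on $M$, $J$ or the solution. All sums below run over nonnegative integers $i,j$ (resp. $i,j,k$), and time derivatives at an end point of $J$ are one-sided. (1) For every integer $l\ge1$, $$\frac{\partial}{\partial t}\nabla^{l}H=\Delta(\nabla^{l}H)+\sum_{i+j=l}\nabla^{i}H\ast\nabla^{j}{\rm Rm}+\sum_{i+j+k=l}\nabla^{i}H\ast\nabla^{j}H\ast\nabla^{k}H .$$ (2) For every integer $l\ge1$ there is a constant $C$ depending only on $n$ and $l$ such that $$\frac{\partial}{\partial t}|\nabla^{l}H|^{2}\le\Delta|\nabla^{l}H|^{2}-2|\nabla^{l+1}H|^{2}+C\sum_{i+j=l}|\nabla^{i}H|\,|\nabla^{j}{\rm Rm}|\,|\nabla^{l}H|+C\sum_{i+j+k=l}|\nabla^{i}H|\,|\nabla^{j}H|\,|\nabla^{k}H|\,|\nabla^{l}H| .$$ (3) There is a constant $C$ depending only on $n$ such that $$\frac{\partial}{\partial t}|H|^{2}\le\Delta|H|^{2}-2|\nabla H|^{2}+C\,|{\rm Rm}|\,|H|^{2}.$$ -/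

import Mathlib

open scoped Manifold ContDiff

noncomputable section

namespace GRF

/-- The model space `ℝⁿ`. -/
abbrev Coord (n : ℕ) : Type := EuclideanSpace ℝ (Fin n)

/-- The components of a covariant tensor of rank `k` at a point. -/
abbrev Comp (n k : ℕ) : Type := (Fin k → Fin n) → ℝ

/-- The components, as functions of the coordinates, of a covariant tensor field of rank `k` on a
coordinate patch. -/
abbrev Field (n k : ℕ) : Type := Coord n → Comp n k

/-- The components `g_{ij}`, as functions of the coordinates, of a metric on a coordinate patch. -/
abbrev MetricField (n : ℕ) : Type := Coord n → Matrix (Fin n) (Fin n) ℝ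

section Coordinates

variable {n : ℕ}

/-- The partial derivative `∂_i f`. -/
def pd (i : Fin n) (f : Coord n → ℝ) (y : Coord n) : ℝ :=
  fderiv ℝ f y (EuclideanSpace.single i 1)

/-- The Christoffel symbols of the Levi-Civita connection,
`Γ^k_{ij} = ½ g^{kl} (∂_i g_{jl} + ∂_j g_{il} - ∂_l g_{ij})`. -/
def christoffel (G : MetricField n) (k i j : Fin n) (y : Coord n) : ℝ :=
  (1 / 2) * ∑ l, (G y)⁻¹ k l *
    (pd i (fun z => G z j l) y + pd j (fun z => G z i l) y - pd l (fun z => G z i j) y)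

/-- The covariant derivative of a covariant tensor field; the index of differentiation is the first
one: `∇_p T_{i₁ … i_k} = ∂_p T_{i₁ … i_k} - ∑_s Γ^q_{p i_s} T_{i₁ … q … i_k}`. -/
def cov (G : MetricField n) {k : ℕ} (T : Field n k) : Field n (k + 1) := fun y I =>
  pd (I 0) (fun z => T z (Fin.tail I)) y
    - ∑ s : Fin k, ∑ q, christoffel G q (I 0) (Fin.tail I s) y *
        T y (Function.update (Fin.tail I) s q)

/-- The iterated covariant derivative `∇^m T`. -/
def iterCov (G : MetricField n) {k : ℕ} (T : Field n k) : (m : ℕ) → Field n (k + m)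
  | 0 => T
  | m + 1 => cov G (iterCov G T m)

/-- The Laplace operator `Δ T = g^{pq} ∇_p ∇_q T` on tensor fields. -/
def lap (G : MetricField n) {k : ℕ} (T : Field n k) : Field n k := fun y I =>
  ∑ p, ∑ q, (G y)⁻¹ p q * cov G (cov G T) y (Fin.cons p (Fin.cons q I))

/-- The Laplace operator `Δ f = g^{pq} ∇_p ∇_q f` on functions (tensor fields of rank `0`). -/
def lapFun (G : MetricField n) (f : Coord n → ℝ) (y : Coord n) : ℝ :=
  lap G (k := 0) (fun z _ => f z) y Fin.elim0

/-- The curvature `R_{ijl}^h`, the `h`-component of `R(∂_i, ∂_j) ∂_l`, where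
`R(X, Y) = ∇_X ∇_Y - ∇_Y ∇_X - ∇_{[X, Y]}`. -/
def riemUp (G : MetricField n) (i j l h : Fin n) (y : Coord n) : ℝ :=
  pd i (christoffel G h j l) y - pd j (christoffel G h i l) y
    + ∑ p, (christoffel G h i p y * christoffel G p j l y
      - christoffel G h j p y * christoffel G p i l y)

/-- The Riemann curvature tensor `R_{ijkl} = g_{hk} R_{ijl}^h`, which is normalised so that
`R_{ijij} > 0` on a round sphere. -/
def riem (G : MetricField n) : Field n 4 := fun y I =>
  ∑ h, G y h (I 2) * riemUp G (I 0) (I 1) (I 3) h y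

/-- The Ricci curvature `R_{ij} = g^{kl} R_{ikjl}`. -/
def ric (G : MetricField n) (i j : Fin n) (y : Coord n) : ℝ :=
  ∑ k, ∑ l, (G y)⁻¹ k l * riem G y ![i, k, j, l]

/-- The exterior derivative in components,
`(dα)_{i₀ … i_p} = ∑_s (-1)^s ∂_{i_s} α_{i₀ … î_s … i_p}`. -/
def extD {p : ℕ} (α : Field n p) : Field n (p + 1) := fun y I =>
  ∑ s : Fin (p + 1), (-1) ^ (s : ℕ) * pd (I s) (fun z => α z (fun r => I (s.succAbove r))) y

/-- The codifferential, `(d^*α)_{i₁ … i_p} = -g^{jk} ∇_j α_{k i₁ … i_p}`. -/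
def coD (G : MetricField n) {p : ℕ} (α : Field n (p + 1)) : Field n p := fun y I =>
  - ∑ j, ∑ k, (G y)⁻¹ j k * cov G α y (Fin.cons j (Fin.cons k I))

/-- The Laplace–Beltrami operator `□ = -(d d^* + d^* d)` on forms of positive degree. -/
def box (G : MetricField n) {p : ℕ} (α : Field n (p + 1)) : Field n (p + 1) := fun y I =>
  -(extD (coD G α) y I + coD G (extD α) y I)

/-- `h_{ij} = H_{ikl} H_j{}^{kl} = g^{kp} g^{lq} H_{ikl} H_{jpq}`. -/
def hTerm (G : MetricField n) (H : Field n 3) (i j : Fin n) (y : Coord n) : ℝ :=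
  ∑ k, ∑ l, ∑ p, ∑ q, (G y)⁻¹ k p * (G y)⁻¹ l q * H y ![i, k, l] * H y ![j, p, q]

/-- `|T|² = g^{i₁ j₁} ⋯ g^{i_k j_k} T_{i₁ … i_k} T_{j₁ … j_k}`. -/
def normSq (G : MetricField n) {k : ℕ} (T : Field n k) (y : Coord n) : ℝ :=
  ∑ I : Fin k → Fin n, ∑ J : Fin k → Fin n, (∏ s, (G y)⁻¹ (I s) (J s)) * T y I * T y J

/-- `|T|`. -/
def nrm (G : MetricField n) {k : ℕ} (T : Field n k) (y : Coord n) : ℝ :=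
  Real.sqrt (normSq G T y)

/-- The tensor product `A ⊗ B`. -/
def tprod {a b : ℕ} (A : Field n a) (B : Field n b) : Field n (a + b) := fun y I =>
  A y (fun s => I (Fin.castAdd b s)) * B y (fun s => I (Fin.natAdd a s))

/-- The contraction of a tensor of rank `r` with `m` copies of `g^{-1}`, along the pattern `σ`,
which says for each of the `r` slots whether it carries one of the `c` remaining indices or is the
first or second member of one of the `m` contracted pairs. -/
def contr (G : MetricField n) {r c m : ℕ} (σ : Fin r ≃ Fin c ⊕ (Fin m × Fin 2)) (T : Field n r) :
    Field n c := fun y I =>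
  ∑ K : Fin m × Fin 2 → Fin n,
    (∏ s : Fin m, (G y)⁻¹ (K (s, 0)) (K (s, 1))) * T y (fun x => Sum.elim I K (σ x))

/-- The real coefficients, one for each contraction pattern, of a linear combination of
contractions that takes tensors of rank `r` to tensors of rank `c` with `m` contracted pairs
(so `r = c + 2 m`, otherwise there are no patterns). -/
abbrev Coeffs (r c m : ℕ) : Type := (Fin r ≃ Fin c ⊕ (Fin m × Fin 2)) → ℝ

/-- The linear combination of contractions with the coefficients `a`. -/
def linContr (G : MetricField n) {r c m : ℕ} (a : Coeffs r c m) (T : Field n r) : Field n c :=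
  fun y I => ∑ σ, a σ * contr G σ T y I

/-- A product `A ∗ B`: a linear combination, with the constant coefficients `a`, of contractions of
`A ⊗ B` by the metric (with the indices in any order). -/
def star2 (G : MetricField n) {a b c m : ℕ} (w : Coeffs (a + b) c m)
    (A : Field n a) (B : Field n b) : Field n c :=
  linContr G w (tprod A B)

/-- A product `A ∗ B ∗ C`: a linear combination of contractions of `A ⊗ B ⊗ C` by the metric. -/
def star3 (G : MetricField n) {a b c d m : ℕ} (w : Coeffs (a + (b + c)) d m)
    (A : Field n a) (B : Field n b) (C : Field n c) : Field n d :=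
  linContr G w (tprod A (tprod B C))

end Coordinates

section Manifold

variable {n : ℕ} {M : Type*} [TopologicalSpace M] [ChartedSpace (Coord n) M]

/-- A local chart (a local coordinate system) of `M`, with values in `ℝⁿ`. -/
abbrev Chart (n : ℕ) (M : Type*) [TopologicalSpace M] : Type _ := OpenPartialHomeomorph M (Coord n)

/-- The coordinate vector field `∂_i` of the chart `e`, at the point with coordinates `y`. -/
def coordVec (e : Chart n M) (i : Fin n) (y : Coord n) : TangentSpace (𝓡 n) (e.symm y) :=
  mfderiv 𝓘(ℝ, Coord n) (𝓡 n) e.symm y (EuclideanSpace.single i (1 : ℝ))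

/-- A smooth Riemannian metric on the manifold `M`. -/
abbrev Metric (n : ℕ) (M : Type*) [TopologicalSpace M] [ChartedSpace (Coord n) M]
    [IsManifold (𝓡 n) ∞ M] : Type _ :=
  Bundle.ContMDiffRiemannianMetric (𝓡 n) ∞ (Coord n) (fun x : M => TangentSpace (𝓡 n) x)

/-- A field of alternating `3`-forms on `M` (smoothness is required separately). -/
abbrev ThreeForm (n : ℕ) (M : Type*) [TopologicalSpace M] [ChartedSpace (Coord n) M] : Type _ :=
  (x : M) → TangentSpace (𝓡 n) x [⋀^Fin 3]→L[ℝ] ℝ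

/-- The components `g_{ij}` in the chart `e`. -/
def metricIn [IsManifold (𝓡 n) ∞ M] (g : Metric n M) (e : Chart n M) : MetricField n :=
  fun y => Matrix.of fun i j => g.inner (e.symm y) (coordVec e i y) (coordVec e j y)

/-- The components `H_{ijk}` in the chart `e`. -/
def formIn (H : ThreeForm n M) (e : Chart n M) : Field n 3 :=
  fun y I => H (e.symm y) (fun s => coordVec e (I s) y)

/-- `(g(t), H(t))`, `t ∈ J`, is a smooth solution of the generalized Ricci flow
`∂_t g_{ij} = -2 R_{ij} + ½ H_{ikl} H_j{}^{kl}`, `∂_t H = □_{g(t)} H` on `M`: in every chart of the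
smooth structure the components are smooth in `(t, x)` together and satisfy these equations
(the derivatives in `t` being one-sided at those end points of `J` that belong to `J`). -/
structure IsSolution [IsManifold (𝓡 n) ∞ M] (J : Set ℝ) (g : ℝ → Metric n M)
    (H : ℝ → ThreeForm n M) : Prop where
  smooth_metric : ∀ e ∈ IsManifold.maximalAtlas (𝓡 n) ∞ M, ∀ i j : Fin n,
    ContDiffOn ℝ ∞ (fun p : ℝ × Coord n => metricIn (g p.1) e p.2 i j) (J ×ˢ e.target)
  smooth_form : ∀ e ∈ IsManifold.maximalAtlas (𝓡 n) ∞ M, ∀ I : Fin 3 → Fin n,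
    ContDiffOn ℝ ∞ (fun p : ℝ × Coord n => formIn (H p.1) e p.2 I) (J ×ˢ e.target)
  metric_eq : ∀ e ∈ IsManifold.maximalAtlas (𝓡 n) ∞ M, ∀ t ∈ J, ∀ y ∈ e.target, ∀ i j : Fin n,
    HasDerivWithinAt (fun s => metricIn (g s) e y i j)
      (-2 * ric (metricIn (g t) e) i j y
        + (1 / 2) * hTerm (metricIn (g t) e) (formIn (H t) e) i j y) J t
  form_eq : ∀ e ∈ IsManifold.maximalAtlas (𝓡 n) ∞ M, ∀ t ∈ J, ∀ y ∈ e.target,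
    ∀ I : Fin 3 → Fin n,
    HasDerivWithinAt (fun s => formIn (H s) e y I)
      (box (metricIn (g t) e) (formIn (H t) e) y I) J t

/-- The components of `∇^m H` in the chart `e`. -/
def nablaH [IsManifold (𝓡 n) ∞ M] (g : Metric n M) (H : ThreeForm n M) (e : Chart n M) (m : ℕ) :
    Field n (3 + m) :=
  iterCov (metricIn g e) (formIn H e) m

/-- The components of `∇^m Rm` in the chart `e`. -/
def nablaRm [IsManifold (𝓡 n) ∞ M] (g : Metric n M) (e : Chart n M) (m : ℕ) :
    Field n (4 + m) :=
  iterCov (metricIn g e) (riem (metricIn g e)) m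

end Manifold

end GRF

end

universe u

noncomputable section

namespace GRF

/-! ### Partial derivatives -/

section PartialDerivatives

variable {n : ℕ}

/-! Everything is a pointwise identity or inequality in a chart; the only global demand is that the
coefficients and constants be the same for all manifolds and solutions. For this reason the error
terms are not computed but tracked as universal tensors: rules that assign a field to every pair of
a metric and a three-form on an open set. `Poly p q l k` records that such a rule is built from `p`
factors of type `∇^i H` and `q` factors of type `∇^j Rm`, with `l` derivatives in all. This class is
stable under `∇` (`Poly.cov`), because `∇` obeys the Leibniz rule and annihilates the inverse
metric.

The evolution of `∇^l H` (`LocFlow.exists_evolution`) is proved by induction on `l`. For `l = 0`,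
the Weitzenböck formula (`exists_box_eq`) gives `□H = ΔH + Rm ∗ H`. In the inductive step, `∂_t ∇T`
is `∇ ∂_t T` minus the action of `∂_t Γ` on `T` (`LocFlow.hasDeriv_cov`). The velocity of `Γ` is
`g⁻¹` times first covariant derivatives of `∂_t g` (`LocFlow.hasDeriv_christoffel`), hence of the
form `∇Rm + ∇(H ∗ H)`; and moving `∇` past `Δ` costs one curvature factor, by the Ricci identity
(`Poly.cov_lap_sub`). So the errors keep the types `(1, 1, l)` and `(3, 0, l)`. A normal form
theorem turns a universal tensor of one of these types into an explicit sum of `∗`-products with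
fixed coefficients (`Poly.exists_star2`, `Poly.exists_star3`).

For the norms, `∂_t |T|²` equals `2⟨∂_t T, T⟩` minus the pairing of `T` with the action of `∂_t g`
on `T` (`LocFlow.hasDeriv_normSq`), and the Bochner formula (`LocData.lapFun_normSq`) converts
`2⟨ΔT, T⟩` into `Δ|T|² - 2|∇T|²`. The remaining terms are again universal of the two types, and are
bounded by Cauchy–Schwarz and by the fact that a contraction increases norms by a factor of at most
`√n` (`Poly.nrm_le_two`, `Poly.nrm_le_three`).

For `l = 0` the only quartic term in `H` comes from the part `½ H_{ikl} H_j{}^{kl}` of `∂_t g`. That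
part is positive semidefinite and enters with a minus sign (`LocData.posSemidef_formPart`,
`LocData.ipC_act_nonneg`), so it is discarded and only `C |Rm| |H|²` remains. -/

theorem pd_congr {i : Fin n} {f h : Coord n → ℝ} {y : Coord n} (e : f =ᶠ[nhds y] h) :
    pd i f y = pd i h y := by
  rw [pd, pd, e.fderiv_eq]

theorem pd_congr_on {U : Set (Coord n)} (hU : IsOpen U) {i : Fin n} {f h : Coord n → ℝ}
    (e : ∀ y ∈ U, f y = h y) {y : Coord n} (hy : y ∈ U) : pd i f y = pd i h y :=
  pd_congr (Filter.eventuallyEq_of_mem (hU.mem_nhds hy) e)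

@[simp] theorem pd_const (i : Fin n) (c : ℝ) (y : Coord n) : pd i (fun _ => c) y = 0 := by
  simp [pd]

theorem pd_add {i : Fin n} {f h : Coord n → ℝ} {y : Coord n} (hf : DifferentiableAt ℝ f y)
    (hh : DifferentiableAt ℝ h y) : pd i (fun z => f z + h z) y = pd i f y + pd i h y := by
  simp only [pd, fderiv_fun_add hf hh]; rfl

theorem pd_sub {i : Fin n} {f h : Coord n → ℝ} {y : Coord n} (hf : DifferentiableAt ℝ f y)
    (hh : DifferentiableAt ℝ h y) : pd i (fun z => f z - h z) y = pd i f y - pd i h y := by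
  simp only [pd, fderiv_fun_sub hf hh]; rfl

theorem pd_mul {i : Fin n} {f h : Coord n → ℝ} {y : Coord n} (hf : DifferentiableAt ℝ f y)
    (hh : DifferentiableAt ℝ h y) :
    pd i (fun z => f z * h z) y = pd i f y * h y + f y * pd i h y := by
  simp only [pd, fderiv_fun_mul hf hh]
  simp
  ring

theorem pd_const_mul {i : Fin n} {f : Coord n → ℝ} {y : Coord n} (c : ℝ)
    (hf : DifferentiableAt ℝ f y) : pd i (fun z => c * f z) y = c * pd i f y := by
  rw [pd_mul (differentiableAt_const c) hf, pd_const, zero_mul, zero_add]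

theorem pd_sum {i : Fin n} {ι : Type*} (s : Finset ι) {f : ι → Coord n → ℝ} {y : Coord n}
    (hf : ∀ a ∈ s, DifferentiableAt ℝ (f a) y) :
    pd i (fun z => ∑ a ∈ s, f a z) y = ∑ a ∈ s, pd i (f a) y := by
  simp only [pd, fderiv_fun_sum hf]
  simp

theorem two_le_infty : minSmoothness ℝ 2 ≤ (∞ : WithTop ℕ∞) := by
  simp only [minSmoothness_of_isRCLikeNormedField]
  exact WithTop.coe_le_coe.2 (le_top : (2 : ℕ∞) ≤ ⊤)

theorem pd_comm {U : Set (Coord n)} (hU : IsOpen U) {f : Coord n → ℝ} (hf : ContDiffOn ℝ ∞ f U)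
    {y : Coord n} (hy : y ∈ U) (i j : Fin n) : pd i (pd j f) y = pd j (pd i f) y := by
  have h1 : ContDiffAt ℝ ∞ f y := hf.contDiffAt (hU.mem_nhds hy)
  have h2 : DifferentiableAt ℝ (fderiv ℝ f) y :=
    (h1.fderiv_right (m := ∞) (by simp)).differentiableAt (by simp)
  have key : ∀ a b : Fin n, pd a (pd b f) y
      = fderiv ℝ (fderiv ℝ f) y (EuclideanSpace.single a 1) (EuclideanSpace.single b 1) := by
    intro a b
    have : (pd b f) = fun z => (fderiv ℝ f z) (EuclideanSpace.single b 1) := rfl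
    rw [pd, this, fderiv_clm_apply h2 (differentiableAt_const _)]
    simp
  rw [key, key]
  exact (h1.isSymmSndFDerivAt two_le_infty) _ _

end PartialDerivatives

/-! ### Families of functions that depend on time -/

section Time

variable {n : ℕ} {J : Set ℝ} {U : Set (Coord n)}

theorem interior_nonempty_of_nontrivial (hJ : J.OrdConnected) (hJ' : J.Nontrivial) :
    (interior J).Nonempty := by
  obtain ⟨a, ha, b, hb, hab⟩ := hJ'.exists_lt
  have : Set.Ioo a b ⊆ interior J :=
    interior_maximal (Set.Ioo_subset_Icc_self.trans (hJ.out ha hb)) isOpen_Ioo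
  exact (Set.nonempty_Ioo.2 hab).mono this

/-- A nondegenerate interval is convex with nonempty interior. This makes one-sided time derivatives
unique, which is used repeatedly to identify two expressions for the same velocity. -/
theorem uniqueDiffOn_time (hJ : J.OrdConnected) (hJ' : J.Nontrivial) : UniqueDiffOn ℝ J :=
  uniqueDiffOn_convex hJ.convex (interior_nonempty_of_nontrivial hJ hJ')

theorem uniqueDiffOn_prod (hJ : J.OrdConnected) (hJ' : J.Nontrivial) (hU : IsOpen U) :
    UniqueDiffOn ℝ (J ×ˢ U) :=
  (uniqueDiffOn_time hJ hJ').prod hU.uniqueDiffOn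

/-- Symmetry of the second derivative within a set requires the point to be a limit of interior
points; this covers the end points of `J`. -/
theorem prod_subset_closure_interior (hJ : J.OrdConnected) (hJ' : J.Nontrivial) (hU : IsOpen U) :
    J ×ˢ U ⊆ closure (interior (J ×ˢ U)) := by
  rw [interior_prod_eq, closure_prod_eq, hU.interior_eq,
    (hJ.convex : Convex ℝ J).closure_interior_eq_closure_of_nonempty_interior
      (interior_nonempty_of_nontrivial hJ hJ')]
  exact Set.prod_mono (subset_closure (s := J)) (subset_closure (s := U))

theorem hasFDerivAt_slice (hU : IsOpen U) {E : Type*} [NormedAddCommGroup E] [NormedSpace ℝ E]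
    {F : ℝ × Coord n → E} {F' : ℝ × Coord n →L[ℝ] E} {t : ℝ} {y : Coord n} (ht : t ∈ J)
    (hy : y ∈ U) (hF : HasFDerivWithinAt F F' (J ×ˢ U) (t, y)) :
    HasFDerivAt (fun z => F (t, z)) (F'.comp (ContinuousLinearMap.inr ℝ ℝ (Coord n))) y := by
  have h1 : HasFDerivWithinAt (fun z : Coord n => (t, z))
      (ContinuousLinearMap.inr ℝ ℝ (Coord n)) U y :=
    (hasFDerivAt_prodMk_right t y).hasFDerivWithinAt
  exact (hF.comp y h1 (fun z hz => ⟨ht, hz⟩)).hasFDerivAt (hU.mem_nhds hy)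

theorem hasDerivWithinAt_slice {E : Type*} [NormedAddCommGroup E] [NormedSpace ℝ E]
    {F : ℝ × Coord n → E} {F' : ℝ × Coord n →L[ℝ] E} {t : ℝ} {y : Coord n}
    (hy : y ∈ U) (hF : HasFDerivWithinAt F F' (J ×ˢ U) (t, y)) :
    HasDerivWithinAt (fun s => F (s, y)) (F' (1, 0)) J t := by
  have h1 : HasFDerivWithinAt (fun s : ℝ => (s, y))
      (ContinuousLinearMap.inl ℝ ℝ (Coord n)) J t :=
    (hasFDerivAt_prodMk_left t y).hasFDerivWithinAt
  have := (hF.comp t h1 (fun z hz => Set.mk_mem_prod hz hy)).hasDerivWithinAt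
  simpa [Function.comp_def] using this

theorem pd_slice (hU : IsOpen U) {F : ℝ × Coord n → ℝ} (hF : ContDiffOn ℝ ∞ F (J ×ˢ U))
    {t : ℝ} {y : Coord n} (ht : t ∈ J) (hy : y ∈ U) (i : Fin n) :
    pd i (fun z => F (t, z)) y
      = fderivWithin ℝ F (J ×ˢ U) (t, y) (0, EuclideanSpace.single i 1) := by
  have h := hasFDerivAt_slice hU ht hy
    ((hF.differentiableOn (by simp)) (t, y) ⟨ht, hy⟩).hasFDerivWithinAt
  rw [pd, h.fderiv]
  simp

/-- The spatial partial derivatives of a smooth family are a smooth family. -/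
theorem contDiffOn_pd_family (hJ : J.OrdConnected) (hJ' : J.Nontrivial) (hU : IsOpen U)
    {f : ℝ → Coord n → ℝ} (hf : ContDiffOn ℝ ∞ (fun p : ℝ × Coord n => f p.1 p.2) (J ×ˢ U))
    (i : Fin n) : ContDiffOn ℝ ∞ (fun p : ℝ × Coord n => pd i (f p.1) p.2) (J ×ˢ U) := by
  have h1 := hf.fderivWithin (m := ∞) (uniqueDiffOn_prod hJ hJ' hU) (by simp)
  refine (h1.clm_apply (contDiffOn_const (c := (0, EuclideanSpace.single i 1)))).congr ?_
  rintro ⟨t, y⟩ ⟨ht, hy⟩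
  exact pd_slice hU hf ht hy i


theorem contDiffOn_slice {f : ℝ → Coord n → ℝ}
    (hf : ContDiffOn ℝ ∞ (fun p : ℝ × Coord n => f p.1 p.2) (J ×ˢ U)) {t : ℝ} (ht : t ∈ J) :
    ContDiffOn ℝ ∞ (f t) U :=
  hf.comp (f := fun z : Coord n => (t, z)) (by fun_prop) (fun z hz => ⟨ht, hz⟩)

theorem differentiableWithinAt_time {f : ℝ → Coord n → ℝ}
    (hf : ContDiffOn ℝ ∞ (fun p : ℝ × Coord n => f p.1 p.2) (J ×ˢ U)) {t : ℝ} (ht : t ∈ J)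
    {y : Coord n} (hy : y ∈ U) : DifferentiableWithinAt ℝ (fun s => f s y) J t :=
  (hasDerivWithinAt_slice hy
    ((hf.differentiableOn (by simp)) (t, y) ⟨ht, hy⟩).hasFDerivWithinAt).differentiableWithinAt

/-- Time derivatives commute with spatial partial derivatives. -/
theorem hasDerivWithinAt_pd (hJ : J.OrdConnected) (hJ' : J.Nontrivial) (hU : IsOpen U)
    {f f' : ℝ → Coord n → ℝ} (hf : ContDiffOn ℝ ∞ (fun p : ℝ × Coord n => f p.1 p.2) (J ×ˢ U))
    (hf' : ∀ t ∈ J, ∀ y ∈ U, HasDerivWithinAt (fun s => f s y) (f' t y) J t) (i : Fin n)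
    {t : ℝ} (ht : t ∈ J) {y : Coord n} (hy : y ∈ U) :
    HasDerivWithinAt (fun s => pd i (f s) y) (pd i (f' t) y) J t := by
  set S := J ×ˢ U
  set F : ℝ × Coord n → ℝ := fun p => f p.1 p.2
  have hS := uniqueDiffOn_prod hJ hJ' hU
  have h1 : ContDiffOn ℝ ∞ (fderivWithin ℝ F S) S := hf.fderivWithin (m := ∞) hS (by simp)
  have h2 : HasFDerivWithinAt (fderivWithin ℝ F S) (fderivWithin ℝ (fderivWithin ℝ F S) S (t, y))
      S (t, y) := ((h1.differentiableOn (by simp)) (t, y) ⟨ht, hy⟩).hasFDerivWithinAt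
  -- Schwarz's theorem on `J × U`, for the directions `(1, 0)` and `(0, e_i)`, is the whole content;
  -- the rest identifies iterated partial derivatives with values of this second derivative.
  have hsymm := (hf (t, y) ⟨ht, hy⟩).isSymmSndFDerivWithinAt two_le_infty hS
    (prod_subset_closure_interior hJ hJ' hU ⟨ht, hy⟩) ⟨ht, hy⟩
  have h3 := (hasDerivWithinAt_slice hy h2).clm_apply
    (hasDerivWithinAt_const t J ((0, EuclideanSpace.single i 1) : ℝ × Coord n))
  have h4 : HasDerivWithinAt (fun s => pd i (f s) y)
      (fderivWithin ℝ (fderivWithin ℝ F S) S (t, y) (1, 0) (0, EuclideanSpace.single i 1)) J t := by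
    refine (h3.congr_deriv (by simp)).congr (fun s hs => ?_) ?_
    · exact pd_slice hU hf hs hy i
    · exact pd_slice hU hf ht hy i
  -- The given velocity is the joint derivative in the time direction, by uniqueness of one-sided
  -- derivatives; only this makes it differentiable in space.
  have h5 : ∀ z ∈ U, f' t z = fderivWithin ℝ F S (t, z) (1, 0) := fun z hz =>
    ((uniqueDiffOn_time hJ hJ') t ht).eq_deriv _ (hf' t ht z hz)
      (hasDerivWithinAt_slice hz
        ((hf.differentiableOn (by simp)) (t, z) ⟨ht, hz⟩).hasFDerivWithinAt)
  have h6 : pd i (f' t) y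
      = fderivWithin ℝ (fderivWithin ℝ F S) S (t, y) (0, EuclideanSpace.single i 1) (1, 0) := by
    rw [pd_congr_on hU h5 hy, pd]
    have := (hasFDerivAt_slice hU ht hy h2).clm_apply
      (hasFDerivAt_const ((1, 0) : ℝ × Coord n) y)
    rw [this.fderiv]
    simp
  rw [h6, ← hsymm (1, 0) (0, EuclideanSpace.single i 1)]
  exact h4

end Time

/-! ### Inverse matrices -/

section Inverse

variable {n : ℕ}

theorem contDiffOn_det {E : Type*} [NormedAddCommGroup E] [NormedSpace ℝ E] {s : Set E}
    {m : ℕ} {A : E → Matrix (Fin m) (Fin m) ℝ} (hA : ∀ i j, ContDiffOn ℝ ∞ (fun x => A x i j) s) :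
    ContDiffOn ℝ ∞ (fun x => (A x).det) s := by
  simp only [Matrix.det_apply]
  exact ContDiffOn.sum fun σ _ => ContDiffOn.const_smul _ (contDiffOn_prod fun i _ => hA _ _)

/-- Cramer's rule: the entries of the inverse are polynomials in the entries of the matrix, divided
by the determinant. -/
theorem contDiffOn_inv_entry {E : Type*} [NormedAddCommGroup E] [NormedSpace ℝ E] {s : Set E}
    {A : E → Matrix (Fin n) (Fin n) ℝ} (hA : ∀ i j, ContDiffOn ℝ ∞ (fun x => A x i j) s)
    (hdet : ∀ x ∈ s, (A x).det ≠ 0) (i j : Fin n) :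
    ContDiffOn ℝ ∞ (fun x => (A x)⁻¹ i j) s := by
  have h1 : ContDiffOn ℝ ∞ (fun x => ((A x).det)⁻¹) s := (contDiffOn_det hA).inv hdet
  have h2 : ContDiffOn ℝ ∞ (fun x => (A x).adjugate i j) s := by
    simp only [Matrix.adjugate_apply]
    refine contDiffOn_det fun a b => ?_
    by_cases h : a = j
    · subst h; simpa using contDiffOn_const
    · simpa [Matrix.updateRow_ne h] using hA a b
  refine (h1.mul h2).congr fun x _ => ?_
  simp [Matrix.inv_def]

/-- The algebra behind differentiating `A P = 1`. It serves both for spatial derivatives of `g⁻¹`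
and for its time derivative. -/
theorem inv_deriv_eq {A P A' P' : Matrix (Fin n) (Fin n) ℝ} (hP : P * A = 1)
    (h : A' * P + A * P' = 0) : P' = -(P * A' * P) := by
  have : P * (A' * P + A * P') = 0 := by rw [h, mul_zero]
  rw [mul_add, ← mul_assoc, ← mul_assoc, hP, one_mul] at this
  exact (neg_eq_of_add_eq_zero_right this).symm

end Inverse

/-! ### Algebra of tensor components -/

section Components

variable {n k k' : ℕ}

/-- The action of a matrix on the `s`-th index of a covariant tensor. -/
def slot (s : Fin k) (A : Fin n → Fin n → ℝ) (T : Comp n k) : Comp n k := fun I =>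
  ∑ q, A q (I s) * T (Function.update I s q)

/-- The action of a matrix on covariant tensors, as a derivation. -/
def act (A : Fin n → Fin n → ℝ) (T : Comp n k) : Comp n k := fun I => ∑ s, slot s A T I

/-- Renaming the slots of a tensor. -/
def permC (σ : Fin k ≃ Fin k') (T : Comp n k) : Comp n k' := fun I => T (I ∘ σ)

/-- The contraction of the first two slots. -/
def contrC (P : Matrix (Fin n) (Fin n) ℝ) (T : Comp n (k + 2)) : Comp n k := fun I =>
  ∑ a, ∑ b, P a b * T (Fin.cons a (Fin.cons b I))

/-- The tensor product of components. -/
def tmul (A : Comp n k) (B : Comp n k') : Comp n (k + k') := fun I =>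
  A (fun s => I (Fin.castAdd k' s)) * B (fun s => I (Fin.natAdd k s))

theorem slot_comm {s s' : Fin k} (h : s ≠ s') (A B : Fin n → Fin n → ℝ) (T : Comp n k) :
    slot s A (slot s' B T) = slot s' B (slot s A T) := by
  funext I
  simp only [slot, Finset.mul_sum]
  rw [Finset.sum_comm]
  refine Finset.sum_congr rfl fun q _ => Finset.sum_congr rfl fun r _ => ?_
  rw [Function.update_of_ne h.symm, Function.update_of_ne h, Function.update_comm h]
  ring

theorem slot_slot (s : Fin k) (A B : Fin n → Fin n → ℝ) (T : Comp n k) :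
    slot s A (slot s B T) = slot s (fun r i => ∑ q, B r q * A q i) T := by
  funext I
  simp only [slot, Finset.mul_sum, Finset.sum_mul]
  rw [Finset.sum_comm]
  refine Finset.sum_congr rfl fun q _ => Finset.sum_congr rfl fun r _ => ?_
  rw [Function.update_self, Function.update_idem]
  ring

theorem slot_sum {ι : Type*} (t : Finset ι) (s : Fin k) (A : Fin n → Fin n → ℝ)
    (T : ι → Comp n k) : slot s A (fun I => ∑ a ∈ t, T a I) = fun I => ∑ a ∈ t, slot s A (T a) I := by
  funext I
  simp only [slot, Finset.mul_sum]
  rw [Finset.sum_comm]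

theorem slot_sub_left (s : Fin k) (A B : Fin n → Fin n → ℝ) (T : Comp n k) (I : Fin k → Fin n) :
    slot s (fun q i => A q i - B q i) T I = slot s A T I - slot s B T I := by
  simp [slot, sub_mul, Finset.sum_sub_distrib]

theorem act_sub_left (A B : Fin n → Fin n → ℝ) (T : Comp n k) (I : Fin k → Fin n) :
    act (fun q i => A q i - B q i) T I = act A T I - act B T I := by
  simp [act, slot_sub_left, Finset.sum_sub_distrib]

/-- Actions on different slots commute, so only the terms with both matrices on the same slot
survive, and these assemble into a matrix commutator. It yields the quadratic terms in `Γ` of the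
curvature. -/
theorem act_act_sub (A B : Fin n → Fin n → ℝ) (T : Comp n k) (I : Fin k → Fin n) :
    act A (act B T) I - act B (act A T) I
      = act (fun r i => ∑ q, (B r q * A q i - A r q * B q i)) T I := by
  have e : ∀ A B : Fin n → Fin n → ℝ, act A (act B T) I = ∑ s, ∑ s', slot s A (slot s' B T) I := by
    intro A B
    simp only [act]
    refine Finset.sum_congr rfl fun s _ => ?_
    exact congrFun (slot_sum Finset.univ s A fun s' => slot s' B T) I
  rw [e, e, Finset.sum_comm (f := fun s s' => slot s B (slot s' A T) I),
    ← Finset.sum_sub_distrib, act]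
  refine Finset.sum_congr rfl fun s _ => ?_
  rw [← Finset.sum_sub_distrib, Finset.sum_eq_single s]
  · simp only [Finset.sum_sub_distrib]
    rw [slot_slot, slot_slot, slot_sub_left]
  · intro s' _ h
    rw [slot_comm h.symm, sub_self]
  · simp

theorem act_permC (A : Fin n → Fin n → ℝ) (σ : Fin k ≃ Fin k') (T : Comp n k) :
    act A (permC σ T) = permC σ (act A T) := by
  funext I
  simp only [act, slot, permC]
  rw [← Equiv.sum_comp σ]
  refine Finset.sum_congr rfl fun s _ => Finset.sum_congr rfl fun q _ => ?_
  congr 2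
  funext x
  simp [Function.update_apply, σ.injective.eq_iff]

theorem act_tmul (A : Fin n → Fin n → ℝ) (S : Comp n k) (T : Comp n k') (I : Fin (k + k') → Fin n) :
    act A (tmul S T) I = tmul (act A S) T I + tmul S (act A T) I := by
  simp only [act, slot, tmul]
  rw [Fin.sum_univ_add, Finset.sum_mul, Finset.mul_sum]
  congr 1
  · refine Finset.sum_congr rfl fun s _ => ?_
    rw [Finset.sum_mul]
    refine Finset.sum_congr rfl fun q _ => ?_
    rw [mul_assoc]
    congr 3
    · funext x
      simp [Function.update_apply]
    · funext x
      rw [Function.update_of_ne]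
      intro h
      have := congrArg Fin.val h
      simp at this
      omega
  · refine Finset.sum_congr rfl fun s _ => ?_
    rw [Finset.mul_sum]
    refine Finset.sum_congr rfl fun q _ => ?_
    rw [mul_left_comm]
    congr 2
    · funext x
      rw [Function.update_of_ne]
      intro h
      have := congrArg Fin.val h
      simp at this
      omega
    · congr 1
      funext x
      simp [Function.update_apply]

/-- Separates the Christoffel correction of a newly created derivative slot from the corrections of
the old slots. -/
theorem act_cons (A : Fin n → Fin n → ℝ) (T : Comp n (k + 1)) (p : Fin n) (I : Fin k → Fin n) :
    act A T (Fin.cons p I) = ∑ c, A c p * T (Fin.cons c I)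
      + act A (fun J => T (Fin.cons p J)) I := by
  simp only [act, slot]
  rw [Fin.sum_univ_succ]
  congr 1
  · refine Finset.sum_congr rfl fun q _ => ?_
    simp
  · refine Finset.sum_congr rfl fun s _ => Finset.sum_congr rfl fun q _ => ?_
    simp [Fin.cons_update]

theorem act_contrC (A : Fin n → Fin n → ℝ) (P : Matrix (Fin n) (Fin n) ℝ) (T : Comp n (k + 2))
    (I : Fin k → Fin n) : act A (contrC P T) I
      = ∑ a, ∑ b, P a b * act A (fun J => T (Fin.cons a (Fin.cons b J))) I := by
  have e : ∀ s : Fin k, slot s A (contrC P T) I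
      = ∑ a, ∑ b, P a b * slot s A (fun J => T (Fin.cons a (Fin.cons b J))) I := by
    intro s
    simp only [slot, contrC, Finset.mul_sum]
    rw [Finset.sum_comm]
    refine Finset.sum_congr rfl fun a _ => ?_
    rw [Finset.sum_comm]
    exact Finset.sum_congr rfl fun b _ => Finset.sum_congr rfl fun q _ => by ring
  simp only [act, e, Finset.mul_sum]
  rw [Finset.sum_comm]
  refine Finset.sum_congr rfl fun a _ => ?_
  rw [Finset.sum_comm]

end Components

/-! ### Tensor fields -/

section Fields

variable {n k k' : ℕ}

/-- Renaming the slots of a tensor field. -/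
def perm (σ : Fin k ≃ Fin k') (T : Field n k) : Field n k' := fun y => permC σ (T y)

/-- The contraction of the first two slots of a tensor field. -/
def contract (G : MetricField n) (T : Field n (k + 2)) : Field n k := fun y =>
  contrC (G y)⁻¹ (T y)

theorem tprod_apply (A : Field n k) (B : Field n k') (y : Coord n) :
    tprod A B y = tmul (A y) (B y) := rfl

theorem lap_eq (G : MetricField n) (T : Field n k) : lap G T = contract G (cov G (cov G T)) := rfl

/-- The matrix `Γ^q_{p i}` for fixed `p`. -/
def chr (G : MetricField n) (p : Fin n) (y : Coord n) : Fin n → Fin n → ℝ := fun q i =>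
  christoffel G q p i y

theorem cov_cons (G : MetricField n) (T : Field n k) (y : Coord n) (p : Fin n)
    (I : Fin k → Fin n) : cov G T y (Fin.cons p I)
      = pd p (fun z => T z I) y - act (chr G p y) (T y) I := rfl

theorem cov_apply (G : MetricField n) (T : Field n k) (y : Coord n) (I : Fin (k + 1) → Fin n) :
    cov G T y I = pd (I 0) (fun z => T z (Fin.tail I)) y
      - act (chr G (I 0) y) (T y) (Fin.tail I) := rfl

theorem cov_congr {U : Set (Coord n)} (hU : IsOpen U) (G : MetricField n) {S T : Field n k}
    (h : ∀ y ∈ U, S y = T y) {y : Coord n} (hy : y ∈ U) : cov G S y = cov G T y := by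
  funext I
  rw [cov_apply, cov_apply, h y hy, pd_congr_on hU (fun z hz => congrFun (h z hz) _) hy]

/-- The slot permutation of `∇` applied to a permuted tensor. -/
def succPerm (σ : Fin k ≃ Fin k') : Fin (k + 1) ≃ Fin (k' + 1) :=
  (finSuccEquiv k).trans ((Equiv.optionCongr σ).trans (finSuccEquiv k').symm)

@[simp] theorem succPerm_zero (σ : Fin k ≃ Fin k') : succPerm σ 0 = 0 := by simp [succPerm]

@[simp] theorem succPerm_succ (σ : Fin k ≃ Fin k') (s : Fin k) :
    succPerm σ s.succ = (σ s).succ := by simp [succPerm]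

theorem tail_comp_succPerm (σ : Fin k ≃ Fin k') (I : Fin (k' + 1) → Fin n) :
    Fin.tail (I ∘ succPerm σ) = Fin.tail I ∘ σ := by
  funext s; simp [Fin.tail]

theorem cov_perm (G : MetricField n) (σ : Fin k ≃ Fin k') (T : Field n k) :
    cov G (perm σ T) = perm (succPerm σ) (cov G T) := by
  funext y I
  simp only [perm, permC, cov_apply, tail_comp_succPerm]
  simp only [Function.comp_apply, succPerm_zero]
  congr 1
  exact congrFun (act_permC _ σ (T y)) (Fin.tail I)

end Fields

/-! ### Local data: a metric and a three-form on an open set of coordinates -/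

/-- A smooth metric and a smooth three-form on an open subset of `ℝⁿ`. -/
structure LocData (n : ℕ) where
  U : Set (Coord n)
  isOpen_U : IsOpen U
  G : MetricField n
  H : Field n 3
  smooth_G : ∀ i j, ContDiffOn ℝ ∞ (fun y => G y i j) U
  posDef : ∀ y ∈ U, (G y).PosDef
  smooth_H : ∀ I, ContDiffOn ℝ ∞ (fun y => H y I) U
  alt_H : ∀ y ∈ U, ∀ (I : Fin 3 → Fin n) (r s : Fin 3), r ≠ s →
    H y (I ∘ Equiv.swap r s) = -H y I

namespace LocData

variable {n k k' : ℕ} (D : LocData n)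

/-- Smoothness of a tensor field on the domain of the data. -/
def Smooth (T : Field n k) : Prop := ∀ I, ContDiffOn ℝ ∞ (fun y => T y I) D.U

variable {D}

theorem Smooth.differentiableAt {T : Field n k} (hT : D.Smooth T) {y : Coord n} (hy : y ∈ D.U)
    (I : Fin k → Fin n) : DifferentiableAt ℝ (fun z => T z I) y :=
  ((hT I).differentiableOn (by simp)).differentiableAt (D.isOpen_U.mem_nhds hy)

theorem isUnit_det {y : Coord n} (hy : y ∈ D.U) : IsUnit (D.G y).det :=
  (D.posDef y hy).det_pos.ne'.isUnit

theorem symm_G {y : Coord n} (hy : y ∈ D.U) (i j : Fin n) : D.G y i j = D.G y j i := by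
  have := (D.posDef y hy).isHermitian.apply j i
  simpa using this

theorem symm_inv {y : Coord n} (hy : y ∈ D.U) (i j : Fin n) : (D.G y)⁻¹ i j = (D.G y)⁻¹ j i := by
  have := (D.posDef y hy).inv.isHermitian.apply j i
  simpa using this

theorem inv_mul {y : Coord n} (hy : y ∈ D.U) : (D.G y)⁻¹ * D.G y = 1 :=
  Matrix.nonsing_inv_mul _ (isUnit_det hy)

theorem mul_inv {y : Coord n} (hy : y ∈ D.U) : D.G y * (D.G y)⁻¹ = 1 :=
  Matrix.mul_nonsing_inv _ (isUnit_det hy)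

theorem smooth_inv (i j : Fin n) : ContDiffOn ℝ ∞ (fun y => (D.G y)⁻¹ i j) D.U :=
  contDiffOn_inv_entry D.smooth_G (fun _ hy => (isUnit_det hy).ne_zero) i j

theorem differentiableAt_G {y : Coord n} (hy : y ∈ D.U) (i j : Fin n) :
    DifferentiableAt ℝ (fun z => D.G z i j) y :=
  ((D.smooth_G i j).differentiableOn (by simp)).differentiableAt (D.isOpen_U.mem_nhds hy)

theorem differentiableAt_inv {y : Coord n} (hy : y ∈ D.U) (i j : Fin n) :
    DifferentiableAt ℝ (fun z => (D.G z)⁻¹ i j) y :=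
  ((smooth_inv i j).differentiableOn (by simp)).differentiableAt (D.isOpen_U.mem_nhds hy)

theorem christoffel_symm {y : Coord n} (hy : y ∈ D.U) (c i j : Fin n) :
    christoffel D.G c i j y = christoffel D.G c j i y := by
  simp only [christoffel]
  congr 1
  refine Finset.sum_congr rfl fun l _ => ?_
  rw [pd_congr_on D.isOpen_U (fun z hz => symm_G hz i j) hy]
  ring

/-- Koszul's formula. It contains no inverse metric, which makes it the convenient form to
differentiate in time. -/
theorem lower_christoffel {y : Coord n} (hy : y ∈ D.U) (i j l : Fin n) :
    ∑ c, D.G y l c * christoffel D.G c i j y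
      = (1 / 2) * (pd i (fun z => D.G z j l) y + pd j (fun z => D.G z i l) y
        - pd l (fun z => D.G z i j) y) := by
  set w : Fin n → ℝ := fun l => pd i (fun z => D.G z j l) y + pd j (fun z => D.G z i l) y
        - pd l (fun z => D.G z i j) y
  have : (fun c => christoffel D.G c i j y) = (1 / 2 : ℝ) • ((D.G y)⁻¹).mulVec w := by
    funext c
    simp [christoffel, Matrix.mulVec, dotProduct, w]
  have h2 : ∑ c, D.G y l c * christoffel D.G c i j y
      = (D.G y).mulVec (fun c => christoffel D.G c i j y) l := rfl
  rw [h2, this, Matrix.mulVec_smul, Matrix.mulVec_mulVec, mul_inv hy, Matrix.one_mulVec]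
  rfl

/-- Metric compatibility `∇g = 0`: add Koszul's formula to itself with two indices exchanged. -/
theorem pd_metric {y : Coord n} (hy : y ∈ D.U) (p i j : Fin n) :
    pd p (fun z => D.G z i j) y = ∑ a, christoffel D.G a p i y * D.G y a j
      + ∑ a, christoffel D.G a p j y * D.G y i a := by
  have h1 := lower_christoffel hy p i j
  have h2 := lower_christoffel hy p j i
  have e : ∀ a b c : Fin n, pd a (fun z => D.G z b c) y = pd a (fun z => D.G z c b) y :=
    fun a b c => pd_congr_on D.isOpen_U (fun z hz => symm_G hz b c) hy
  have h3 : ∑ a, christoffel D.G a p i y * D.G y a j = ∑ c, D.G y j c * christoffel D.G c p i y :=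
    Finset.sum_congr rfl fun a _ => by rw [symm_G hy a j, mul_comm]
  have h4 : ∑ a, christoffel D.G a p j y * D.G y i a = ∑ c, D.G y i c * christoffel D.G c p j y :=
    Finset.sum_congr rfl fun a _ => by rw [mul_comm]
  rw [h3, h4, h1, h2, e p j i, e j p i, e i p j]
  rw [e i j p, e j i p]
  ring

/-- This is `∇g⁻¹ = 0`, obtained from `∇g = 0` by differentiating `g g⁻¹ = 1`. -/
theorem pd_inv {y : Coord n} (hy : y ∈ D.U) (p i j : Fin n) :
    pd p (fun z => (D.G z)⁻¹ i j) y = -(∑ a, christoffel D.G i p a y * (D.G y)⁻¹ a j)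
      - ∑ a, christoffel D.G j p a y * (D.G y)⁻¹ i a := by
  set M : Matrix (Fin n) (Fin n) ℝ := Matrix.of (chr D.G p y)
  set G' : Matrix (Fin n) (Fin n) ℝ := Matrix.of fun i j => pd p (fun z => D.G z i j) y
  set P' : Matrix (Fin n) (Fin n) ℝ := Matrix.of fun i j => pd p (fun z => (D.G z)⁻¹ i j) y
  have hG' : G' = M.transpose * D.G y + D.G y * M := by
    ext a b
    simp only [G', Matrix.of_apply, Matrix.add_apply, Matrix.mul_apply, Matrix.transpose_apply, M,
      chr, pd_metric hy]
    congr 1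
    exact Finset.sum_congr rfl fun _ _ => mul_comm _ _
  have h0 : G' * (D.G y)⁻¹ + D.G y * P' = 0 := by
    ext a b
    have e1 : pd p (fun z => ∑ c, D.G z a c * (D.G z)⁻¹ c b) y = 0 := by
      rw [pd_congr_on (h := fun _ => (1 : Matrix (Fin n) (Fin n) ℝ) a b) D.isOpen_U ?_ hy, pd_const]
      intro z hz
      rw [← mul_inv hz, Matrix.mul_apply]
    rw [pd_sum _ fun c _ => (differentiableAt_G hy a c).fun_mul (differentiableAt_inv hy c b)] at e1
    simp only [pd_mul (differentiableAt_G hy _ _) (differentiableAt_inv hy _ _),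
      Finset.sum_add_distrib] at e1
    exact e1
  have h1 := inv_deriv_eq (inv_mul hy) h0
  have h2 : P' = -((D.G y)⁻¹ * M.transpose) - M * (D.G y)⁻¹ := by
    rw [h1, hG', mul_add, add_mul, mul_assoc _ (M.transpose * _), mul_assoc M.transpose,
      mul_inv hy, mul_one, ← mul_assoc _ (D.G y) M, inv_mul hy, one_mul]
    abel
  have h3 := congrFun (congrFun h2 i) j
  simp only [P', Matrix.of_apply, Matrix.sub_apply, Matrix.neg_apply, Matrix.mul_apply,
    Matrix.transpose_apply, M, chr] at h3
  rw [h3]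
  have : ∑ x, (D.G y)⁻¹ i x * christoffel D.G j p x y
      = ∑ a, christoffel D.G j p a y * (D.G y)⁻¹ i a :=
    Finset.sum_congr rfl fun _ _ => mul_comm _ _
  rw [this]
  ring

/-- Since `∇g⁻¹ = 0`, covariant differentiation commutes with metric contraction. -/
theorem cov_contract {T : Field n (k + 2)} (hT : D.Smooth T) {y : Coord n} (hy : y ∈ D.U)
    (p : Fin n) (I : Fin k → Fin n) : cov D.G (contract D.G T) y (Fin.cons p I)
      = ∑ a, ∑ b, (D.G y)⁻¹ a b * cov D.G T y (Fin.cons p (Fin.cons a (Fin.cons b I))) := by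
  have hd : ∀ a b, DifferentiableAt ℝ
      (fun z => (D.G z)⁻¹ a b * T z (Fin.cons a (Fin.cons b I))) y := fun a b =>
    (differentiableAt_inv hy a b).fun_mul (hT.differentiableAt hy _)
  rw [cov_cons]
  simp only [contract, act_contrC]
  simp only [contrC]
  rw [pd_sum _ fun a _ => DifferentiableAt.fun_sum fun b _ => hd a b]
  simp only [pd_sum _ fun b _ => hd _ b,
    pd_mul (differentiableAt_inv hy _ _) (hT.differentiableAt hy _), cov_cons, act_cons,
    pd_inv hy, chr]
  simp only [mul_sub, sub_mul, mul_add, neg_mul, Finset.sum_add_distrib, Finset.sum_sub_distrib,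
    Finset.sum_neg_distrib, Finset.mul_sum, Finset.sum_mul]
  have e1 : ∀ X : Fin n → Fin n → Fin n → ℝ, ∑ a, ∑ b, ∑ c, X a b c = ∑ a, ∑ b, ∑ c, X c b a := by
    intro X
    rw [Finset.sum_congr rfl fun a _ => Finset.sum_comm, Finset.sum_comm]
    refine Finset.sum_congr rfl fun a _ => ?_
    rw [Finset.sum_comm]
  have e2 : ∀ X : Fin n → Fin n → Fin n → ℝ, ∑ a, ∑ b, ∑ c, X a b c = ∑ a, ∑ b, ∑ c, X a c b :=
    fun X => Finset.sum_congr rfl fun a _ => Finset.sum_comm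
  -- Dummy indices are renamed so that the terms from `∂g⁻¹` become the Christoffel corrections of
  -- the two contracted slots on the right-hand side.
  rw [e1 (fun a b c => christoffel D.G a p c y * (D.G y)⁻¹ c b * T y (Fin.cons a (Fin.cons b I))),
    e2 (fun a b c => christoffel D.G b p c y * (D.G y)⁻¹ a c * T y (Fin.cons a (Fin.cons b I)))]
  have e3 : ∀ a b c : Fin n, christoffel D.G c p a y * (D.G y)⁻¹ a b * T y (Fin.cons c (Fin.cons b I))
      = (D.G y)⁻¹ a b * (christoffel D.G c p a y * T y (Fin.cons c (Fin.cons b I))) := by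
    intros; ring
  have e4 : ∀ a b c : Fin n, christoffel D.G c p b y * (D.G y)⁻¹ a b * T y (Fin.cons a (Fin.cons c I))
      = (D.G y)⁻¹ a b * (christoffel D.G c p b y * T y (Fin.cons a (Fin.cons c I))) := by
    intros; ring
  simp only [e3, e4]
  ring

theorem cov_tprod {A : Field n k} {B : Field n k'} (hA : D.Smooth A) (hB : D.Smooth B)
    {y : Coord n} (hy : y ∈ D.U) (p : Fin n) (I : Fin (k + k') → Fin n) :
    cov D.G (tprod A B) y (Fin.cons p I)
      = cov D.G A y (Fin.cons p fun s => I (Fin.castAdd k' s)) * B y (fun s => I (Fin.natAdd k s))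
        + A y (fun s => I (Fin.castAdd k' s))
          * cov D.G B y (Fin.cons p fun s => I (Fin.natAdd k s)) := by
  simp only [cov_cons, tprod_apply, act_tmul]
  simp only [tmul, pd_mul (hA.differentiableAt hy _) (hB.differentiableAt hy _)]
  ring

end LocData

/-! ### Smooth families of tensor fields -/

section Families

variable {n k : ℕ} {J : Set ℝ} {U : Set (Coord n)}

theorem contDiffOn_christoffel_family (hJ : J.OrdConnected) (hJ' : J.Nontrivial) (hU : IsOpen U)
    {G : ℝ → MetricField n}
    (hG : ∀ i j, ContDiffOn ℝ ∞ (fun p : ℝ × Coord n => G p.1 p.2 i j) (J ×ˢ U))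
    (hdet : ∀ t ∈ J, ∀ y ∈ U, (G t y).det ≠ 0) (c i j : Fin n) :
    ContDiffOn ℝ ∞ (fun p : ℝ × Coord n => christoffel (G p.1) c i j p.2) (J ×ˢ U) := by
  have hp : ∀ a b d : Fin n, ContDiffOn ℝ ∞
      (fun p : ℝ × Coord n => pd a (fun z => G p.1 z b d) p.2) (J ×ˢ U) := fun a b d =>
    contDiffOn_pd_family hJ hJ' hU (f := fun t z => G t z b d) (hG b d) a
  have hi : ∀ a b, ContDiffOn ℝ ∞ (fun p : ℝ × Coord n => (G p.1 p.2)⁻¹ a b) (J ×ˢ U) :=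
    contDiffOn_inv_entry (A := fun p : ℝ × Coord n => G p.1 p.2) hG
      (fun p hp => hdet p.1 hp.1 p.2 hp.2)
  exact contDiffOn_const.mul (ContDiffOn.sum fun l _ =>
    (hi c l).mul (((hp _ _ _).add (hp _ _ _)).sub (hp _ _ _)))

theorem contDiffOn_cov_family (hJ : J.OrdConnected) (hJ' : J.Nontrivial) (hU : IsOpen U)
    {G : ℝ → MetricField n}
    (hG : ∀ i j, ContDiffOn ℝ ∞ (fun p : ℝ × Coord n => G p.1 p.2 i j) (J ×ˢ U))
    (hdet : ∀ t ∈ J, ∀ y ∈ U, (G t y).det ≠ 0) {T : ℝ → Field n k}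
    (hT : ∀ I, ContDiffOn ℝ ∞ (fun p : ℝ × Coord n => T p.1 p.2 I) (J ×ˢ U))
    (I : Fin (k + 1) → Fin n) :
    ContDiffOn ℝ ∞ (fun p : ℝ × Coord n => cov (G p.1) (T p.1) p.2 I) (J ×ˢ U) := by
  refine (contDiffOn_pd_family hJ hJ' hU (f := fun t z => T t z (Fin.tail I)) (hT _) (I 0)).sub
    (ContDiffOn.sum fun s _ => ContDiffOn.sum fun q _ => ?_)
  exact (contDiffOn_christoffel_family hJ hJ' hU hG hdet _ _ _).mul (hT _)

end Families

/-! ### Smoothness and linearity of covariant derivatives at a fixed time -/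

namespace LocData

variable {n k k' : ℕ} {D : LocData n}

/-- A static field is a constant family over all times, so that smoothness in space alone follows
from the lemmas on families by slicing. -/
theorem contDiffOn_const_family {f : Coord n → ℝ} {U : Set (Coord n)} (hf : ContDiffOn ℝ ∞ f U) :
    ContDiffOn ℝ ∞ (fun p : ℝ × Coord n => f p.2) (Set.univ ×ˢ U) :=
  hf.comp (f := fun p : ℝ × Coord n => p.2) contDiffOn_snd (fun _ hp => hp.2)

theorem smooth_pd {f : Coord n → ℝ} (hf : ContDiffOn ℝ ∞ f D.U) (i : Fin n) :
    ContDiffOn ℝ ∞ (pd i f) D.U :=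
  contDiffOn_slice (f := fun _ => pd i f) (contDiffOn_pd_family (f := fun _ => f) Set.ordConnected_univ
    Set.nontrivial_univ D.isOpen_U (contDiffOn_const_family hf) i) (Set.mem_univ (0 : ℝ))

theorem smooth_christoffel (c i j : Fin n) : ContDiffOn ℝ ∞ (christoffel D.G c i j) D.U :=
  contDiffOn_slice (f := fun _ => christoffel D.G c i j)
    (contDiffOn_christoffel_family Set.ordConnected_univ Set.nontrivial_univ D.isOpen_U
      (fun i j => contDiffOn_const_family (D.smooth_G i j))
      (fun _ _ _ hy => (isUnit_det hy).ne_zero) c i j) (Set.mem_univ (0 : ℝ))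

theorem Smooth.cov {T : Field n k} (hT : D.Smooth T) : D.Smooth (cov D.G T) := fun I =>
  contDiffOn_slice (f := fun _ y => GRF.cov D.G T y I)
    (contDiffOn_cov_family (T := fun _ => T) Set.ordConnected_univ Set.nontrivial_univ D.isOpen_U
      (fun i j => contDiffOn_const_family (D.smooth_G i j))
      (fun _ _ _ hy => (isUnit_det hy).ne_zero)
      (fun I => contDiffOn_const_family (hT I)) I) (Set.mem_univ (0 : ℝ))

theorem Smooth.iterCov {T : Field n k} (hT : D.Smooth T) : ∀ m, D.Smooth (iterCov D.G T m)
  | 0 => hT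
  | m + 1 => (Smooth.iterCov hT m).cov

theorem Smooth.perm {T : Field n k} (hT : D.Smooth T) (σ : Fin k ≃ Fin k') :
    D.Smooth (perm σ T) := fun I => hT (I ∘ σ)

theorem Smooth.contract {T : Field n (k + 2)} (hT : D.Smooth T) : D.Smooth (contract D.G T) :=
  fun I => ContDiffOn.sum (s := Finset.univ) fun a _ =>
    ContDiffOn.sum (s := Finset.univ) fun b _ =>
      (smooth_inv a b).mul (hT (Fin.cons a (Fin.cons b I)))

theorem Smooth.tprod {A : Field n k} {B : Field n k'} (hA : D.Smooth A) (hB : D.Smooth B) :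
    D.Smooth (tprod A B) := fun _ => (hA _).mul (hB _)

theorem Smooth.add {A B : Field n k} (hA : D.Smooth A) (hB : D.Smooth B) : D.Smooth (A + B) :=
  fun I => (hA I).add (hB I)

theorem Smooth.smul {A : Field n k} (c : ℝ) (hA : D.Smooth A) : D.Smooth (c • A) :=
  fun I => contDiffOn_const.mul (hA I)

theorem Smooth.congr {A B : Field n k} (hA : D.Smooth A) (h : ∀ y ∈ D.U, B y = A y) :
    D.Smooth B := fun I => (hA I).congr fun y hy => congrFun (h y hy) I

theorem smooth_H' : D.Smooth D.H := D.smooth_H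

theorem smooth_riem : D.Smooth (riem D.G) := fun _ =>
  ContDiffOn.sum fun _ _ => (D.smooth_G _ _).mul
    (((smooth_pd (smooth_christoffel _ _ _) _).sub (smooth_pd (smooth_christoffel _ _ _) _)).add
      (ContDiffOn.sum fun _ _ => ((smooth_christoffel _ _ _).mul (smooth_christoffel _ _ _)).sub
        ((smooth_christoffel _ _ _).mul (smooth_christoffel _ _ _))))

theorem differentiableAt_christoffel {y : Coord n} (hy : y ∈ D.U) (c i j : Fin n) :
    DifferentiableAt ℝ (christoffel D.G c i j) y :=
  ((smooth_christoffel c i j).differentiableOn (by simp)).differentiableAt (D.isOpen_U.mem_nhds hy)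

theorem cov_add {A B : Field n k} (hA : D.Smooth A) (hB : D.Smooth B) {y : Coord n}
    (hy : y ∈ D.U) : GRF.cov D.G (A + B) y = GRF.cov D.G A y + GRF.cov D.G B y := by
  funext I
  simp only [cov_apply, Pi.add_apply, act, slot, mul_add, Finset.sum_add_distrib,
    pd_add (hA.differentiableAt hy _) (hB.differentiableAt hy _)]
  ring

theorem cov_smul {A : Field n k} (c : ℝ) (hA : D.Smooth A) {y : Coord n} (hy : y ∈ D.U) :
    GRF.cov D.G (c • A) y = c • GRF.cov D.G A y := by
  funext I
  simp only [cov_apply, Pi.smul_apply, smul_eq_mul, act, slot, mul_left_comm _ c,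
    pd_const_mul c (hA.differentiableAt hy _), ← Finset.mul_sum]
  ring

theorem cov_sub {A B : Field n k} (hA : D.Smooth A) (hB : D.Smooth B) {y : Coord n}
    (hy : y ∈ D.U) : GRF.cov D.G (A - B) y = GRF.cov D.G A y - GRF.cov D.G B y := by
  have : A - B = A + (-1 : ℝ) • B := by simp [sub_eq_add_neg]
  rw [this, cov_add hA (hB.smul _) hy, cov_smul _ hB hy]
  simp [sub_eq_add_neg]

theorem cov_zero (y : Coord n) : GRF.cov D.G (0 : Field n k) y = 0 := by
  funext I
  simp [cov_apply, act, slot]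

/-! ### The Ricci identity -/

theorem pd_act {A : Fin n → Fin n → Coord n → ℝ} {T : Field n k} {y : Coord n}
    (hA : ∀ q i, DifferentiableAt ℝ (A q i) y) (hT : ∀ I, DifferentiableAt ℝ (fun z => T z I) y)
    (p : Fin n) (I : Fin k → Fin n) :
    pd p (fun z => act (fun q i => A q i z) (T z) I) y
      = act (fun q i => pd p (A q i) y) (T y) I
        + act (fun q i => A q i y) (fun J => pd p (fun z => T z J) y) I := by
  simp only [act, slot]
  rw [pd_sum _ fun s _ => DifferentiableAt.fun_sum fun q _ => (hA q (I s)).fun_mul (hT _)]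
  simp only [pd_sum _ fun q _ => (hA q _).fun_mul (hT _), pd_mul (hA _ _) (hT _),
    Finset.sum_add_distrib]

theorem act_sub_right (A : Fin n → Fin n → ℝ) (S T : Comp n k) (I : Fin k → Fin n) :
    act A (fun J => S J - T J) I = act A S I - act A T I := by
  simp [act, slot, mul_sub, Finset.sum_sub_distrib]

theorem act_add_left (A B : Fin n → Fin n → ℝ) (T : Comp n k) (I : Fin k → Fin n) :
    act (fun q i => A q i + B q i) T I = act A T I + act B T I := by
  simp [act, slot, add_mul, Finset.sum_add_distrib]

theorem riemUp_eq {y : Coord n} (hy : y ∈ D.U) (i j l h : Fin n) :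
    riemUp D.G i j l h y = ∑ m, (D.G y)⁻¹ h m * riem D.G y ![i, j, m, l] := by
  have e : ∀ m, riem D.G y ![i, j, m, l] = (D.G y).mulVec (fun a => riemUp D.G i j l a y) m := by
    intro m
    simp [riem, Matrix.mulVec, dotProduct, symm_G hy m]
  simp only [e]
  have := congrFun (Matrix.mulVec_mulVec (fun a => riemUp D.G i j l a y) (D.G y)⁻¹ (D.G y)) h
  rw [inv_mul hy, Matrix.one_mulVec] at this
  exact this.symm

/-- After expansion in coordinates, second partial derivatives cancel by symmetry, the correction of
the inner derivative slot cancels because `Γ` is torsion-free, and the mixed terms `Γ ∂T` occur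
symmetrically. What is left is `∂Γ` and the commutator of two `Γ`-actions, that is, the curvature
acting on each slot. -/
theorem ricci_identity {T : Field n k} (hT : D.Smooth T) {y : Coord n} (hy : y ∈ D.U)
    (p q : Fin n) (I : Fin k → Fin n) :
    GRF.cov D.G (GRF.cov D.G T) y (Fin.cons p (Fin.cons q I))
      - GRF.cov D.G (GRF.cov D.G T) y (Fin.cons q (Fin.cons p I))
      = -act (fun h i => riemUp D.G p q i h y) (T y) I := by
  have hpd : ∀ a J, DifferentiableAt ℝ (pd a fun z => T z J) y := fun a J =>
    ((smooth_pd (hT J) a).differentiableOn (by simp)).differentiableAt (D.isOpen_U.mem_nhds hy)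
  have hact : ∀ a, DifferentiableAt ℝ (fun z => act (chr D.G a z) (T z) I) y := fun a =>
    DifferentiableAt.fun_sum fun s _ => DifferentiableAt.fun_sum fun b _ =>
      (differentiableAt_christoffel hy _ _ _).fun_mul (hT.differentiableAt hy _)
  have key : ∀ a b, GRF.cov D.G (GRF.cov D.G T) y (Fin.cons a (Fin.cons b I))
      = pd a (pd b fun z => T z I) y
        - (act (fun q i => pd a (christoffel D.G q b i) y) (T y) I
          + act (chr D.G b y) (fun J => pd a (fun z => T z J) y) I)
        - (∑ c, christoffel D.G c a b y * GRF.cov D.G T y (Fin.cons c I)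
          + (act (chr D.G a y) (fun J => pd b (fun z => T z J) y) I
            - act (chr D.G a y) (act (chr D.G b y) (T y)) I)) := by
    intro a b
    rw [cov_cons, act_cons]
    simp only [cov_cons]
    rw [pd_sub (hpd b I) (hact b), act_sub_right]
    congr 2
    exact pd_act (fun q i => differentiableAt_christoffel hy q b i) (hT.differentiableAt hy) a I
  have e : (fun h i => riemUp D.G p q i h y) = fun h i =>
      (pd p (christoffel D.G h q i) y - pd q (christoffel D.G h p i) y)
        + ∑ x, (chr D.G p y h x * chr D.G q y x i - chr D.G q y h x * chr D.G p y x i) := rfl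
  rw [key, key, e, act_add_left, act_sub_left, ← act_act_sub, pd_comm D.isOpen_U (hT I) hy p q]
  simp only [christoffel_symm hy _ p q]
  ring

end LocData

/-! ### Universal tensors -/

/-- A rule that assigns a tensor field of rank `k` to local data. -/
abbrev TF (n k : ℕ) : Type := LocData n → Field n k

/-- The universal tensors that are linear combinations of contractions of products of `p` factors
`∇^i H` and `q` factors `∇^j Rm` with `l` derivatives in total. -/
inductive Poly {n : ℕ} : ℕ → ℕ → ℕ → (k : ℕ) → TF n k → Prop
  | nablaH (i : ℕ) : Poly 1 0 i (3 + i) fun D => iterCov D.G D.H i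
  | nablaRm (j : ℕ) : Poly 0 1 j (4 + j) fun D => iterCov D.G (riem D.G) j
  | tprod {p q l k p' q' l' k' : ℕ} {A : TF n k} {B : TF n k'} : Poly p q l k A →
      Poly p' q' l' k' B → Poly (p + p') (q + q') (l + l') (k + k') fun D => tprod (A D) (B D)
  | perm {p q l k k' : ℕ} {A : TF n k} (σ : Fin k ≃ Fin k') : Poly p q l k A →
      Poly p q l k' fun D => perm σ (A D)
  | contract {p q l k : ℕ} {A : TF n (k + 2)} : Poly p q l (k + 2) A →
      Poly p q l k fun D => contract D.G (A D)
  | add {p q l k : ℕ} {A B : TF n k} : Poly p q l k A → Poly p q l k B → Poly p q l k (A + B)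
  | smul {p q l k : ℕ} {A : TF n k} (c : ℝ) : Poly p q l k A → Poly p q l k (c • A)
  | zero {p q l k : ℕ} : Poly p q l k 0
  | congr {p q l k : ℕ} {A B : TF n k} : Poly p q l k A → (∀ D, ∀ y ∈ D.U, B D y = A D y) →
      Poly p q l k B

/-- A bijection between initial segments of the naturals, from an injection. -/
def finEquiv {a b : ℕ} (f : Fin a → Fin b) (hf : Function.Injective f) (h : a = b) :
    Fin a ≃ Fin b :=
  Equiv.ofBijective f ((Fintype.bijective_iff_injective_and_card f).2 ⟨hf, by simpa using h⟩)

@[simp] theorem finEquiv_apply {a b : ℕ} (f : Fin a → Fin b) (hf : Function.Injective f)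
    (h : a = b) (s : Fin a) : finEquiv f hf h s = f s := rfl

theorem append_injective {a b : ℕ} {α : Type*} {f : Fin a → α} {g : Fin b → α}
    (hf : Function.Injective f) (hg : Function.Injective g) (h : ∀ i j, f i ≠ g j) :
    Function.Injective (Fin.append f g) := by
  intro x y
  refine Fin.addCases (fun i => ?_) (fun i => ?_) x <;>
    refine Fin.addCases (fun j => ?_) (fun j => ?_) y
  · simp only [Fin.append_left]; exact fun e => congrArg _ (hf e)
  · simp only [Fin.append_left, Fin.append_right]; exact fun e => absurd e (h _ _)
  · simp only [Fin.append_left, Fin.append_right]; exact fun e => absurd e.symm (h _ _)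
  · simp only [Fin.append_right]; exact fun e => congrArg _ (hg e)

theorem cons_injective {a : ℕ} {α : Type*} {x : α} {f : Fin a → α}
    (hf : Function.Injective f) (h : ∀ i, f i ≠ x) :
    Function.Injective (Fin.cons x f : Fin (a + 1) → α) :=
  Fin.cons_injective_iff.2 ⟨fun ⟨i, hi⟩ => h i hi, hf⟩

/-- The cyclic permutation of the first three slots, `(i, j, k, …) ↦ (k, i, j, …)`. -/
def rot (k : ℕ) : Fin (k + 3) ≃ Fin (k + 3) :=
  finEquiv (Fin.cons (Fin.succ (Fin.succ 0)) (Fin.cons 0 (Fin.cons (Fin.succ 0) fun s => s.succ.succ.succ)))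
    (cons_injective (cons_injective (cons_injective (fun a b h => by simpa using h)
      (fun i h => by simp [Fin.ext_iff] at h)) (fun i => by
        refine Fin.cases ?_ (fun i => ?_) i <;> simp [Fin.ext_iff]))
      (fun i h => by
        have h := congrArg Fin.val h
        revert h
        refine Fin.cases ?_ (Fin.cases ?_ fun i => ?_) i <;>
          simp only [Fin.cons_zero, Fin.cons_succ, Fin.val_succ, Fin.val_zero] <;> omega)) rfl

/-- In `∇_c T_{ab…}` the derivative slot stands before the pair to be contracted; the rotation
places the pair in front, where `contract` expects it. -/
theorem cons_comp_rot {n k : ℕ} (a b c : Fin n) (I : Fin k → Fin n) :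
    (Fin.cons a (Fin.cons b (Fin.cons c I)) : Fin (k + 3) → Fin n) ∘ rot k
      = Fin.cons c (Fin.cons a (Fin.cons b I)) := by
  funext s
  refine Fin.cases rfl (fun s => ?_) s
  refine Fin.cases rfl (fun s => ?_) s
  refine Fin.cases rfl (fun s => ?_) s
  rfl

theorem cons_comp_swap {n k : ℕ} (a b : Fin n) (I : Fin k → Fin n) :
    (Fin.cons a (Fin.cons b I) : Fin (k + 2) → Fin n) ∘ Equiv.swap 0 1
      = Fin.cons b (Fin.cons a I) := by
  funext s
  refine Fin.cases (by simp) (fun s => ?_) s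
  refine Fin.cases (by simp) (fun s => ?_) s
  have : Equiv.swap (0 : Fin (k + 2)) 1 s.succ.succ = s.succ.succ :=
    Equiv.swap_apply_of_ne_of_ne (by simp [Fin.ext_iff]) (by simp [Fin.ext_iff])
  simp [this]

theorem cons_comp_succPerm {n k k' : ℕ} (σ : Fin k ≃ Fin k') (a : Fin n) (I : Fin k' → Fin n) :
    (Fin.cons a I : Fin (k' + 1) → Fin n) ∘ succPerm σ = Fin.cons a (I ∘ σ) := by
  funext s
  refine Fin.cases (by simp) (fun s => ?_) s
  simp

/-! ### Closure properties of the universal tensors -/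

namespace Poly

variable {n p q l k p' q' l' k' : ℕ} {A B : TF n k}

theorem of_eq (h : Poly p q l k A) (hp : p = p') (hq : q = q') (hl : l = l') :
    Poly p' q' l' k A := by
  subst hp hq hl; exact h

theorem sub (hA : Poly p q l k A) (hB : Poly p q l k B) : Poly p q l k (A - B) := by
  have : A - B = A + (-1 : ℝ) • B := by simp [sub_eq_add_neg]
  rw [this]
  exact hA.add (hB.smul _)

theorem neg (hA : Poly p q l k A) : Poly p q l k (-A) := by
  have : -A = (-1 : ℝ) • A := by simp
  rw [this]
  exact hA.smul _

theorem sum {ι : Type*} (s : Finset ι) {F : ι → TF n k} (h : ∀ a ∈ s, Poly p q l k (F a)) :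
    Poly p q l k (∑ a ∈ s, F a) := by
  classical
  induction s using Finset.induction_on with
  | empty => simpa using Poly.zero
  | insert a s ha ih =>
    rw [Finset.sum_insert ha]
    exact (h a (by simp)).add (ih fun b hb => h b (by simp [hb]))

theorem smooth (h : Poly p q l k A) (D : LocData n) : D.Smooth (A D) := by
  induction h with
  | nablaH i => exact LocData.smooth_H'.iterCov i
  | nablaRm j => exact LocData.smooth_riem.iterCov j
  | tprod _ _ hA hB => exact hA.tprod hB
  | perm σ _ h => exact h.perm σ
  | contract _ h => exact h.contract
  | add _ _ hA hB => exact hA.add hB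
  | smul c _ h => exact h.smul c
  | zero => exact fun _ => contDiffOn_const
  | congr _ e h => exact h.congr (e D)

/-- The position of the slots in `A ⊗ ∇B`, in terms of those of `∇(A ⊗ B)`. -/
def leibnizPerm (k k' : ℕ) : Fin (k + (k' + 1)) ≃ Fin (k + k' + 1) :=
  finEquiv (Fin.append (fun s : Fin k => (Fin.castAdd k' s).succ)
      (Fin.cons 0 fun s : Fin k' => (Fin.natAdd k s).succ))
    (append_injective (fun a b h => by simpa using h)
      (cons_injective (fun a b h => by simpa using h) fun i => Fin.succ_ne_zero _)
      (fun i j => by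
        refine Fin.cases ?_ (fun j => ?_) j
        · simp
        · intro h
          simp only [Fin.cons_succ] at h
          have := congrArg Fin.val h
          simp at this
          omega)) (by omega)

theorem cov_tprod_eq {D : LocData n} {A : Field n k} {B : Field n k'} (hA : D.Smooth A)
    (hB : D.Smooth B) {y : Coord n} (hy : y ∈ D.U) : cov D.G (GRF.tprod A B) y
      = GRF.perm (finCongr (by omega : k + 1 + k' = k + k' + 1))
          (GRF.tprod (cov D.G A) B) y
        + GRF.perm (leibnizPerm k k') (GRF.tprod A (cov D.G B)) y := by
  funext I
  obtain ⟨a, I, rfl⟩ : ∃ a J, I = Fin.cons a J := ⟨I 0, Fin.tail I, (Fin.cons_self_tail I).symm⟩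
  rw [LocData.cov_tprod hA hB hy]
  simp only [Pi.add_apply, GRF.perm, permC, GRF.tprod]
  congr 1
  · congr 2
    funext s
    refine Fin.cases ?_ (fun s => ?_) s
    · rfl
    · rfl
    · funext s
      have : (finCongr (by omega : k + 1 + k' = k + k' + 1)) (Fin.natAdd (k + 1) s)
          = (Fin.natAdd k s).succ := by
        ext; simp; omega
      simp only [Function.comp_apply, this, Fin.cons_succ]
  · congr 2
    · funext s
      simp [leibnizPerm]
    · funext s
      refine Fin.cases ?_ (fun s => ?_) s <;> simp [leibnizPerm]

theorem cov_contract_eq {D : LocData n} {T : Field n (k + 2)} (hT : D.Smooth T) {y : Coord n}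
    (hy : y ∈ D.U) : cov D.G (GRF.contract D.G T) y
      = GRF.contract D.G (GRF.perm (rot k) (cov D.G T)) y := by
  funext I
  obtain ⟨a, I, rfl⟩ : ∃ a J, I = Fin.cons a J := ⟨I 0, Fin.tail I, (Fin.cons_self_tail I).symm⟩
  rw [LocData.cov_contract hT hy]
  simp only [GRF.contract, contrC, GRF.perm, permC, cons_comp_rot]

/-- Each constructor is compatible with `∇`: atoms gain a derivative, products follow Leibniz, and
permutations and contractions commute with `∇`. The number of factors does not change; only the
derivative count rises by one. -/
theorem cov (h : Poly p q l k A) : Poly p q (l + 1) (k + 1) fun D => cov D.G (A D) := by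
  induction h with
  | nablaH i => exact nablaH (i + 1)
  | nablaRm j => exact nablaRm (j + 1)
  | tprod hA hB ihA ihB =>
    refine congr (((((ihA.tprod hB).perm (finCongr (by omega))).of_eq rfl rfl (by omega)).add
      ((hA.tprod ihB).perm (leibnizPerm _ _)))) fun D y hy => ?_
    exact cov_tprod_eq (hA.smooth D) (hB.smooth D) hy
  | perm σ _ h => exact congr (h.perm (succPerm σ)) fun D y _ => by rw [cov_perm]
  | contract hA ih =>
    exact congr (ih.perm (rot _)).contract fun D y hy => cov_contract_eq (hA.smooth D) hy
  | add hA hB ihA ihB =>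
    exact congr (ihA.add ihB) fun D y hy => LocData.cov_add (hA.smooth D) (hB.smooth D) hy
  | smul c hA ih => exact congr (ih.smul c) fun D y hy => LocData.cov_smul c (hA.smooth D) hy
  | zero => exact congr zero fun D y _ => LocData.cov_zero y
  | congr _ e ih => exact congr ih fun D y hy => cov_congr D.isOpen_U _ (e D) hy

theorem lap (h : Poly p q l k A) : Poly p q (l + 2) k fun D => lap D.G (A D) :=
  h.cov.cov.contract

/-! ### Actions by tensors -/

/-- The tensor `B` of rank `c + 2`, with its first index raised, acting on `T`. -/
def actBy {r c : ℕ} (G : MetricField n) (f : Fin c → Fin r) (h : Fin k → Fin r)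
    (B : Field n (c + 2)) (T : Field n k) : Field n r := fun y I =>
  act (fun a i => ∑ b, (G y)⁻¹ a b * B y (Fin.cons b (Fin.cons i (I ∘ f)))) (T y) (I ∘ h)

/-- The action is a sum over the slots of `A`; each summand is one permutation of `B ⊗ A` followed
by one contraction. -/
theorem actBy_poly {r c : ℕ} {f : Fin c → Fin r} {h : Fin k → Fin r} (hr : c + k = r)
    (hf : Function.Injective f) (hh : Function.Injective h) (hfh : ∀ i j, f i ≠ h j)
    {B : TF n (c + 2)} (hB : Poly p q l (c + 2) B) (hA : Poly p' q' l' k A) :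
    Poly (p + p') (q + q') (l + l') r fun D => actBy D.G f h (B D) (A D) := by
  -- Positions `0` and `1` are the contracted pair: slot `s` of `A` goes to `0` and the raised index
  -- of `B` to `1`. The second index of `B` takes over the place that slot `s` vacates.
  let σ : Fin k → (Fin (c + 2 + k) ≃ Fin (r + 2)) := fun s =>
    finEquiv (Fin.append
      (Fin.cons 1 (Fin.cons (h s).succ.succ fun x => (f x).succ.succ))
      (fun u => if u = s then 0 else (h u).succ.succ))
    (append_injective
      (cons_injective (cons_injective (fun a b e => hf (by simpa using e))
        (fun i e => hfh i s (by simpa using e))) (fun i => by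
          refine Fin.cases ?_ (fun i => ?_) i <;> simp [Fin.ext_iff]))
      (fun a b e => by
        by_cases ha : a = s <;> by_cases hb : b = s
        · rw [ha, hb]
        · simp [ha, hb, Fin.ext_iff] at e
        · simp [ha, hb, Fin.ext_iff] at e
        · simp only [ha, hb, if_false] at e
          exact hh (by simpa using e))
      (fun i j => by
        by_cases hj : j = s
        · refine Fin.cases ?_ (fun i => Fin.cases ?_ (fun i => ?_) i) i <;>
            simp [hj, Fin.ext_iff]
        · refine Fin.cases ?_ (fun i => Fin.cases ?_ (fun i => ?_) i) i
          · simp [hj, Fin.ext_iff]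
          · simpa [hj] using fun e => hj (hh e).symm
          · simpa [hj] using hfh i j)) (by omega)
  refine congr (Poly.sum Finset.univ fun s _ => ((hB.tprod hA).perm (σ s)).contract)
    fun D y hy => ?_
  funext I
  simp only [Finset.sum_apply, actBy, act]
  refine Finset.sum_congr rfl fun s _ => ?_
  simp only [slot, GRF.contract, contrC, GRF.perm, permC, GRF.tprod, Finset.sum_mul]
  refine Finset.sum_congr rfl fun a _ => Finset.sum_congr rfl fun b _ => ?_
  rw [mul_assoc]
  congr 3
  · funext x
    refine Fin.cases ?_ (fun x => Fin.cases ?_ (fun x => ?_) x) x <;> simp [σ]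
  · funext u
    by_cases hu : u = s
    · subst hu; simp [σ]
    · simp [σ, hu]

end Poly

/-! ### Commuting covariant derivatives -/

section Commutator

variable {n p q l k p' q' l' k' : ℕ} {A : TF n k}

/-- The commutator `∇_p ∇_q T - ∇_q ∇_p T`. -/
def comm (G : MetricField n) (T : Field n k) : Field n (k + 2) :=
  cov G (cov G T) - perm (Equiv.swap 0 1) (cov G (cov G T))

theorem comm_cons (G : MetricField n) (T : Field n k) (y : Coord n) (a b : Fin n)
    (I : Fin k → Fin n) : comm G T y (Fin.cons a (Fin.cons b I))
      = cov G (cov G T) y (Fin.cons a (Fin.cons b I))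
        - cov G (cov G T) y (Fin.cons b (Fin.cons a I)) := by
  simp only [comm, Pi.sub_apply, perm, permC, cons_comp_swap]

/-- The pairing of slots by which the curvature acts in the Ricci identity. -/
def riemPerm : Fin 4 ≃ Fin (2 + 2) := finEquiv ![2, 3, 0, 1] (by decide) rfl

theorem exists_cons {k : ℕ} (I : Fin (k + 1) → Fin n) : ∃ a J, I = Fin.cons a J :=
  ⟨I 0, Fin.tail I, (Fin.cons_self_tail I).symm⟩

/-- By the Ricci identity the two derivatives are traded for one undifferentiated factor `Rm`; hence
`q` goes up by one and `l` does not move. -/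
theorem Poly.comm (h : Poly p q l k A) : Poly p (q + 1) l (k + 2) fun D => comm D.G (A D) := by
  have hB : Poly (n := n) 0 1 0 (2 + 2) fun D => GRF.perm riemPerm (riem D.G) :=
    (Poly.nablaRm 0).perm riemPerm
  have h1 := (actBy_poly (f := ![0, 1]) (h := fun s : Fin k => s.succ.succ) (r := k + 2)
    (by omega) (by
      intro a b e
      fin_cases a <;> fin_cases b <;> simp at e ⊢) (fun a b e => by simpa using e)
    (fun i j => by fin_cases i <;> simp [Fin.ext_iff]) hB h)
  refine Poly.congr (h1.neg.of_eq (by omega) (by omega) (by omega)) fun D y hy => ?_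
  funext I
  obtain ⟨a, I, rfl⟩ := exists_cons I
  obtain ⟨b, I, rfl⟩ := exists_cons I
  rw [comm_cons, LocData.ricci_identity (h.smooth D) hy]
  simp only [Pi.neg_apply, Poly.actBy]
  congr 2
  funext x i
  rw [LocData.riemUp_eq hy]
  refine Finset.sum_congr rfl fun m _ => ?_
  congr 2
  funext s
  fin_cases s <;> simp [riemPerm] <;> rfl

/-- `∇ Δ T - Δ ∇ T` involves one factor of the curvature. -/
theorem Poly.cov_lap_sub (h : Poly p q l k A) :
    Poly p (q + 1) (l + 1) (k + 1) fun D => GRF.cov D.G (GRF.lap D.G (A D))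
      - GRF.lap D.G (GRF.cov D.G (A D)) := by
  -- The two steps of moving `∇_c` inward past `g^{ab} ∇_a ∇_b`: this term is `g^{ab} [∇_c, ∇_a] ∇_b
  -- T`, and the next one is `g^{ab} ∇_a [∇_c, ∇_b] T`.
  have h1 : Poly p (q + 1) (l + 1) (k + 1) fun D =>
      GRF.contract D.G (GRF.perm (rot k) (GRF.comm D.G (GRF.cov D.G (A D)))) :=
    (h.cov.comm.perm (rot k)).contract
  have h2 : Poly p (q + 1) (l + 1) (k + 1) fun D => GRF.contract D.G
      (GRF.perm (succPerm (Equiv.swap 0 1)) (GRF.cov D.G (GRF.comm D.G (A D)))) :=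
    (h.comm.cov.perm (succPerm (Equiv.swap 0 1))).contract
  refine Poly.congr (h1.add h2) fun D y hy => ?_
  funext I
  obtain ⟨c, I, rfl⟩ := exists_cons I
  have hs := h.smooth D
  have hc : GRF.cov D.G (GRF.comm D.G (A D)) y
      = GRF.cov D.G (GRF.cov D.G (GRF.cov D.G (A D))) y
        - GRF.perm (succPerm (Equiv.swap 0 1)) (GRF.cov D.G (GRF.cov D.G (GRF.cov D.G (A D)))) y := by
    rw [GRF.comm, LocData.cov_sub hs.cov.cov (hs.cov.cov.perm _) hy, cov_perm]
  simp only [Pi.sub_apply, Pi.add_apply, lap_eq]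
  rw [LocData.cov_contract hs.cov.cov hy]
  simp only [GRF.contract, contrC, GRF.perm, permC, hc, Pi.sub_apply, cons_comp_succPerm,
    cons_comp_swap, cons_comp_rot, comm_cons]
  rw [← Finset.sum_sub_distrib, ← Finset.sum_add_distrib]
  refine Finset.sum_congr rfl fun a _ => ?_
  rw [← Finset.sum_sub_distrib, ← Finset.sum_add_distrib]
  refine Finset.sum_congr rfl fun b _ => ?_
  ring

end Commutator

/-! ### The Weitzenböck formula -/

section Weitzenboeck

variable {n : ℕ}

/-- The permutation that moves the slot `s` to the front. -/
def frontPerm {p : ℕ} (s : Fin (p + 1)) : Fin (p + 1) ≃ Fin (p + 1) :=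
  finEquiv (Fin.cons s s.succAbove)
    (cons_injective Fin.succAbove_right_injective fun i => Fin.succAbove_ne s i) rfl

theorem comp_frontPerm {p : ℕ} (s : Fin (p + 1)) (I : Fin (p + 1) → Fin n) :
    I ∘ frontPerm s = Fin.cons (I s) (I ∘ s.succAbove) := by
  funext r
  refine Fin.cases ?_ (fun r => ?_) r <;> simp [frontPerm]

/-- The components are antisymmetric. -/
def IsAlt {p : ℕ} (T : Comp n p) : Prop :=
  ∀ (I : Fin p → Fin n) (r s : Fin p), r ≠ s → T (I ∘ Equiv.swap r s) = -T I

/-- In the antisymmetrisation of `∇α` each Christoffel term is matched by one with its two lower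
indices exchanged and the opposite sign, so symmetry of `Γ` makes the sum vanish. Rank two is needed
for `d^*H`. -/
theorem sum_act_two {Γ : Fin n → Fin n → Fin n → ℝ} (hΓ : ∀ c i j, Γ c i j = Γ c j i)
    {T : Comp n 2} (hT : IsAlt T) (I : Fin 3 → Fin n) :
    ∑ s : Fin 3, (-1) ^ (s : ℕ) * act (fun q i => Γ q (I s) i) T (I ∘ s.succAbove) = 0 := by
  have e : ∀ X : Fin 2 → Fin n, T X = T ![X 0, X 1] := fun X => by
    congr 1; funext s; fin_cases s <;> rfl
  have hsw : ∀ a b, T ![a, b] = -T ![b, a] := fun a b => by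
    rw [← hT _ 0 1 (by decide)]
    congr 1; funext s; fin_cases s <;> simp
  have hF : ∀ x y z, ∑ q, Γ q x y * T ![z, q] = -∑ q, Γ q y x * T ![q, z] := by
    intro x y z
    rw [← Finset.sum_neg_distrib]
    exact Finset.sum_congr rfl fun q _ => by rw [hsw, hΓ]; ring
  have hG : ∀ x y z, ∑ q, Γ q x y * T ![q, z] = ∑ q, Γ q y x * T ![q, z] := fun x y z =>
    Finset.sum_congr rfl fun q _ => by rw [hΓ]
  simp only [act, slot, Fin.sum_univ_succ, Fin.sum_univ_zero]
  simp only [e (Function.update _ _ _)]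
  simp [Fin.succAbove, hF]
  rw [hG (I 1) (I 0), hG (I 2) (I 0), hG (I 2) (I 1)]
  ring

/-- The same cancellation in rank three, needed for `H` itself. -/
theorem sum_act_three {Γ : Fin n → Fin n → Fin n → ℝ} (hΓ : ∀ c i j, Γ c i j = Γ c j i)
    {T : Comp n 3} (hT : IsAlt T) (I : Fin 4 → Fin n) :
    ∑ s : Fin 4, (-1) ^ (s : ℕ) * act (fun q i => Γ q (I s) i) T (I ∘ s.succAbove) = 0 := by
  have e : ∀ X : Fin 3 → Fin n, T X = T ![X 0, X 1, X 2] := fun X => by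
    congr 1; funext s; fin_cases s <;> rfl
  have h01 : ∀ a b c, T ![a, b, c] = -T ![b, a, c] := fun a b c => by
    rw [← hT _ 0 1 (by decide)]
    congr 1; funext s; fin_cases s <;> simp [Equiv.swap_apply_def]
  have h12 : ∀ a b c, T ![a, b, c] = -T ![a, c, b] := fun a b c => by
    rw [← hT _ 1 2 (by decide)]
    congr 1; funext s; fin_cases s <;> simp [Equiv.swap_apply_def]
  have hF : ∀ x y z w, ∑ q, Γ q x y * T ![z, q, w] = -∑ q, Γ q y x * T ![q, z, w] := by
    intro x y z w
    rw [← Finset.sum_neg_distrib]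
    exact Finset.sum_congr rfl fun q _ => by rw [h01, hΓ]; ring
  have hF' : ∀ x y z w, ∑ q, Γ q x y * T ![z, w, q] = ∑ q, Γ q y x * T ![q, z, w] := by
    intro x y z w
    exact Finset.sum_congr rfl fun q _ => by rw [h12, h01, hΓ]; ring
  have hG : ∀ x y z w, ∑ q, Γ q x y * T ![q, z, w] = ∑ q, Γ q y x * T ![q, z, w] :=
    fun x y z w => Finset.sum_congr rfl fun q _ => by rw [hΓ]
  simp only [act, slot, Fin.sum_univ_succ, Fin.sum_univ_zero]
  simp only [e (Function.update _ _ _)]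
  simp [Fin.succAbove, hF, hF']
  rw [hG (I 1) (I 0), hG (I 2) (I 0), hG (I 2) (I 1), hG (I 3) (I 0), hG (I 3) (I 1),
    hG (I 3) (I 2)]
  ring

/-- Once the Christoffel terms cancel, partial derivatives in `d` may be replaced by covariant ones.
-/
theorem extD_eq_of_sum_act {p : ℕ} {G : MetricField n} {α : Field n p} {y : Coord n}
    (h : ∀ I : Fin (p + 1) → Fin n, ∑ s : Fin (p + 1), (-1) ^ (s : ℕ) *
      act (fun q i => christoffel G q (I s) i y) (α y) (I ∘ s.succAbove) = 0) :
    extD α y = (∑ s : Fin (p + 1), ((-1) ^ (s : ℕ) : ℝ) • perm (frontPerm s) (cov G α)) y := by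
  funext I
  simp only [Finset.sum_apply, Pi.smul_apply, smul_eq_mul, perm, permC, comp_frontPerm, cov_cons,
    mul_sub, Finset.sum_sub_distrib]
  have h' := h I
  change _ = _ - ∑ s : Fin (p + 1), (-1) ^ (s : ℕ) *
      act (fun q i => christoffel G q (I s) i y) (α y) (I ∘ s.succAbove)
  rw [h', sub_zero]
  rfl

namespace LocData

variable {D : LocData n}

/-- `∇_p H` inherits antisymmetry in the slots of `H`, since `∇` commutes with slot permutations,
and the contraction leaves two of these slots free. -/
theorem isAlt_coD {y : Coord n} (hy : y ∈ D.U) : IsAlt (coD D.G D.H y) := by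
  have key : ∀ (p : Fin n) (I : Fin 3 → Fin n) (r s : Fin 3), r ≠ s →
      cov D.G D.H y (Fin.cons p (I ∘ Equiv.swap r s)) = -cov D.G D.H y (Fin.cons p I) := by
    intro p I r s hrs
    have h1 : cov D.G (perm (Equiv.swap r s) D.H) y = cov D.G ((-1 : ℝ) • D.H) y :=
      cov_congr D.isOpen_U _ (fun z hz => by
        funext I
        simpa [perm, permC] using D.alt_H z hz I r s hrs) hy
    rw [cov_perm, cov_smul _ smooth_H' hy] at h1
    have h2 := congrFun h1 (Fin.cons p I)
    simpa [perm, permC, cons_comp_succPerm] using h2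
  have cons_swap : ∀ (b : Fin n) (I : Fin 2 → Fin n) (r s : Fin 2),
      (Fin.cons b (I ∘ Equiv.swap r s) : Fin 3 → Fin n)
        = (Fin.cons b I : Fin 3 → Fin n) ∘ Equiv.swap r.succ s.succ := by
    intro b I r s
    funext x
    refine Fin.cases ?_ (fun x => ?_) x
    · rw [Function.comp_apply, Equiv.swap_apply_of_ne_of_ne (Fin.succ_ne_zero _).symm
        (Fin.succ_ne_zero _).symm]
      rfl
    · simp only [Fin.cons_succ, Function.comp_apply, Equiv.swap_apply_def, Fin.succ_inj]
      split_ifs <;> simp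
  intro I r s hrs
  simp only [coD, cons_swap]
  simp only [key _ _ _ _ (fun h => hrs (Fin.succ_inj.1 h)), mul_neg, Finset.sum_neg_distrib]

theorem extD_H {y : Coord n} (hy : y ∈ D.U) : extD D.H y
    = (∑ s : Fin 4, ((-1) ^ (s : ℕ) : ℝ) • perm (frontPerm s) (cov D.G D.H)) y :=
  extD_eq_of_sum_act fun I => sum_act_three (Γ := fun q i j => christoffel D.G q i j y)
    (fun c i j => christoffel_symm hy c i j) (D.alt_H y hy) I

theorem extD_coD {y : Coord n} (hy : y ∈ D.U) : extD (coD D.G D.H) y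
    = (∑ s : Fin 3, ((-1) ^ (s : ℕ) : ℝ) • perm (frontPerm s) (cov D.G (coD D.G D.H))) y :=
  extD_eq_of_sum_act fun I => sum_act_two (Γ := fun q i j => christoffel D.G q i j y)
    (fun c i j => christoffel_symm hy c i j) (isAlt_coD hy) I

theorem coD_eq {k : ℕ} (G : MetricField n) (T : Field n (k + 1)) :
    coD G T = (-1 : ℝ) • contract G (cov G T) := by
  funext y I
  simp [coD, contract, contrC]

theorem cov_sum {ι : Type*} {k : ℕ} (t : Finset ι) {F : ι → Field n k}
    (hF : ∀ a ∈ t, D.Smooth (F a)) {y : Coord n} (hy : y ∈ D.U) :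
    D.Smooth (∑ a ∈ t, F a) ∧ cov D.G (∑ a ∈ t, F a) y = ∑ a ∈ t, cov D.G (F a) y := by
  classical
  induction t using Finset.induction_on with
  | empty => exact ⟨fun _ => contDiffOn_const, by simpa using cov_zero y⟩
  | insert a t ha ih =>
    have h1 := hF a (by simp)
    obtain ⟨h2, h3⟩ := ih fun b hb => hF b (by simp [hb])
    rw [Finset.sum_insert ha, Finset.sum_insert ha]
    exact ⟨h1.add h2, by rw [cov_add h1 h2 hy, h3]⟩

theorem cons_comp_frontPerm_succ {p : ℕ} (b : Fin n) (s : Fin (p + 1)) (I : Fin (p + 1) → Fin n) :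
    (Fin.cons b I : Fin (p + 2) → Fin n) ∘ frontPerm s.succ
      = Fin.cons (I s) (Fin.cons b (I ∘ s.succAbove)) := by
  rw [comp_frontPerm]
  funext x
  refine Fin.cases (by simp) (fun x => ?_) x
  refine Fin.cases (by simp) (fun x => ?_) x
  simp [Fin.removeNth]

theorem cons_comp_frontPerm_zero {p : ℕ} (b : Fin n) (I : Fin p → Fin n) :
    (Fin.cons b I : Fin (p + 1) → Fin n) ∘ frontPerm 0 = Fin.cons b I := by
  rw [comp_frontPerm]
  funext x
  refine Fin.cases (by simp) (fun x => ?_) x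
  simp

/-- In `-d^*dH` the summand of `d` that differentiates along the contracted index is `ΔH`. The other
summands are `∓ g^{ab} ∇_a ∇_{i_s} H_{b…}`, and `-dd^*H` supplies the same terms with opposite sign
and the derivatives interchanged. The difference is a sum of commutators. -/
theorem box_eq {y : Coord n} (hy : y ∈ D.U) : box D.G D.H y = lap D.G D.H y
    + ∑ s : Fin 3, ((-1) ^ (s : ℕ) : ℝ) •
        perm (frontPerm s) (contract D.G (perm (rot 2) (comm D.G D.H))) y := by
  have hN : D.Smooth (cov D.G D.H) := smooth_H'.cov
  have h1 : cov D.G (extD D.H) y = ∑ s : Fin 4, ((-1) ^ (s : ℕ) : ℝ) •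
      perm (succPerm (frontPerm s)) (cov D.G (cov D.G D.H)) y := by
    rw [cov_congr D.isOpen_U D.G (fun z hz => extD_H hz) hy,
      (cov_sum _ (fun s _ => (hN.perm _).smul _) hy).2]
    refine Finset.sum_congr rfl fun s _ => ?_
    rw [cov_smul _ (hN.perm _) hy, cov_perm]
  have h2 : cov D.G (coD D.G D.H) y
      = (-1 : ℝ) • contract D.G (perm (rot 2) (cov D.G (cov D.G D.H))) y := by
    rw [coD_eq, cov_smul _ hN.contract hy, Poly.cov_contract_eq hN hy]
  funext I
  have h3 : coD D.G (extD D.H) y I = -contrC (D.G y)⁻¹ (cov D.G (extD D.H) y) I := rfl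
  rw [box, h3, h1, extD_coD hy]
  simp only [Finset.sum_apply, Pi.smul_apply, perm, permC, h2, smul_eq_mul, lap_eq, Pi.add_apply]
  simp only [contract, contrC, comp_frontPerm, perm, permC, cons_comp_rot, comm_cons,
    Finset.sum_apply, Pi.smul_apply, smul_eq_mul, cons_comp_succPerm]
  -- Splits off `s = 0`, the summand that becomes the rough Laplacian; the shift from `s + 1` to `s`
  -- produces the minus sign.
  have h4 : ∀ (a b : Fin n), ∑ s : Fin 4, (-1 : ℝ) ^ (s : ℕ) *
      cov D.G (cov D.G D.H) y (Fin.cons a (Fin.cons ((Fin.cons b I : Fin 4 → Fin n) s)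
        ((Fin.cons b I : Fin 4 → Fin n) ∘ s.succAbove)))
      = cov D.G (cov D.G D.H) y (Fin.cons a (Fin.cons b I))
        - ∑ s : Fin 3, (-1 : ℝ) ^ (s : ℕ) * cov D.G (cov D.G D.H) y
          (Fin.cons a (Fin.cons (I s) (Fin.cons b (I ∘ s.succAbove)))) := by
    intro a b
    simp only [← comp_frontPerm]
    rw [Fin.sum_univ_succ]
    simp only [cons_comp_frontPerm_succ, cons_comp_frontPerm_zero, Fin.val_succ, pow_succ,
      Fin.val_zero]
    rw [sub_eq_add_neg, ← Finset.sum_neg_distrib]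
    congr 1
    · ring
    · exact Finset.sum_congr rfl fun s _ => by ring
  simp only [h4]
  simp only [mul_sub, Finset.sum_sub_distrib, Finset.mul_sum]
  have h5 : ∀ X : Fin n → Fin n → Fin 3 → ℝ,
      ∑ a, ∑ b, ∑ s, X a b s = ∑ s, ∑ a, ∑ b, X a b s := by
    intro X
    rw [Finset.sum_congr rfl fun a _ => Finset.sum_comm, Finset.sum_comm]
  rw [h5]
  simp only [mul_left_comm ((D.G y)⁻¹ _ _) ((-1) ^ _)]
  simp only [mul_neg, neg_mul, one_mul, Finset.sum_neg_distrib]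
  ring

end LocData

theorem exists_box_eq : ∃ P : TF n 3, Poly 1 1 0 3 P ∧
    ∀ D : LocData n, ∀ y ∈ D.U, box D.G D.H y = lap D.G D.H y + P D y := by
  refine ⟨∑ s : Fin 3, ((-1) ^ (s : ℕ) : ℝ) • (fun D =>
    perm (frontPerm s) (contract D.G (perm (rot 2) (comm D.G D.H))) : TF n 3), ?_, fun D y hy => ?_⟩
  · refine Poly.sum _ fun s _ => Poly.smul _ (Poly.perm _ (Poly.contract (Poly.perm _ ?_)))
    exact ((Poly.nablaH 0).comm).of_eq rfl rfl rfl
  · rw [LocData.box_eq hy]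
    simp only [Finset.sum_apply, Pi.smul_apply]

end Weitzenboeck

/-! ### The velocity of the metric and of the Christoffel symbols -/

section Velocity

variable {n : ℕ}

/-- The part `-2 R_{ij}` of the velocity of the metric. -/
def ricPart (G : MetricField n) : Field n 2 := fun y I => -2 * ric G (I 0) (I 1) y

/-- The part `½ H_{ikl} H_j{}^{kl}` of the velocity of the metric. -/
def formPart (G : MetricField n) (H : Field n 3) : Field n 2 := fun y I =>
  (1 / 2) * hTerm G H (I 0) (I 1) y

theorem poly_ricPart : Poly (n := n) 0 1 0 2 fun D => ricPart D.G := by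
  let σ : Fin 4 ≃ Fin (2 + 2) := finEquiv ![2, 0, 3, 1] (by decide) rfl
  have h : Poly (n := n) 0 1 0 2 ((-2 : ℝ) • (fun D => contract D.G (perm σ (riem D.G)) : TF n 2)) :=
    (((Poly.nablaRm 0).perm σ).contract).smul (-2)
  refine Poly.congr h fun D y _ => ?_
  funext I
  simp only [ricPart, ric, Pi.smul_apply, smul_eq_mul, contract, contrC, perm, permC]
  congr 1

theorem poly_formPart : Poly (n := n) 2 0 0 2 fun D => formPart D.G D.H := by
  let σ : Fin (3 + 3) ≃ Fin (2 + 2 + 2) := finEquiv ![4, 2, 0, 5, 3, 1] (by decide) rfl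
  have h : Poly (n := n) 2 0 0 2 ((1 / 2 : ℝ) • (fun D =>
      -- The inner contraction pairs the last indices of the two copies of `H`, and the outer one
      -- their middle indices.
      contract D.G (contract D.G (perm σ (tprod D.H D.H))) : TF n 2)) :=
    (((((Poly.nablaH 0).tprod (Poly.nablaH 0)).perm σ).contract).contract).smul (1 / 2)
  refine Poly.congr h fun D y _ => ?_
  funext I
  simp only [formPart, hTerm, Pi.smul_apply, smul_eq_mul, contract, contrC, perm, permC,
    Finset.mul_sum]
  refine Finset.sum_congr rfl fun a _ => ?_
  rw [Finset.sum_comm]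
  refine Finset.sum_congr rfl fun b _ => Finset.sum_congr rfl fun c _ =>
    Finset.sum_congr rfl fun d _ => ?_
  have e1 : (fun s => ((Fin.cons c (Fin.cons d (Fin.cons a (Fin.cons b I))) :
      Fin (2 + 2 + 2) → Fin n) ∘ σ) (Fin.castAdd 3 s)) = ![I 0, a, c] := by
    funext s
    fin_cases s <;> simp [σ] <;> rfl
  have e2 : (fun s => ((Fin.cons c (Fin.cons d (Fin.cons a (Fin.cons b I))) :
      Fin (2 + 2 + 2) → Fin n) ∘ σ) (Fin.natAdd 3 s)) = ![I 1, b, d] := by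
    funext s
    fin_cases s <;> simp [σ] <;> rfl
  simp only [tprod]
  rw [e1, e2]
  ring

/-- The velocity of the Christoffel symbols, with the upper index lowered, for the velocity `v` of
the metric; the slots are the lowered index and the two lower indices. -/
def gam (G : MetricField n) (v : Field n 2) : Field n 3 := fun y I =>
  (1 / 2) * (cov G v y ![I 2, I 1, I 0] + cov G v y ![I 1, I 2, I 0] - cov G v y ![I 0, I 2, I 1])

theorem Poly.gam {p q l : ℕ} {A : TF n 2} (h : Poly p q l 2 A) :
    Poly p q (l + 1) 3 fun D => gam D.G (A D) := by
  let σ₁ : Fin 3 ≃ Fin 3 := finEquiv ![2, 1, 0] (by decide) rfl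
  let σ₂ : Fin 3 ≃ Fin 3 := finEquiv ![1, 2, 0] (by decide) rfl
  let σ₃ : Fin 3 ≃ Fin 3 := finEquiv ![0, 2, 1] (by decide) rfl
  refine Poly.congr ((((h.cov.perm σ₁).add (h.cov.perm σ₂)).sub (h.cov.perm σ₃)).smul (1 / 2))
    fun D y _ => ?_
  have e : ∀ (I : Fin 3 → Fin n) (a b c : Fin 3), (I ∘ ![a, b, c]) = ![I a, I b, I c] := by
    intro I a b c
    funext s; fin_cases s <;> rfl
  funext I
  have e1 : I ∘ σ₁ = ![I 2, I 1, I 0] := e I 2 1 0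
  have e2 : I ∘ σ₂ = ![I 1, I 2, I 0] := e I 1 2 0
  have e3 : I ∘ σ₃ = ![I 0, I 2, I 1] := e I 0 2 1
  simp only [GRF.gam, Pi.smul_apply, Pi.sub_apply, Pi.add_apply, smul_eq_mul, GRF.perm, permC,
    e1, e2, e3]

/-- The action of the velocity of the connection on a tensor, as the rank goes up by one. -/
theorem Poly.actBy_gam {p q l k p' q' l' : ℕ} {V : TF n 2} {A : TF n k} (hV : Poly p q l 2 V)
    (hA : Poly p' q' l' k A) : Poly (p + p') (q + q') (l + 1 + l') (k + 1) fun D =>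
      Poly.actBy D.G (fun _ : Fin 1 => 0) Fin.succ (GRF.gam D.G (V D)) (A D) :=
  actBy_poly (by omega) (fun a b _ => Subsingleton.elim a b) (Fin.succ_injective _)
    (fun _ j => (Fin.succ_ne_zero j).symm) hV.gam hA

/-- The action of a tensor of rank two on a tensor. -/
theorem Poly.actBy_self {p q l k p' q' l' : ℕ} {V : TF n 2} {A : TF n k} (hV : Poly p q l 2 V)
    (hA : Poly p' q' l' k A) : Poly (p + p') (q + q') (l + l') k fun D =>
      Poly.actBy D.G (Fin.elim0 : Fin 0 → Fin k) id (V D) (A D) :=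
  actBy_poly (by omega) (fun a => a.elim0) Function.injective_id (fun a => a.elim0) hV hA

end Velocity

/-! ### The flow in local coordinates -/

/-- A smooth solution of the generalized Ricci flow on an open subset of `ℝⁿ`. -/
structure LocFlow (n : ℕ) where
  J : Set ℝ
  ordConnected : J.OrdConnected
  nontrivial : J.Nontrivial
  U : Set (Coord n)
  isOpen_U : IsOpen U
  G : ℝ → MetricField n
  H : ℝ → Field n 3
  smooth_G : ∀ i j, ContDiffOn ℝ ∞ (fun p : ℝ × Coord n => G p.1 p.2 i j) (J ×ˢ U)
  smooth_H : ∀ I, ContDiffOn ℝ ∞ (fun p : ℝ × Coord n => H p.1 p.2 I) (J ×ˢ U)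
  posDef : ∀ t ∈ J, ∀ y ∈ U, (G t y).PosDef
  alt_H : ∀ t ∈ J, ∀ y ∈ U, IsAlt (H t y)
  metric_eq : ∀ t ∈ J, ∀ y ∈ U, ∀ i j, HasDerivWithinAt (fun s => G s y i j)
    (-2 * ric (G t) i j y + (1 / 2) * hTerm (G t) (H t) i j y) J t
  form_eq : ∀ t ∈ J, ∀ y ∈ U, ∀ I, HasDerivWithinAt (fun s => H s y I) (box (G t) (H t) y I) J t

namespace LocFlow

variable {n k : ℕ} (F : LocFlow n)

/-- The data of the flow at a fixed time. -/
def slice (t : ℝ) (ht : t ∈ F.J) : LocData n where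
  U := F.U
  isOpen_U := F.isOpen_U
  G := F.G t
  H := F.H t
  smooth_G i j := contDiffOn_slice (f := fun t y => F.G t y i j) (F.smooth_G i j) ht
  posDef := F.posDef t ht
  smooth_H I := contDiffOn_slice (f := fun t y => F.H t y I) (F.smooth_H I) ht
  alt_H := F.alt_H t ht

/-- The velocity of the metric. -/
def vel (t : ℝ) : Field n 2 := ricPart (F.G t) + formPart (F.G t) (F.H t)

/-- The velocity of the connection, with the upper index lowered. -/
def gamVel (t : ℝ) : Field n 3 := gam (F.G t) (F.vel t)

variable {F} {t : ℝ} {y : Coord n}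

theorem hasDeriv_G (ht : t ∈ F.J) (hy : y ∈ F.U) (i j : Fin n) :
    HasDerivWithinAt (fun s => F.G s y i j) (F.vel t y ![i, j]) F.J t :=
  F.metric_eq t ht y hy i j

theorem deriv_unique {f : ℝ → ℝ} {a b : ℝ} (ht : t ∈ F.J) (ha : HasDerivWithinAt f a F.J t)
    (hb : HasDerivWithinAt f b F.J t) : a = b :=
  (uniqueDiffOn_time F.ordConnected F.nontrivial t ht).eq_deriv _ ha hb

/-- Symmetry is inherited from that of `g(t)` by uniqueness of the time derivative, so no symmetry
of the Ricci tensor has to be derived from the curvature formula. -/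
theorem vel_symm (ht : t ∈ F.J) (hy : y ∈ F.U) (i j : Fin n) :
    F.vel t y ![i, j] = F.vel t y ![j, i] :=
  deriv_unique ht (hasDeriv_G ht hy i j) ((hasDeriv_G ht hy j i).congr
    (fun s hs => LocData.symm_G (D := F.slice s hs) hy i j)
    (LocData.symm_G (D := F.slice t ht) hy i j))

theorem det_ne_zero (ht : t ∈ F.J) (hy : y ∈ F.U) : (F.G t y).det ≠ 0 :=
  (F.posDef t ht y hy).det_pos.ne'

theorem smooth_inv (i j : Fin n) :
    ContDiffOn ℝ ∞ (fun p : ℝ × Coord n => (F.G p.1 p.2)⁻¹ i j) (F.J ×ˢ F.U) :=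
  contDiffOn_inv_entry (A := fun p : ℝ × Coord n => F.G p.1 p.2) F.smooth_G
    (fun _ hp => det_ne_zero hp.1 hp.2) i j

/-- Existence of the derivative comes from joint smoothness; its value is then forced by
differentiating `g g⁻¹ = 1`. -/
theorem hasDeriv_inv (ht : t ∈ F.J) (hy : y ∈ F.U) (i j : Fin n) :
    HasDerivWithinAt (fun s => (F.G s y)⁻¹ i j)
      (-∑ a, ∑ b, (F.G t y)⁻¹ i a * F.vel t y ![a, b] * (F.G t y)⁻¹ b j) F.J t := by
  have hd : ∀ i j, HasDerivWithinAt (fun s => (F.G s y)⁻¹ i j)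
      (derivWithin (fun s => (F.G s y)⁻¹ i j) F.J t) F.J t := fun i j =>
    (differentiableWithinAt_time (f := fun s z => (F.G s z)⁻¹ i j) (smooth_inv i j) ht
      hy).hasDerivWithinAt
  set P' : Matrix (Fin n) (Fin n) ℝ :=
    Matrix.of fun i j => derivWithin (fun s => (F.G s y)⁻¹ i j) F.J t
  set G' : Matrix (Fin n) (Fin n) ℝ := Matrix.of fun i j => F.vel t y ![i, j]
  have h0 : G' * (F.G t y)⁻¹ + F.G t y * P' = 0 := by
    ext a b
    have e1 : HasDerivWithinAt (fun s => ∑ c, F.G s y a c * (F.G s y)⁻¹ c b) 0 F.J t := by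
      have e : ∀ s ∈ F.J, ∑ c, F.G s y a c * (F.G s y)⁻¹ c b
          = (1 : Matrix (Fin n) (Fin n) ℝ) a b := fun s hs => by
        rw [← LocData.mul_inv (D := F.slice s hs) hy, Matrix.mul_apply]
        rfl
      exact (hasDerivWithinAt_const t F.J _).congr e (e t ht)
    have e2 := HasDerivWithinAt.fun_sum (u := Finset.univ)
      fun c _ => (hasDeriv_G ht hy a c).fun_mul (hd c b)
    rw [Finset.sum_add_distrib] at e2
    exact deriv_unique ht e2 e1
  have h1 := congrFun (congrFun (inv_deriv_eq (LocData.inv_mul (D := F.slice t ht) hy) h0) i) j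
  have h2 : P' i j = -∑ a, ∑ b, (F.G t y)⁻¹ i a * F.vel t y ![a, b] * (F.G t y)⁻¹ b j := by
    rw [h1, Finset.sum_comm]
    simp only [Matrix.neg_apply, Matrix.mul_apply, Finset.sum_mul]
    rfl
  rw [← h2]
  exact hd i j

theorem hasDeriv_pd_G (ht : t ∈ F.J) (hy : y ∈ F.U) (a i j : Fin n) :
    HasDerivWithinAt (fun s => pd a (fun z => F.G s z i j) y)
      (pd a (fun z => F.vel t z ![i, j]) y) F.J t :=
  hasDerivWithinAt_pd F.ordConnected F.nontrivial F.isOpen_U (f := fun s z => F.G s z i j)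
    (f' := fun s z => F.vel s z ![i, j]) (F.smooth_G i j) (fun _ ht _ hy => hasDeriv_G ht hy i j)
    a ht hy

theorem smooth_christoffel (c i j : Fin n) :
    ContDiffOn ℝ ∞ (fun p : ℝ × Coord n => christoffel (F.G p.1) c i j p.2) (F.J ×ˢ F.U) :=
  contDiffOn_christoffel_family F.ordConnected F.nontrivial F.isOpen_U F.smooth_G
    (fun _ ht _ hy => det_ne_zero ht hy) c i j

theorem cov_two (G : MetricField n) (v : Field n 2) (y : Coord n) (a i j : Fin n) :
    cov G v y ![a, i, j] = pd a (fun z => v z ![i, j]) y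
      - ∑ q, christoffel G q a i y * v y ![q, j] - ∑ q, christoffel G q a j y * v y ![i, q] := by
  have h : (![a, i, j] : Fin 3 → Fin n) = Fin.cons a ![i, j] := rfl
  rw [h, cov_cons, act, Fin.sum_univ_two, sub_sub]
  congr 2
  · refine Finset.sum_congr rfl fun q _ => ?_
    have : Function.update ![i, j] 0 q = ![q, j] := by
      funext s; fin_cases s <;> simp
    rw [this]; rfl
  · refine Finset.sum_congr rfl fun q _ => ?_
    have : Function.update ![i, j] 1 q = ![i, q] := by
      funext s; fin_cases s <;> simp
    rw [this]; rfl

/-- Among the six Christoffel terms of the covariant expression four cancel in pairs by symmetry of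
`Γ` and of the velocity. The remaining `v_{lc} Γ^c_{pi}` is what arises from differentiating the
factor `g_{lc}` in Koszul's formula. -/
theorem gamVel_apply (ht : t ∈ F.J) (hy : y ∈ F.U) (l i p : Fin n) :
    F.gamVel t y ![l, i, p] = (1 / 2) * (pd p (fun z => F.vel t z ![i, l]) y
      + pd i (fun z => F.vel t z ![p, l]) y - pd l (fun z => F.vel t z ![p, i]) y)
      - ∑ c, F.vel t y ![l, c] * christoffel (F.G t) c p i y := by
  have hΓ := fun c i j => LocData.christoffel_symm (D := F.slice t ht) hy c i j
  change ∀ c i j, christoffel (F.G t) c i j y = christoffel (F.G t) c j i y at hΓ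
  have hv := fun i j => vel_symm (F := F) ht hy i j
  have e1 : ∑ c, F.vel t y ![l, c] * christoffel (F.G t) c p i y
      = ∑ q, christoffel (F.G t) q p i y * F.vel t y ![q, l] :=
    Finset.sum_congr rfl fun q _ => by rw [hv l q, mul_comm]
  have e2 : ∀ a b c, ∑ q, christoffel (F.G t) q a b y * F.vel t y ![c, q]
      = ∑ q, christoffel (F.G t) q a b y * F.vel t y ![q, c] := fun a b c =>
    Finset.sum_congr rfl fun q _ => by rw [hv c q]
  have e3 : ∀ a b c, ∑ q, christoffel (F.G t) q a b y * F.vel t y ![q, c]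
      = ∑ q, christoffel (F.G t) q b a y * F.vel t y ![q, c] := fun a b c =>
    Finset.sum_congr rfl fun q _ => by rw [hΓ q a b]
  have e0 : F.gamVel t y ![l, i, p] = (1 / 2) * (cov (F.G t) (F.vel t) y ![p, i, l]
      + cov (F.G t) (F.vel t) y ![i, p, l] - cov (F.G t) (F.vel t) y ![l, p, i]) := rfl
  rw [e0, e1]
  simp only [cov_two, e2]
  rw [e3 i p l, e3 l p i, e3 l i p]
  ring

/-- Differentiate Koszul's formula `g_{lc} Γ^c_{pi} = …` in time and solve for the derivative of
`Γ`. The outcome is tensorial although `Γ` is not. -/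
theorem hasDeriv_christoffel (ht : t ∈ F.J) (hy : y ∈ F.U) (c p i : Fin n) :
    HasDerivWithinAt (fun s => christoffel (F.G s) c p i y)
      (∑ l, (F.G t y)⁻¹ c l * F.gamVel t y ![l, i, p]) F.J t := by
  have hd : ∀ c, HasDerivWithinAt (fun s => christoffel (F.G s) c p i y)
      (derivWithin (fun s => christoffel (F.G s) c p i y) F.J t) F.J t := fun c =>
    (differentiableWithinAt_time (f := fun s z => christoffel (F.G s) c p i z)
      (smooth_christoffel c p i) ht hy).hasDerivWithinAt
  set X : Fin n → ℝ := fun c => derivWithin (fun s => christoffel (F.G s) c p i y) F.J t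
  have h1 : ∀ l, (F.G t y).mulVec X l = F.gamVel t y ![l, i, p] := by
    intro l
    have e1 := HasDerivWithinAt.fun_sum (u := Finset.univ)
      fun c _ => (hasDeriv_G ht hy l c).fun_mul (hd c)
    have e2 := (((hasDeriv_pd_G ht hy p i l).fun_add (hasDeriv_pd_G ht hy i p l)).fun_sub
      (hasDeriv_pd_G ht hy l p i)).const_mul (1 / 2)
    have e3 := deriv_unique ht e1 (e2.congr
      (fun s hs => LocData.lower_christoffel (D := F.slice s hs) hy p i l)
      (LocData.lower_christoffel (D := F.slice t ht) hy p i l))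
    rw [gamVel_apply ht hy, ← e3, Finset.sum_add_distrib]
    simp only [Matrix.mulVec, dotProduct]
    ring
  have h2 := congrFun (Matrix.mulVec_mulVec X (F.G t y)⁻¹ (F.G t y)) c
  have hPG : (F.G t y)⁻¹ * F.G t y = 1 := LocData.inv_mul (D := F.slice t ht) hy
  rw [hPG, Matrix.one_mulVec] at h2
  have h3 : ∑ l, (F.G t y)⁻¹ c l * F.gamVel t y ![l, i, p] = X c := by
    rw [← h2]
    simp only [← h1]
    rfl
  rw [h3]
  exact hd c

/-- The evolution of a covariant derivative. -/
theorem hasDeriv_cov {T T' : ℝ → Field n k}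
    (hT : ∀ I, ContDiffOn ℝ ∞ (fun p : ℝ × Coord n => T p.1 p.2 I) (F.J ×ˢ F.U))
    (hT' : ∀ t ∈ F.J, ∀ y ∈ F.U, ∀ I, HasDerivWithinAt (fun s => T s y I) (T' t y I) F.J t)
    (ht : t ∈ F.J) (hy : y ∈ F.U) (I : Fin (k + 1) → Fin n) :
    HasDerivWithinAt (fun s => cov (F.G s) (T s) y I)
      (cov (F.G t) (T' t) y I
        - Poly.actBy (F.G t) (fun _ : Fin 1 => 0) Fin.succ (F.gamVel t) (T t) y I) F.J t := by
  have h1 := hasDerivWithinAt_pd F.ordConnected F.nontrivial F.isOpen_U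
    (f := fun s z => T s z (Fin.tail I)) (f' := fun s z => T' s z (Fin.tail I)) (hT _)
    (fun t ht y hy => hT' t ht y hy _) (I 0) ht hy
  have h2 := HasDerivWithinAt.fun_sum (u := Finset.univ) fun (r : Fin k) _ =>
    HasDerivWithinAt.fun_sum (u := Finset.univ) fun (q : Fin n) _ =>
      (hasDeriv_christoffel ht hy q (I 0) (Fin.tail I r)).fun_mul
        (hT' t ht y hy (Function.update (Fin.tail I) r q))
  refine (h1.fun_sub h2).congr_deriv ?_
  have e : ∀ b i : Fin n, (Fin.cons b (Fin.cons i (I ∘ fun _ : Fin 1 => 0)) : Fin 3 → Fin n)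
      = ![b, i, I 0] := by
    intro b i
    funext s; fin_cases s <;> rfl
  simp only [Finset.sum_add_distrib, cov_apply, Poly.actBy, act, slot, chr, e]
  change _ - (_ + _) = _ - _ - ∑ s, ∑ q, _ * T t y (Function.update (Fin.tail I) s q)
  rw [sub_sub]
  exact congrArg _ (add_comm _ _)

theorem smooth_nablaH (l : ℕ) : ∀ I, ContDiffOn ℝ ∞
    (fun p : ℝ × Coord n => iterCov (F.G p.1) (F.H p.1) l p.2 I) (F.J ×ˢ F.U) := by
  induction l with
  | zero => exact F.smooth_H
  | succ l ih =>
    exact contDiffOn_cov_family F.ordConnected F.nontrivial F.isOpen_U F.smooth_G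
      (fun _ ht _ hy => det_ne_zero ht hy) (T := fun t => iterCov (F.G t) (F.H t) l) ih

theorem gam_add {D : LocData n} {v w : Field n 2} (hv : D.Smooth v) (hw : D.Smooth w)
    {y : Coord n} (hy : y ∈ D.U) : gam D.G (v + w) y = gam D.G v y + gam D.G w y := by
  funext I
  simp only [gam, LocData.cov_add hv hw hy, Pi.add_apply]
  ring

theorem actBy_add {r c : ℕ} {G : MetricField n} {f : Fin c → Fin r} {h : Fin k → Fin r}
    {B B₁ B₂ : Field n (c + 2)} {T : Field n k} {y : Coord n} (hB : B y = B₁ y + B₂ y) :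
    Poly.actBy G f h B T y = Poly.actBy G f h B₁ T y + Poly.actBy G f h B₂ T y := by
  funext I
  simp only [Poly.actBy, hB, Pi.add_apply, mul_add, Finset.sum_add_distrib,
    LocData.act_add_left]

/-- The evolution of `∇^l H`: a universal formula. -/
theorem exists_evolution (n l : ℕ) : ∃ A B : TF n (3 + l), Poly 1 1 l (3 + l) A ∧
    Poly 3 0 l (3 + l) B ∧ ∀ (F : LocFlow n) (t : ℝ) (ht : t ∈ F.J), ∀ y ∈ F.U, ∀ I,
      HasDerivWithinAt (fun s => iterCov (F.G s) (F.H s) l y I)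
        (lap (F.G t) (iterCov (F.G t) (F.H t) l) y I + A (F.slice t ht) y I
          + B (F.slice t ht) y I) F.J t := by
  induction l with
  | zero =>
    obtain ⟨P, hP, h⟩ := exists_box_eq (n := n)
    refine ⟨P, 0, hP, Poly.zero, fun F t ht y hy I => ?_⟩
    refine (F.form_eq t ht y hy I).congr_deriv ?_
    have := congrFun (h (F.slice t ht) y hy) I
    rw [Pi.zero_apply, Pi.zero_apply, Pi.zero_apply, add_zero]
    exact this
  | succ l ih =>
    obtain ⟨A, B, hA, hB, h⟩ := ih
    have hH : Poly (n := n) 1 0 l (3 + l) fun D => iterCov D.G D.H l := Poly.nablaH l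
    -- The three new contributions at level `l + 1`: the commutator of `∇` and `Δ`, and the action
    -- on `∇^l H` of the velocity of `Γ`, split into its curvature part and its `H`-part.
    have hC := hH.cov_lap_sub
    have hR := (poly_ricPart (n := n)).actBy_gam hH
    have hF := (poly_formPart (n := n)).actBy_gam hH
    refine ⟨_, _, (hA.cov.add (hC.of_eq rfl (zero_add 1) rfl)).sub
        (hR.of_eq rfl rfl (by omega)),
      hB.cov.sub (hF.of_eq rfl rfl (by omega)), fun F t ht y hy I => ?_⟩
    classical
    have key := hasDeriv_cov (F := F) (T := fun s => iterCov (F.G s) (F.H s) l)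
      -- Slices of the flow exist only for times in `J`; the value `0` elsewhere is a dummy.
      (T' := fun s => if hs : s ∈ F.J then lap (F.G s) (iterCov (F.G s) (F.H s) l)
        + A (F.slice s hs) + B (F.slice s hs) else 0) (smooth_nablaH l)
      (fun s hs z hz K => by
        simp only [hs, dif_pos]
        exact h F s hs z hz K) ht hy I
    refine key.congr_deriv ?_
    simp only [ht, dif_pos]
    set D := F.slice t ht with hD
    have s1 : D.Smooth (lap (F.G t) (iterCov (F.G t) (F.H t) l)) := hH.lap.smooth D
    have c1 : cov (F.G t) (lap (F.G t) (iterCov (F.G t) (F.H t) l) + A D + B D) y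
        = cov (F.G t) (lap (F.G t) (iterCov (F.G t) (F.H t) l)) y + cov (F.G t) (A D) y
          + cov (F.G t) (B D) y :=
      (LocData.cov_add (D := D) (s1.add (hA.smooth D)) (hB.smooth D) hy).trans
        (congrArg (· + cov (F.G t) (B D) y) (LocData.cov_add s1 (hA.smooth D) hy))
    have c2 : F.gamVel t y = gam (F.G t) (ricPart (F.G t)) y
        + gam (F.G t) (formPart (F.G t) (F.H t)) y :=
      gam_add (D := D) (poly_ricPart.smooth D) (poly_formPart.smooth D) hy
    rw [c1, actBy_add c2]
    simp only [Pi.add_apply, Pi.sub_apply]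
    change _ = lap (F.G t) (cov (F.G t) (iterCov (F.G t) (F.H t) l)) y I
      + (cov (F.G t) (A D) y I + (cov (F.G t) (lap (F.G t) (iterCov (F.G t) (F.H t) l)) y I
        - lap (F.G t) (cov (F.G t) (iterCov (F.G t) (F.H t) l)) y I) - _)
      + (cov (F.G t) (B D) y I - _)
    have e : ∀ a b c d e f : ℝ, a + b + c - (d + e) = f + (b + (a - f) - d) + (c - e) := by
      intros; ring
    exact e _ _ _ _ _ _

end LocFlow

/-! ### Normal forms of universal tensors -/

section NormalForm

variable {n r r' k k' : ℕ}

/-- The universal tensors obtained from `W` by permutations of indices and contractions. -/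
inductive CP {n r : ℕ} (W : TF n r) : (k : ℕ) → TF n k → Prop
  | refl : CP W r W
  | perm {k k' : ℕ} {A : TF n k} (σ : Fin k ≃ Fin k') : CP W k A → CP W k' fun D => perm σ (A D)
  | contract {k : ℕ} {A : TF n (k + 2)} : CP W (k + 2) A → CP W k fun D => contract D.G (A D)

namespace CP

theorem trans {W : TF n r} {A : TF n k} {B : TF n k'} (h : CP W k A) (h' : CP A k' B) :
    CP W k' B := by
  induction h' with
  | refl => exact h
  | perm σ _ ih => exact ih.perm σ
  | contract _ ih => exact ih.contract

theorem of_perm_eq {A : TF n k} {B : TF n k'} (σ : Fin k ≃ Fin k')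
    (h : ∀ D, B D = GRF.perm σ (A D)) : CP A k' B := by
  have : B = fun D => GRF.perm σ (A D) := funext h
  rw [this]
  exact CP.refl.perm σ

theorem tprod_flip (A : TF n k) (B : TF n k') :
    CP (fun D => GRF.tprod (A D) (B D)) (k' + k) fun D => GRF.tprod (B D) (A D) := by
  refine of_perm_eq finAddFlip fun D => ?_
  funext y I
  simp [GRF.tprod, GRF.perm, permC, mul_comm]

/-- Operations on the first factor of a product can be carried out on the whole product, because its
slots come first. -/
theorem tprod_left {W : TF n r} {A : TF n k} (h : CP W k A) (B : TF n k') :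
    CP (fun D => GRF.tprod (W D) (B D)) (k + k') fun D => GRF.tprod (A D) (B D) := by
  induction h with
  | refl => exact CP.refl
  | @perm k₁ k₂ A σ _ ih =>
    refine ih.trans (of_perm_eq
      (finSumFinEquiv.symm.trans ((Equiv.sumCongr σ (Equiv.refl _)).trans finSumFinEquiv))
      fun D => ?_)
    funext y I
    simp [GRF.tprod, GRF.perm, permC, Function.comp_def]
  | @contract k₁ A _ ih =>
    refine ih.trans ?_
    have e : (fun D => GRF.tprod (GRF.contract D.G (A D)) (B D)) = fun D => GRF.contract D.G
        (GRF.perm (finCongr (by omega : k₁ + 2 + k' = k₁ + k' + 2)) (GRF.tprod (A D) (B D))) := by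
      funext D y I
      simp only [GRF.tprod, GRF.contract, contrC, GRF.perm, permC, Finset.sum_mul]
      refine Finset.sum_congr rfl fun a _ => Finset.sum_congr rfl fun b _ => ?_
      rw [mul_assoc]
      congr 3
      · funext s
        refine Fin.cases rfl (fun s => ?_) s
        refine Fin.cases rfl (fun s => ?_) s
        rfl
      · funext s
        have : (finCongr (by omega : k₁ + 2 + k' = k₁ + k' + 2)) (Fin.natAdd (k₁ + 2) s)
            = (Fin.natAdd k₁ s).succ.succ := by
          ext; simp; omega
        simp only [Function.comp_apply, this, Fin.cons_succ]
    rw [e]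
    exact (CP.refl.perm _).contract

/-- Treat the left factor, exchange the factors, treat the other one, and exchange back. -/
theorem tprod {W : TF n r} {A : TF n k} {W' : TF n r'} {A' : TF n k'} (h : CP W k A)
    (h' : CP W' k' A') :
    CP (fun D => GRF.tprod (W D) (W' D)) (k + k') fun D => GRF.tprod (A D) (A' D) :=
  (h.tprod_left W').trans ((tprod_flip A W').trans ((h'.tprod_left A).trans (tprod_flip A' A)))

/-- The tensor `1` of rank `0`. -/
def unit (n : ℕ) : TF n 0 := fun _ _ _ => 1

theorem tprod_unit (A : TF n k) : CP A (k + 0) fun D => GRF.tprod (A D) (unit n D) :=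
  of_perm_eq (Equiv.refl _) fun D => by
    funext y I
    simp [GRF.tprod, unit, GRF.perm, permC]

theorem of_tprod_unit (A : TF n k) : CP (fun D => GRF.tprod (A D) (unit n D)) k A :=
  of_perm_eq (Equiv.refl _) fun D => by
    funext y I
    simp [GRF.tprod, unit, GRF.perm, permC]

theorem unit_tprod (A : TF n k) : CP A (0 + k) fun D => GRF.tprod (unit n D) (A D) :=
  (tprod_unit A).trans (tprod_flip A (unit n))

theorem assoc {a b c : ℕ} (A : TF n a) (B : TF n b) (C : TF n c) :
    CP (fun D => GRF.tprod (A D) (GRF.tprod (B D) (C D))) (a + b + c) fun D =>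
      GRF.tprod (GRF.tprod (A D) (B D)) (C D) := by
  refine of_perm_eq (finCongr (by omega)) fun D => ?_
  funext y I
  simp only [GRF.tprod, GRF.perm, permC, mul_assoc]
  congr 2
  congr 2
  funext s
  simp only [Function.comp_apply]
  congr 1
  ext
  simp
  omega

end CP

/-- The rank of `∇^i H` or `∇^j Rm`. -/
def atomRank : ℕ ⊕ ℕ → ℕ
  | Sum.inl i => 3 + i
  | Sum.inr j => 4 + j

/-- The universal tensors `∇^i H` and `∇^j Rm`. -/
def atomF (n : ℕ) : (a : ℕ ⊕ ℕ) → TF n (atomRank a)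
  | Sum.inl i => fun D => iterCov D.G D.H i
  | Sum.inr j => fun D => iterCov D.G (riem D.G) j

/-- The numbers of factors `H`, of factors `Rm` and of derivatives. -/
def atomType : ℕ ⊕ ℕ → ℕ × ℕ × ℕ
  | Sum.inl i => (1, 0, i)
  | Sum.inr j => (0, 1, j)

/-- The rank of a product of factors `∇^i H`, `∇^j Rm`. -/
def wordRank : List (ℕ ⊕ ℕ) → ℕ
  | [] => 0
  | a :: w => atomRank a + wordRank w

/-- A product of factors `∇^i H`, `∇^j Rm`. -/
def wordF (n : ℕ) : (w : List (ℕ ⊕ ℕ)) → TF n (wordRank w)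
  | [] => CP.unit n
  | a :: w => fun D => tprod (atomF n a D) (wordF n w D)

/-- The total type of a product. -/
def wordType (w : List (ℕ ⊕ ℕ)) : ℕ × ℕ × ℕ := (w.map atomType).sum

theorem CP.word_append (w w' : List (ℕ ⊕ ℕ)) : CP (wordF n (w ++ w')) (wordRank w + wordRank w')
    fun D => GRF.tprod (wordF n w D) (wordF n w' D) := by
  induction w with
  | nil => exact CP.unit_tprod (wordF n w')
  | cons a w ih =>
    exact (CP.tprod (CP.refl (W := atomF n a)) ih).trans
      (CP.assoc (atomF n a) (wordF n w) (wordF n w'))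

/-- The span of the contractions of products of the given type. -/
def wordSpan (n p q l k : ℕ) : Submodule ℝ (TF n k) :=
  Submodule.span ℝ {S | ∃ w, wordType w = (p, q, l) ∧ CP (wordF n w) k S}

variable {p q l p' q' l' : ℕ}

theorem wordSpan_perm (σ : Fin k ≃ Fin k') {A : TF n k} (h : A ∈ wordSpan n p q l k) :
    (fun D => perm σ (A D)) ∈ wordSpan n p q l k' := by
  refine Submodule.span_induction (p := fun A _ => (fun D => perm σ (A D)) ∈ wordSpan n p q l k')
    ?_ ?_ ?_ ?_ h
  · rintro S ⟨w, hw, hS⟩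
    exact Submodule.subset_span ⟨w, hw, hS.perm σ⟩
  · exact (wordSpan n p q l k').zero_mem
  · exact fun A B _ _ hA hB => (wordSpan n p q l k').add_mem hA hB
  · exact fun c A _ hA => (wordSpan n p q l k').smul_mem c hA

theorem contract_add (G : MetricField n) (A B : Field n (k + 2)) :
    contract G (A + B) = contract G A + contract G B := by
  funext y I
  simp [contract, contrC, mul_add, Finset.sum_add_distrib]

theorem contract_smul (G : MetricField n) (c : ℝ) (A : Field n (k + 2)) :
    contract G (c • A) = c • contract G A := by
  funext y I
  simp [contract, contrC, Finset.mul_sum, mul_left_comm]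

theorem wordSpan_contract {A : TF n (k + 2)} (h : A ∈ wordSpan n p q l (k + 2)) :
    (fun D => contract D.G (A D)) ∈ wordSpan n p q l k := by
  refine Submodule.span_induction
    (p := fun A _ => (fun D : LocData n => contract D.G (A D)) ∈ wordSpan n p q l k) ?_ ?_ ?_ ?_ h
  · rintro S ⟨w, hw, hS⟩
    exact Submodule.subset_span ⟨w, hw, hS.contract⟩
  · convert (wordSpan n p q l k).zero_mem using 1
    funext D y I
    simp [contract, contrC]
  · intro A B _ _ hA hB
    convert (wordSpan n p q l k).add_mem hA hB using 1
    funext D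
    exact contract_add _ _ _
  · intro c A _ hA
    convert (wordSpan n p q l k).smul_mem c hA using 1
    funext D
    exact contract_smul _ _ _

/-- By bilinearity only generators matter, and for these the words are concatenated and their types
add. -/
theorem wordSpan_tprod {A : TF n k} {B : TF n k'} (hA : A ∈ wordSpan n p q l k)
    (hB : B ∈ wordSpan n p' q' l' k') :
    (fun D => tprod (A D) (B D)) ∈ wordSpan n (p + p') (q + q') (l + l') (k + k') := by
  set V := wordSpan n (p + p') (q + q') (l + l') (k + k')
  refine Submodule.span_induction (p := fun A _ => (fun D => tprod (A D) (B D)) ∈ V)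
    ?_ ?_ ?_ ?_ hA
  · rintro S ⟨w, hw, hS⟩
    refine Submodule.span_induction (p := fun B _ => (fun D => tprod (S D) (B D)) ∈ V)
      ?_ ?_ ?_ ?_ hB
    · rintro S' ⟨w', hw', hS'⟩
      refine Submodule.subset_span ⟨w ++ w', ?_, (CP.word_append w w').trans (hS.tprod hS')⟩
      rw [wordType, List.map_append, List.sum_append]
      change wordType w + wordType w' = _
      rw [hw, hw']
      rfl
    · convert V.zero_mem using 1
      funext D y I
      simp [tprod]
    · intro B B' _ _ hB hB'
      convert V.add_mem hB hB' using 1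
      funext D y I
      simp [tprod, mul_add]
    · intro c B _ hB
      convert V.smul_mem c hB using 1
      funext D y I
      simp [tprod, mul_left_comm]
  · convert V.zero_mem using 1
    funext D y I
    simp [tprod]
  · intro B B' _ _ hB hB'
    convert V.add_mem hB hB' using 1
    funext D y I
    simp [tprod, add_mul]
  · intro c B _ hB
    convert V.smul_mem c hB using 1
    funext D y I
    simp [tprod, mul_assoc]

/-- All products can be moved inside all contractions and sums moved outside. Equality is claimed
only on the domain, where the `congr` steps of `Poly` hold. -/
theorem Poly.exists_mem_wordSpan {A : TF n k} (h : Poly p q l k A) :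
    ∃ S ∈ wordSpan n p q l k, ∀ D, ∀ y ∈ D.U, A D y = S D y := by
  induction h with
  | nablaH i =>
    exact ⟨_, Submodule.subset_span ⟨[Sum.inl i], by simp [wordType, atomType],
      CP.of_tprod_unit _⟩, fun _ _ _ => rfl⟩
  | nablaRm j =>
    exact ⟨_, Submodule.subset_span ⟨[Sum.inr j], by simp [wordType, atomType],
      CP.of_tprod_unit _⟩, fun _ _ _ => rfl⟩
  | tprod _ _ hA hB =>
    obtain ⟨S, hS, eS⟩ := hA
    obtain ⟨S', hS', eS'⟩ := hB
    exact ⟨_, wordSpan_tprod hS hS', fun D y hy =>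
      congrArg₂ tmul (eS D y hy) (eS' D y hy)⟩
  | perm σ _ h =>
    obtain ⟨S, hS, eS⟩ := h
    exact ⟨_, wordSpan_perm σ hS, fun D y hy => by simp only [GRF.perm, eS D y hy]⟩
  | contract _ h =>
    obtain ⟨S, hS, eS⟩ := h
    exact ⟨_, wordSpan_contract hS, fun D y hy => by simp only [GRF.contract, eS D y hy]⟩
  | add _ _ hA hB =>
    obtain ⟨S, hS, eS⟩ := hA
    obtain ⟨S', hS', eS'⟩ := hB
    exact ⟨_, Submodule.add_mem _ hS hS', fun D y hy => by
      simp only [Pi.add_apply, eS D y hy, eS' D y hy]⟩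
  | smul c _ h =>
    obtain ⟨S, hS, eS⟩ := h
    exact ⟨_, Submodule.smul_mem _ c hS, fun D y hy => by simp only [Pi.smul_apply, eS D y hy]⟩
  | zero => exact ⟨0, Submodule.zero_mem _, fun _ _ _ => rfl⟩
  | congr _ e h =>
    obtain ⟨S, hS, eS⟩ := h
    exact ⟨S, hS, fun D y hy => (e D y hy).trans (eS D y hy)⟩

/-- The two slots contracted last become the first contracted pair. -/
def pairEquiv (k m : ℕ) : Fin (k + 2) ⊕ (Fin m × Fin 2) ≃ Fin k ⊕ (Fin (m + 1) × Fin 2) :=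
  Equiv.ofBijective (Sum.elim
      (Fin.cons (Sum.inr (0, 0)) (Fin.cons (Sum.inr (0, 1)) Sum.inl))
      (fun x => Sum.inr (x.1.succ, x.2)))
    ((Fintype.bijective_iff_injective_and_card _).2 ⟨by
      refine Function.Injective.sumElim
        (cons_injective (cons_injective Sum.inl_injective (fun i => by simp)) fun i => ?_) ?_ ?_
      · refine Fin.cases ?_ (fun i => ?_) i <;> simp
      · rintro ⟨a, b⟩ ⟨c, d⟩ h
        simpa using h
      · intro i x
        refine Fin.cases ?_ (fun i => Fin.cases ?_ (fun i => ?_) i) i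
        · simpa using fun h => absurd h.symm (Fin.succ_ne_zero _)
        · simpa using fun h => absurd h.symm (Fin.succ_ne_zero _)
        · simp, by simp; ring⟩)

/-- A chain of renamings and pairwise contractions amounts to a single contraction pattern: a
renaming relabels the free slots, and a contraction turns two free slots into a new pair. -/
theorem CP.exists_contr {W : TF n r} {S : TF n k} (h : CP W k S) :
    ∃ (m : ℕ) (σ : Fin r ≃ Fin k ⊕ (Fin m × Fin 2)), ∀ D y I, S D y I = contr D.G σ (W D) y I := by
  induction h with
  | refl =>
    refine ⟨0, (Equiv.sumEmpty _ _).symm, fun D y I => ?_⟩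
    rw [contr, Fintype.sum_unique]
    simp
  | perm τ _ ih =>
    obtain ⟨m, σ, h⟩ := ih
    refine ⟨m, σ.trans (Equiv.sumCongr τ (Equiv.refl _)), fun D y I => ?_⟩
    simp only [GRF.perm, permC, h, contr]
    refine Finset.sum_congr rfl fun K _ => ?_
    congr 2
    funext x
    rw [Equiv.trans_apply]
    rcases σ x with a | b <;> rfl
  | @contract k A _ ih =>
    obtain ⟨m, σ, h⟩ := ih
    refine ⟨m + 1, σ.trans (pairEquiv k m), fun D y I => ?_⟩
    simp only [GRF.contract, contrC, h, contr, Finset.mul_sum]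
    -- An index assignment for `m + 1` pairs is one for the new first pair together with one for the
    -- old `m` pairs.
    let f : (Fin n × Fin n) × (Fin m × Fin 2 → Fin n) → (Fin (m + 1) × Fin 2 → Fin n) :=
      fun x z => (Fin.cons (if z.2 = 0 then x.1.1 else x.1.2) (fun s => x.2 (s, z.2)) :
        Fin (m + 1) → Fin n) z.1
    let g : (Fin (m + 1) × Fin 2 → Fin n) → (Fin n × Fin n) × (Fin m × Fin 2 → Fin n) :=
      fun K => ((K (0, 0), K (0, 1)), fun z => K (z.1.succ, z.2))
    let e : (Fin n × Fin n) × (Fin m × Fin 2 → Fin n) ≃ (Fin (m + 1) × Fin 2 → Fin n) :=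
      { toFun := f
        invFun := g
        left_inv := fun x => by
          refine Prod.ext (Prod.ext ?_ ?_) ?_
          · simp [f, g]
          · simp [f, g]
          · funext z
            simp [f, g]
        right_inv := fun K => by
          funext ⟨a, b⟩
          refine Fin.cases ?_ (fun a => ?_) a
          · fin_cases b <;> simp [f, g]
          · simp [f, g] }
    rw [← Equiv.sum_comp e, Fintype.sum_prod_type, Fintype.sum_prod_type]
    refine Finset.sum_congr rfl fun a₀ _ => Finset.sum_congr rfl fun b₀ _ =>
      Finset.sum_congr rfl fun K _ => ?_
    rw [Fin.prod_univ_succ, ← mul_assoc]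
    congr 2
    funext s
    rw [Equiv.trans_apply]
    rcases σ s with a | b
    · refine Fin.cases ?_ (fun a => Fin.cases ?_ (fun a => ?_) a) a <;>
        simp [pairEquiv, e, f]
    · simp [pairEquiv, e, f]

/-- Counting slots determines the number of contracted pairs. -/
theorem CP.exists_contr_of_rank {W : TF n r} {S : TF n k} (h : CP W k S) {m : ℕ}
    (hm : r = k + 2 * m) :
    ∃ σ : Fin r ≃ Fin k ⊕ (Fin m × Fin 2), ∀ D y I, S D y I = contr D.G σ (W D) y I := by
  obtain ⟨m', σ, h⟩ := h.exists_contr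
  have h1 := Fintype.card_congr σ
  simp at h1
  obtain rfl : m' = m := by omega
  exact ⟨σ, h⟩

theorem linContr_add (G : MetricField n) {c m : ℕ} (a b : Coeffs r c m) (T : Field n r) :
    linContr G (a + b) T = linContr G a T + linContr G b T := by
  funext y I
  simp [linContr, add_mul, Finset.sum_add_distrib]

theorem linContr_smul (G : MetricField n) {c m : ℕ} (x : ℝ) (a : Coeffs r c m) (T : Field n r) :
    linContr G (x • a) T = x • linContr G a T := by
  funext y I
  simp [linContr, mul_assoc, Finset.mul_sum]

theorem linContr_zero (G : MetricField n) {c m : ℕ} (T : Field n r) :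
    linContr G (0 : Coeffs r c m) T = 0 := by
  funext y I
  simp [linContr]

theorem linContr_single (G : MetricField n) {c m : ℕ} (σ : Fin r ≃ Fin c ⊕ (Fin m × Fin 2))
    (T : Field n r) : linContr G (Pi.single σ 1 : Coeffs r c m) T = contr G σ T := by
  funext y I
  simp only [linContr, Pi.single_apply, ite_mul, one_mul, zero_mul]
  simp

theorem wordType_length (w : List (ℕ ⊕ ℕ)) : w.length = (wordType w).1 + (wordType w).2.1 := by
  induction w with
  | nil => rfl
  | cons a w ih =>
    have : wordType (a :: w) = atomType a + wordType w := by simp [wordType]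
    rw [this, List.length_cons, ih]
    rcases a with i | j <;> simp [atomType] <;> ring

/-- The type forces exactly one factor `∇^i H` and one factor `∇^j Rm`; if the curvature stands
first, the factors are exchanged. -/
theorem CP.of_word_two {w : List (ℕ ⊕ ℕ)} (hw : wordType w = (1, 1, l)) :
    ∃ i j, i + j = l ∧ CP (fun D : LocData n => GRF.tprod (iterCov D.G D.H i)
      (iterCov D.G (riem D.G) j)) (wordRank w) (wordF n w) := by
  have hl := wordType_length w
  rw [hw] at hl
  obtain ⟨a, b, rfl⟩ := List.length_eq_two.1 hl
  have h2 : ∀ a b, CP (fun D => GRF.tprod (atomF n a D) (atomF n b D)) (wordRank [a, b])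
      (wordF n [a, b]) := fun a b => CP.tprod CP.refl (CP.tprod_unit (atomF n b))
  rcases a with i | i <;> rcases b with j | j <;> simp [wordType, atomType] at hw
  · exact ⟨i, j, hw, h2 (Sum.inl i) (Sum.inr j)⟩
  · exact ⟨j, i, by omega, (CP.tprod_flip (atomF n (Sum.inl j)) (atomF n (Sum.inr i))).trans
      (h2 (Sum.inr i) (Sum.inl j))⟩

theorem CP.of_word_three {w : List (ℕ ⊕ ℕ)} (hw : wordType w = (3, 0, l)) :
    ∃ i j j', i + j + j' = l ∧ CP (fun D : LocData n => GRF.tprod (iterCov D.G D.H i)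
      (GRF.tprod (iterCov D.G D.H j) (iterCov D.G D.H j'))) (wordRank w) (wordF n w) := by
  have hl := wordType_length w
  rw [hw] at hl
  obtain ⟨a, b, c, rfl⟩ := List.length_eq_three.1 hl
  have h3 : ∀ a b c, CP (fun D => GRF.tprod (atomF n a D) (GRF.tprod (atomF n b D) (atomF n c D)))
      (wordRank [a, b, c]) (wordF n [a, b, c]) := fun a b c =>
    CP.tprod CP.refl (CP.tprod CP.refl (CP.tprod_unit (atomF n c)))
  rcases a with i | i <;> rcases b with j | j <;> rcases c with x | x <;>
    simp [wordType, atomType] at hw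
  exact ⟨i, j, x, by omega, h3 (Sum.inl i) (Sum.inl j) (Sum.inl x)⟩

/-- The universal tensors of the form `∑ ∇^i H ∗ ∇^j Rm`, as a linear function of the
coefficients. -/
def star2Map (n l k m : ℕ) : ((i j : ℕ) → Coeffs ((3 + i) + (4 + j)) k m) →ₗ[ℝ] TF n k where
  toFun a D := ∑ x ∈ Finset.HasAntidiagonal.antidiagonal l,
    star2 D.G (a x.1 x.2) (iterCov D.G D.H x.1) (iterCov D.G (riem D.G) x.2)
  map_add' a b := by
    funext D
    simp only [Pi.add_apply, star2, linContr_add, Finset.sum_add_distrib]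
  map_smul' c a := by
    funext D
    simp only [Pi.smul_apply, star2, linContr_smul, Finset.smul_sum, RingHom.id_apply]

/-- The universal tensors of the form `∑ ∇^i H ∗ ∇^j H ∗ ∇^k H`, as a linear function of the
coefficients. -/
def star3Map (n l k m : ℕ) :
    ((i j j' : ℕ) → Coeffs ((3 + i) + ((3 + j) + (3 + j'))) k m) →ₗ[ℝ] TF n k where
  toFun a D := ∑ x ∈ Finset.Nat.antidiagonalTuple 3 l,
    star3 D.G (a (x 0) (x 1) (x 2)) (iterCov D.G D.H (x 0)) (iterCov D.G D.H (x 1))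
      (iterCov D.G D.H (x 2))
  map_add' a b := by
    funext D
    simp only [Pi.add_apply, star3, linContr_add, Finset.sum_add_distrib]
  map_smul' c a := by
    funext D
    simp only [Pi.smul_apply, star3, linContr_smul, Finset.smul_sum, RingHom.id_apply]

theorem star2Map_single {m i j : ℕ} (hij : i + j = l) (c : Coeffs ((3 + i) + (4 + j)) k m)
    (D : LocData n) : star2Map n l k m (Pi.single i (Pi.single j c)) D
      = star2 D.G c (iterCov D.G D.H i) (iterCov D.G (riem D.G) j) := by
  change ∑ x ∈ Finset.HasAntidiagonal.antidiagonal l, _ = _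
  rw [Finset.sum_eq_single (i, j)]
  · simp only [Pi.single_eq_same]
  · rintro ⟨i', j'⟩ hx hne
    have : i' ≠ i := by
      rintro rfl
      rw [Finset.HasAntidiagonal.mem_antidiagonal] at hx
      exact hne (Prod.ext rfl (by simp only at hx ⊢; omega))
    simp only [Pi.single_eq_of_ne this, Pi.zero_apply, star2, linContr_zero]
  · intro hx
    exact absurd (Finset.HasAntidiagonal.mem_antidiagonal.2 hij) hx

theorem star3Map_single {m i j j' : ℕ} (hij : i + j + j' = l)
    (c : Coeffs ((3 + i) + ((3 + j) + (3 + j'))) k m) (D : LocData n) :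
    star3Map n l k m (Pi.single i (Pi.single j (Pi.single j' c))) D
      = star3 D.G c (iterCov D.G D.H i) (iterCov D.G D.H j) (iterCov D.G D.H j') := by
  set a : (i j j' : ℕ) → Coeffs ((3 + i) + ((3 + j) + (3 + j'))) k m :=
    Pi.single i (Pi.single j (Pi.single j' c)) with ha
  have h1 : a i j j' = c := by simp only [ha, Pi.single_eq_same]
  have h2 : ∀ i' x x', ¬(i' = i ∧ x = j ∧ x' = j') → a i' x x' = 0 := by
    intro i' x x' hne
    by_cases h0 : i' = i
    · subst h0
      by_cases h1 : x = j
      · subst h1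
        have h2 : x' ≠ j' := fun h2 => hne ⟨rfl, rfl, h2⟩
        simp only [ha, Pi.single_eq_same, Pi.single_eq_of_ne h2]
      · simp only [ha, Pi.single_eq_same, Pi.single_eq_of_ne h1, Pi.zero_apply]
    · simp only [ha, Pi.single_eq_of_ne h0, Pi.zero_apply]
  change ∑ x ∈ Finset.Nat.antidiagonalTuple 3 l, star3 D.G (a (x 0) (x 1) (x 2))
    (iterCov D.G D.H (x 0)) (iterCov D.G D.H (x 1)) (iterCov D.G D.H (x 2)) = _
  rw [Finset.sum_eq_single ![i, j, j']]
  · rw [← h1]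
    rfl
  · intro x _ hne
    rw [h2 _ _ _ fun h => hne (by
      funext s
      fin_cases s
      · exact h.1
      · exact h.2.1
      · exact h.2.2), star3, linContr_zero]
  · intro hx
    refine absurd (Finset.Nat.mem_antidiagonalTuple.2 ?_) hx
    simpa [Fin.sum_univ_three] using hij

/-- The `∗`-sums form the range of a linear map on coefficient families, so it is enough to hit the
generators of the span. Each of these is one contraction pattern, given by a coefficient family with
a single nonzero entry. The number `7 + l` is the rank `(3 + i) + (4 + j)`. -/
theorem Poly.exists_star2 {A : TF n k} (h : Poly 1 1 l k A) {m : ℕ} (hm : 7 + l = k + 2 * m) :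
    ∃ a : (i j : ℕ) → Coeffs ((3 + i) + (4 + j)) k m, ∀ D, ∀ y ∈ D.U, ∀ I,
      A D y I = ∑ x ∈ Finset.HasAntidiagonal.antidiagonal l,
        star2 D.G (a x.1 x.2) (iterCov D.G D.H x.1) (iterCov D.G (riem D.G) x.2) y I := by
  classical
  obtain ⟨S, hS, hAS⟩ := h.exists_mem_wordSpan
  have hle : wordSpan n 1 1 l k ≤ LinearMap.range (star2Map n l k m) := by
    refine Submodule.span_le.2 ?_
    rintro S ⟨w, hw, hS⟩
    obtain ⟨i, j, hij, hc⟩ := CP.of_word_two (n := n) hw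
    obtain ⟨σ, hσ⟩ := (hc.trans hS).exists_contr_of_rank (m := m) (by omega)
    refine ⟨Pi.single i (Pi.single j (Pi.single σ 1)), ?_⟩
    funext D y I
    rw [star2Map_single hij, star2, linContr_single, hσ]
  obtain ⟨a, rfl⟩ := hle hS
  refine ⟨a, fun D y hy I => ?_⟩
  rw [hAS D y hy]
  simp only [star2Map, LinearMap.coe_mk, AddHom.coe_mk, Finset.sum_apply]

theorem Poly.exists_star3 {A : TF n k} (h : Poly 3 0 l k A) {m : ℕ} (hm : 9 + l = k + 2 * m) :
    ∃ a : (i j j' : ℕ) → Coeffs ((3 + i) + ((3 + j) + (3 + j'))) k m, ∀ D, ∀ y ∈ D.U, ∀ I,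
      A D y I = ∑ x ∈ Finset.Nat.antidiagonalTuple 3 l,
        star3 D.G (a (x 0) (x 1) (x 2)) (iterCov D.G D.H (x 0)) (iterCov D.G D.H (x 1))
          (iterCov D.G D.H (x 2)) y I := by
  classical
  obtain ⟨S, hS, hAS⟩ := h.exists_mem_wordSpan
  have hle : wordSpan n 3 0 l k ≤ LinearMap.range (star3Map n l k m) := by
    refine Submodule.span_le.2 ?_
    rintro S ⟨w, hw, hS⟩
    obtain ⟨i, j, j', hij, hc⟩ := CP.of_word_three (n := n) hw
    obtain ⟨σ, hσ⟩ := (hc.trans hS).exists_contr_of_rank (m := m) (by omega)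
    refine ⟨Pi.single i (Pi.single j (Pi.single j' (Pi.single σ 1))), ?_⟩
    funext D y I
    rw [star3Map_single hij, star3, linContr_single, hσ]
  obtain ⟨a, rfl⟩ := hle hS
  refine ⟨a, fun D y hy I => ?_⟩
  rw [hAS D y hy]
  simp only [star3Map, LinearMap.coe_mk, AddHom.coe_mk, Finset.sum_apply]

end NormalForm

/-! ### Inner products of tensors -/

section InnerProduct

variable {n k k' : ℕ}

theorem sum_cons {M : Type*} [AddCommMonoid M] (f : (Fin (k + 1) → Fin n) → M) :
    ∑ I, f I = ∑ a, ∑ I : Fin k → Fin n, f (Fin.cons a I) := by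
  rw [← (Fin.consEquiv fun _ => Fin n).sum_comp, Fintype.sum_prod_type]
  rfl

theorem sum_append {M : Type*} [AddCommMonoid M] (f : (Fin (k + k') → Fin n) → M) :
    ∑ I, f I = ∑ A : Fin k → Fin n, ∑ B : Fin k' → Fin n, f (Fin.append A B) := by
  rw [← (Fin.appendEquiv k k').sum_comp, Fintype.sum_prod_type]
  rfl

/-- The pairing of tensors by one bilinear form for each slot. -/
def ipQ (Q : Fin k → Matrix (Fin n) (Fin n) ℝ) (S T : Comp n k) : ℝ :=
  ∑ I : Fin k → Fin n, ∑ J : Fin k → Fin n, (∏ s, Q s (I s) (J s)) * S I * T J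

/-- The pairing of tensors by a bilinear form. -/
def ipC (P : Matrix (Fin n) (Fin n) ℝ) (S T : Comp n k) : ℝ := ipQ (fun _ => P) S T

theorem normSq_eq (G : MetricField n) (T : Field n k) (y : Coord n) :
    normSq G T y = ipC (G y)⁻¹ (T y) (T y) := rfl

/-- The components in a moving frame. -/
def frameQ (B : Fin k → Fin n → Fin n → ℝ) (T : Comp n k) : Comp n k := fun K =>
  ∑ I : Fin k → Fin n, (∏ s, B s (K s) (I s)) * T I

/-- Factoring each form as `BᵀB` turns the pairing into a Euclidean inner product of frame
components. The forms may differ from slot to slot, as the sign argument for `|H|²` requires. -/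
theorem ipQ_eq_frame {Q : Fin k → Matrix (Fin n) (Fin n) ℝ} {B : Fin k → Fin n → Fin n → ℝ}
    (h : ∀ s a b, Q s a b = ∑ c, B s c a * B s c b) (S T : Comp n k) :
    ipQ Q S T = ∑ K, frameQ B S K * frameQ B T K := by
  have e : ∀ I J : Fin k → Fin n, ∏ s, Q s (I s) (J s)
      = ∑ K : Fin k → Fin n, (∏ s, B s (K s) (I s)) * ∏ s, B s (K s) (J s) := by
    intro I J
    simp only [h, Finset.prod_univ_sum, Fintype.piFinset_univ, Finset.prod_mul_distrib]
  simp only [ipQ, frameQ, e, Finset.sum_mul, Finset.mul_sum]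
  rw [Finset.sum_congr rfl fun I _ => Finset.sum_comm, Finset.sum_comm]
  refine Finset.sum_congr rfl fun K _ => ?_
  rw [Finset.sum_comm]
  exact Finset.sum_congr rfl fun I _ => Finset.sum_congr rfl fun J _ => by ring

-- The rows of the positive square root of `P` serve as the frame.
open scoped MatrixOrder in
theorem exists_frame {P : Matrix (Fin n) (Fin n) ℝ} (hP : P.PosSemidef) :
    ∃ B : Fin n → Fin n → ℝ, ∀ a b, P a b = ∑ c, B c a * B c b := by
  refine ⟨fun c a => (CFC.sqrt P) c a, fun a b => ?_⟩
  have h1 : CFC.sqrt P * CFC.sqrt P = P := CFC.sqrt_mul_sqrt_self P hP.nonneg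
  have h2 : (CFC.sqrt P).IsHermitian :=
    (Matrix.nonneg_iff_posSemidef.1 (CFC.sqrt_nonneg P)).isHermitian
  have h3 := congrFun (congrFun h1 a) b
  rw [← h3, Matrix.mul_apply]
  refine Finset.sum_congr rfl fun c _ => ?_
  have := h2.apply a c
  rw [← this]
  simp

theorem ipQ_self_nonneg {Q : Fin k → Matrix (Fin n) (Fin n) ℝ} (hQ : ∀ s, (Q s).PosSemidef)
    (T : Comp n k) : 0 ≤ ipQ Q T T := by
  choose B hB using fun s => exists_frame (hQ s)
  rw [ipQ_eq_frame hB]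
  exact Finset.sum_nonneg fun K _ => mul_self_nonneg _

theorem ipC_self_nonneg {P : Matrix (Fin n) (Fin n) ℝ} (hP : P.PosSemidef) (T : Comp n k) :
    0 ≤ ipC P T T := ipQ_self_nonneg (fun _ => hP) T

theorem ipC_add_left (P : Matrix (Fin n) (Fin n) ℝ) (S S' T : Comp n k) :
    ipC P (S + S') T = ipC P S T + ipC P S' T := by
  simp [ipC, ipQ, mul_add, add_mul, Finset.sum_add_distrib]

theorem ipC_smul_left (P : Matrix (Fin n) (Fin n) ℝ) (c : ℝ) (S T : Comp n k) :
    ipC P (c • S) T = c * ipC P S T := by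
  simp only [ipC, ipQ, Pi.smul_apply, smul_eq_mul, Finset.mul_sum]
  exact Finset.sum_congr rfl fun _ _ => Finset.sum_congr rfl fun _ _ => by ring

theorem ipC_sub_left (P : Matrix (Fin n) (Fin n) ℝ) (S S' T : Comp n k) :
    ipC P (S - S') T = ipC P S T - ipC P S' T := by
  simp [ipC, ipQ, mul_sub, sub_mul, Finset.sum_sub_distrib]

theorem ipC_sum_left {ι : Type*} (t : Finset ι) (P : Matrix (Fin n) (Fin n) ℝ)
    (S : ι → Comp n k) (T : Comp n k) : ipC P (∑ a ∈ t, S a) T = ∑ a ∈ t, ipC P (S a) T := by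
  classical
  induction t using Finset.induction_on with
  | empty => simp [ipC, ipQ]
  | insert a t ha ih => rw [Finset.sum_insert ha, Finset.sum_insert ha, ipC_add_left, ih]

theorem ipC_comm {P : Matrix (Fin n) (Fin n) ℝ} (hP : ∀ a b, P a b = P b a) (S T : Comp n k) :
    ipC P S T = ipC P T S := by
  simp only [ipC, ipQ]
  rw [Finset.sum_comm]
  refine Finset.sum_congr rfl fun I _ => Finset.sum_congr rfl fun J _ => ?_
  rw [Finset.prod_congr rfl fun s _ => hP (J s) (I s)]
  ring

theorem abs_ipC_le {P : Matrix (Fin n) (Fin n) ℝ} (hP : P.PosSemidef) (S T : Comp n k) :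
    |ipC P S T| ≤ Real.sqrt (ipC P S S) * Real.sqrt (ipC P T T) := by
  obtain ⟨B, hB⟩ := exists_frame hP
  have h := fun S T : Comp n k => ipQ_eq_frame (Q := fun _ => P) (B := fun _ => B) (fun _ => hB) S T
  simp only [ipC, h]
  rw [← Real.sqrt_sq_eq_abs, ← Real.sqrt_mul (Finset.sum_nonneg fun K _ => mul_self_nonneg _)]
  refine Real.sqrt_le_sqrt ?_
  simp only [← pow_two]
  exact Finset.sum_mul_sq_le_sq_mul_sq _ _ _

theorem ipC_permC (P : Matrix (Fin n) (Fin n) ℝ) (σ : Fin k ≃ Fin k') (S T : Comp n k) :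
    ipC P (permC σ S) (permC σ T) = ipC P S T := by
  simp only [ipC, ipQ, permC]
  rw [← (Equiv.arrowCongr σ (Equiv.refl (Fin n))).sum_comp]
  refine Finset.sum_congr rfl fun I _ => ?_
  rw [← (Equiv.arrowCongr σ (Equiv.refl (Fin n))).sum_comp]
  refine Finset.sum_congr rfl fun J _ => ?_
  have e : ∀ I : Fin k → Fin n, (Equiv.arrowCongr σ (Equiv.refl (Fin n)) I) ∘ σ = I := by
    intro I; funext s; simp
  rw [e, e, ← σ.prod_comp]
  congr 2
  refine Finset.prod_congr rfl fun s _ => ?_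
  simp

theorem ipC_tmul (P : Matrix (Fin n) (Fin n) ℝ) (S S' : Comp n k) (T T' : Comp n k') :
    ipC P (tmul S T) (tmul S' T') = ipC P S S' * ipC P T T' := by
  simp only [ipC, ipQ, tmul, sum_append, Fin.prod_univ_add, Fin.append_left, Fin.append_right]
  rw [Finset.sum_mul_sum]
  refine Finset.sum_congr rfl fun A _ => Finset.sum_congr rfl fun B _ => ?_
  rw [Finset.sum_mul_sum]
  exact Finset.sum_congr rfl fun A' _ => Finset.sum_congr rfl fun B' _ => by ring

/-- In frame components a contraction is a trace `∑_c X_{cc…}` of `n` terms. Cauchy–Schwarz gives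
the factor `n`, and the diagonal entries are among all entries. -/
theorem ipC_contrC_le {P : Matrix (Fin n) (Fin n) ℝ} (hP : P.PosSemidef) (T : Comp n (k + 2)) :
    ipC P (contrC P T) (contrC P T) ≤ n * ipC P T T := by
  obtain ⟨B, hB⟩ := exists_frame hP
  have h : ∀ {k} (S : Comp n k), ipC P S S = ∑ K, frameQ (fun _ => B) S K ^ 2 := fun S => by
    rw [ipC, ipQ_eq_frame (Q := fun _ => P) (B := fun _ => B) (fun _ => hB)]
    exact Finset.sum_congr rfl fun _ _ => (pow_two _).symm
  have h2 : ∀ K, frameQ (fun _ => B) (contrC P T) K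
      = ∑ c, frameQ (fun _ => B) T (Fin.cons c (Fin.cons c K)) := by
    intro K
    simp only [frameQ, contrC, sum_cons, Fin.prod_univ_succ, Fin.cons_zero, Fin.cons_succ, hB,
      Finset.sum_mul, Finset.mul_sum]
    rw [Finset.sum_comm]
    rw [Finset.sum_congr rfl fun a _ => Finset.sum_comm]
    rw [Finset.sum_congr rfl fun a _ => Finset.sum_congr rfl fun b _ => Finset.sum_comm]
    rw [Finset.sum_congr rfl fun a _ => Finset.sum_comm, Finset.sum_comm]
    refine Finset.sum_congr rfl fun c _ => Finset.sum_congr rfl fun a _ =>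
      Finset.sum_congr rfl fun b _ => Finset.sum_congr rfl fun I _ => by ring
  rw [h, h]
  set X := frameQ (fun _ => B) T
  simp only [h2]
  calc ∑ K : Fin k → Fin n, (∑ c, X (Fin.cons c (Fin.cons c K))) ^ 2
      ≤ ∑ K : Fin k → Fin n, (n : ℝ) * ∑ c, X (Fin.cons c (Fin.cons c K)) ^ 2 := by
        refine Finset.sum_le_sum fun K _ => ?_
        simpa using sq_sum_le_card_mul_sum_sq (s := (Finset.univ : Finset (Fin n)))
          (f := fun c => X (Fin.cons c (Fin.cons c K)))
    _ = n * ∑ c, ∑ K : Fin k → Fin n, X (Fin.cons c (Fin.cons c K)) ^ 2 := by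
        rw [← Finset.mul_sum, Finset.sum_comm]
    _ ≤ n * ∑ K, X K ^ 2 := by
        refine mul_le_mul_of_nonneg_left ?_ (Nat.cast_nonneg n)
        rw [sum_cons]
        refine Finset.sum_le_sum fun c _ => ?_
        rw [sum_cons]
        exact Finset.single_le_sum
          (f := fun b => ∑ K : Fin k → Fin n, X (Fin.cons c (Fin.cons b K)) ^ 2)
          (fun b _ => Finset.sum_nonneg fun K _ => sq_nonneg _) (Finset.mem_univ c)

/-- Exchanging the `s`-th entry of `I` with `c` is an involution. It is the index bookkeeping for
transferring a matrix from a tensor to the form it is paired by. -/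
theorem sum_update_swap {M : Type*} [AddCommMonoid M] (s : Fin k)
    (f : (Fin k → Fin n) → Fin n → M) :
    ∑ I, ∑ c, f I c = ∑ I, ∑ c, f (Function.update I s c) (I s) := by
  let e : (Fin k → Fin n) × Fin n ≃ (Fin k → Fin n) × Fin n :=
    Function.Involutive.toPerm (fun x => (Function.update x.1 s x.2, x.1 s)) (fun x => by simp)
  rw [← Fintype.sum_prod_type', ← Fintype.sum_prod_type', ← e.sum_comp]
  rfl

/-- Acting by `M` on slot `s` of `S` has the same effect as replacing `P` by `M P` in that slot of
the pairing. -/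
theorem ipC_slot (P : Matrix (Fin n) (Fin n) ℝ) (s : Fin k) (M : Fin n → Fin n → ℝ)
    (S T : Comp n k) : ipC P (slot s M S) T = ∑ I, ∑ J, (∏ r ∈ Finset.univ.erase s, P (I r) (J r))
      * (∑ c, M (I s) c * P c (J s)) * S I * T J := by
  simp only [ipC, ipQ, slot]
  rw [Finset.sum_comm]
  conv_rhs => rw [Finset.sum_comm]
  refine Finset.sum_congr rfl fun J _ => ?_
  have h := sum_update_swap s fun (I : Fin k → Fin n) (c : Fin n) =>
    (∏ r ∈ Finset.univ.erase s, P (I r) (J r)) * (M (I s) c * P c (J s)) * S I * T J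
  simp only [Finset.mul_sum, Finset.sum_mul]
  rw [h]
  refine Finset.sum_congr rfl fun I _ => Finset.sum_congr rfl fun q _ => ?_
  have h1 : ∏ r ∈ Finset.univ.erase s, P (Function.update I s q r) (J r)
      = ∏ r ∈ Finset.univ.erase s, P (I r) (J r) :=
    Finset.prod_congr rfl fun r hr => by
      rw [Function.update_of_ne (Finset.ne_of_mem_erase hr)]
  rw [h1, Function.update_self, ← Finset.prod_erase_mul _ _ (Finset.mem_univ s)]
  ring

theorem ipC_act (P : Matrix (Fin n) (Fin n) ℝ) (M : Fin n → Fin n → ℝ)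
    (S T : Comp n k) : ipC P (act M S) T = ∑ I, ∑ J,
      (∑ s, (∏ r ∈ Finset.univ.erase s, P (I r) (J r)) * ∑ c, M (I s) c * P c (J s))
        * S I * T J := by
  have : act M S = ∑ s, slot s M S := by funext I; simp [act]
  rw [this, ipC_sum_left]
  simp only [ipC_slot, Finset.sum_mul]
  rw [Finset.sum_comm]
  exact Finset.sum_congr rfl fun I _ => Finset.sum_comm

/-- The derivation property of the pairing. -/
theorem ipC_act_add {P : Matrix (Fin n) (Fin n) ℝ} (hP : ∀ a b, P a b = P b a)
    (M : Fin n → Fin n → ℝ) (S T : Comp n k) : ipC P (act M S) T + ipC P S (act M T)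
      = ∑ I, ∑ J, (∑ s, (∏ r ∈ Finset.univ.erase s, P (I r) (J r))
        * (∑ c, M (I s) c * P c (J s) + ∑ c, M (J s) c * P (I s) c)) * S I * T J := by
  rw [ipC_comm hP S, ipC_act, ipC_act]
  conv_lhs => rw [add_comm, Finset.sum_comm, add_comm]
  rw [← Finset.sum_add_distrib]
  refine Finset.sum_congr rfl fun I _ => ?_
  rw [← Finset.sum_add_distrib]
  refine Finset.sum_congr rfl fun J _ => ?_
  have : ∀ s, (∏ r ∈ Finset.univ.erase s, P (J r) (I r)) * ∑ c, M (J s) c * P c (I s)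
      = (∏ r ∈ Finset.univ.erase s, P (I r) (J r)) * ∑ c, M (J s) c * P (I s) c := by
    intro s
    rw [Finset.prod_congr rfl fun r _ => hP (J r) (I r)]
    congr 1
    exact Finset.sum_congr rfl fun c _ => by rw [hP c]
  simp only [this, mul_add, Finset.sum_add_distrib]
  ring

end InnerProduct

/-! ### Norms of universal tensors -/

namespace LocData

variable {n k k' : ℕ} {D : LocData n} {y : Coord n}

theorem posSemidef_inv (hy : y ∈ D.U) : (D.G y)⁻¹.PosSemidef := (D.posDef y hy).inv.posSemidef

theorem normSq_nonneg (hy : y ∈ D.U) (T : Field n k) : 0 ≤ normSq D.G T y :=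
  ipC_self_nonneg (posSemidef_inv hy) (T y)

theorem nrm_nonneg (T : Field n k) : 0 ≤ nrm D.G T y := Real.sqrt_nonneg _

theorem nrm_mul_self (hy : y ∈ D.U) (T : Field n k) :
    nrm D.G T y * nrm D.G T y = normSq D.G T y := Real.mul_self_sqrt (normSq_nonneg hy T)

theorem nrm_congr {S T : Field n k} (h : S y = T y) : nrm D.G S y = nrm D.G T y := by
  rw [nrm, nrm, normSq_eq, normSq_eq, h]

theorem nrm_perm (σ : Fin k ≃ Fin k') (T : Field n k) : nrm D.G (perm σ T) y = nrm D.G T y :=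
  congrArg Real.sqrt (ipC_permC _ σ (T y) (T y))

theorem nrm_tprod (hy : y ∈ D.U) (A : Field n k) (B : Field n k') :
    nrm D.G (tprod A B) y = nrm D.G A y * nrm D.G B y := by
  rw [nrm, nrm, nrm, ← Real.sqrt_mul (normSq_nonneg hy A)]
  exact congrArg Real.sqrt (ipC_tmul _ (A y) (A y) (B y) (B y))

theorem nrm_contract_le (hy : y ∈ D.U) (T : Field n (k + 2)) :
    nrm D.G (contract D.G T) y ≤ Real.sqrt n * nrm D.G T y := by
  rw [nrm, nrm, ← Real.sqrt_mul (Nat.cast_nonneg n)]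
  exact Real.sqrt_le_sqrt (ipC_contrC_le (posSemidef_inv hy) (T y))

theorem abs_ip_le (hy : y ∈ D.U) (S T : Field n k) :
    |ipC (D.G y)⁻¹ (S y) (T y)| ≤ nrm D.G S y * nrm D.G T y :=
  abs_ipC_le (posSemidef_inv hy) (S y) (T y)

theorem nrm_add_le (hy : y ∈ D.U) (S T : Field n k) :
    nrm D.G (S + T) y ≤ nrm D.G S y + nrm D.G T y := by
  refine Real.sqrt_le_iff.2 ⟨add_nonneg (nrm_nonneg S) (nrm_nonneg T), ?_⟩
  have h1 := (le_abs_self _).trans (abs_ip_le hy S T)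
  have h2 : normSq D.G (S + T) y
      = normSq D.G S y + 2 * ipC (D.G y)⁻¹ (S y) (T y) + normSq D.G T y := by
    simp only [normSq_eq, Pi.add_apply]
    rw [ipC_add_left, ipC_comm (symm_inv hy) (S y) (S y + T y),
      ipC_comm (symm_inv hy) (T y) (S y + T y), ipC_add_left, ipC_add_left,
      ipC_comm (symm_inv hy) (T y) (S y)]
    ring
  rw [h2, ← nrm_mul_self hy S, ← nrm_mul_self hy T]
  nlinarith

theorem nrm_smul (c : ℝ) (T : Field n k) : nrm D.G (c • T) y = |c| * nrm D.G T y := by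
  have : normSq D.G (c • T) y = c ^ 2 * normSq D.G T y := by
    simp only [normSq, Pi.smul_apply, smul_eq_mul, Finset.mul_sum]
    exact Finset.sum_congr rfl fun _ _ => Finset.sum_congr rfl fun _ _ => by ring
  rw [nrm, this, Real.sqrt_mul (sq_nonneg c), Real.sqrt_sq_eq_abs, nrm]

theorem nrm_zero : nrm D.G (0 : Field n k) y = 0 := by
  simp [nrm, normSq]

end LocData

/-! ### Norm bounds with constants independent of the solution -/

section Bounds

variable {n k l : ℕ}

theorem CP.nrm_le {r : ℕ} {W : TF n r} {S : TF n k} (h : CP W k S) :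
    ∃ C : ℝ, 0 ≤ C ∧ ∀ D, ∀ y ∈ D.U, nrm D.G (S D) y ≤ C * nrm D.G (W D) y := by
  induction h with
  | refl => exact ⟨1, zero_le_one, fun D y _ => by rw [one_mul]⟩
  | perm σ _ ih =>
    obtain ⟨C, hC, h⟩ := ih
    exact ⟨C, hC, fun D y hy => by rw [LocData.nrm_perm]; exact h D y hy⟩
  | contract _ ih =>
    obtain ⟨C, hC, h⟩ := ih
    refine ⟨Real.sqrt n * C, mul_nonneg (Real.sqrt_nonneg _) hC, fun D y hy => ?_⟩
    refine (LocData.nrm_contract_le hy _).trans ?_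
    rw [mul_assoc]
    exact mul_le_mul_of_nonneg_left (h D y hy) (Real.sqrt_nonneg _)

/-- A universal tensor is a fixed finite combination of contractions of words. A bound for the words
therefore passes to it with a constant that does not see the data. -/
theorem wordSpan_nrm_le {p q : ℕ} {X : LocData n → Coord n → ℝ}
    (hX : ∀ w, wordType w = (p, q, l) → ∃ C : ℝ, 0 ≤ C ∧ ∀ D, ∀ y ∈ D.U,
      nrm D.G (wordF n w D) y ≤ C * X D y) {A : TF n k}
    (hA : Poly p q l k A) :
    ∃ C : ℝ, 0 ≤ C ∧ ∀ D, ∀ y ∈ D.U, nrm D.G (A D) y ≤ C * X D y := by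
  obtain ⟨S, hS, e⟩ := hA.exists_mem_wordSpan
  suffices h : ∃ C : ℝ, 0 ≤ C ∧ ∀ D, ∀ y ∈ D.U, nrm D.G (S D) y ≤ C * X D y by
    obtain ⟨C, hC, h⟩ := h
    exact ⟨C, hC, fun D y hy => (LocData.nrm_congr (e D y hy)).trans_le (h D y hy)⟩
  refine Submodule.span_induction (p := fun S _ => ∃ C : ℝ, 0 ≤ C ∧ ∀ D, ∀ y ∈ D.U,
    nrm D.G (S D) y ≤ C * X D y) ?_ ?_ ?_ ?_ hS
  · rintro S ⟨w, hw, hS⟩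
    obtain ⟨C, hC, h⟩ := hS.nrm_le
    obtain ⟨C', hC', h'⟩ := hX w hw
    refine ⟨C * C', mul_nonneg hC hC', fun D y hy => (h D y hy).trans ?_⟩
    rw [mul_assoc]
    exact mul_le_mul_of_nonneg_left (h' D y hy) hC
  · exact ⟨0, le_rfl, fun D y _ => by
      rw [zero_mul]; exact LocData.nrm_zero.le⟩
  · rintro A B _ _ ⟨C, hC, h⟩ ⟨C', hC', h'⟩
    refine ⟨C + C', add_nonneg hC hC', fun D y hy => ?_⟩
    rw [add_mul]
    exact (LocData.nrm_add_le hy _ _).trans (add_le_add (h D y hy) (h' D y hy))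
  · rintro c A _ ⟨C, hC, h⟩
    refine ⟨|c| * C, mul_nonneg (abs_nonneg c) hC, fun D y hy => ?_⟩
    rw [Pi.smul_apply, LocData.nrm_smul, mul_assoc]
    exact mul_le_mul_of_nonneg_left (h D y hy) (abs_nonneg c)

theorem Poly.nrm_le_two {A : TF n k} (h : Poly 1 1 l k A) :
    ∃ C : ℝ, 0 ≤ C ∧ ∀ D, ∀ y ∈ D.U, nrm D.G (A D) y
      ≤ C * ∑ x ∈ Finset.HasAntidiagonal.antidiagonal l,
        nrm D.G (iterCov D.G D.H x.1) y * nrm D.G (iterCov D.G (riem D.G) x.2) y := by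
  refine wordSpan_nrm_le (fun w hw => ?_) h
  obtain ⟨i, j, hij, hc⟩ := CP.of_word_two (n := n) hw
  obtain ⟨C, hC, hb⟩ := hc.nrm_le
  refine ⟨C, hC, fun D y hy => (hb D y hy).trans (mul_le_mul_of_nonneg_left ?_ hC)⟩
  rw [LocData.nrm_tprod hy]
  exact Finset.single_le_sum (f := fun x : ℕ × ℕ => nrm D.G (iterCov D.G D.H x.1) y *
    nrm D.G (iterCov D.G (riem D.G) x.2) y)
    (fun x _ => mul_nonneg (LocData.nrm_nonneg _) (LocData.nrm_nonneg _))
    (Finset.HasAntidiagonal.mem_antidiagonal.2 hij : (i, j) ∈ _)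

theorem Poly.nrm_le_three {A : TF n k} (h : Poly 3 0 l k A) :
    ∃ C : ℝ, 0 ≤ C ∧ ∀ D, ∀ y ∈ D.U, nrm D.G (A D) y
      ≤ C * ∑ x ∈ Finset.Nat.antidiagonalTuple 3 l, nrm D.G (iterCov D.G D.H (x 0)) y
        * nrm D.G (iterCov D.G D.H (x 1)) y * nrm D.G (iterCov D.G D.H (x 2)) y := by
  have hnn : ∀ (D : LocData n) (y : Coord n) (x : Fin 3 → ℕ), 0 ≤
      nrm D.G (iterCov D.G D.H (x 0)) y * nrm D.G (iterCov D.G D.H (x 1)) y *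
        nrm D.G (iterCov D.G D.H (x 2)) y := fun D y x =>
    mul_nonneg (mul_nonneg (LocData.nrm_nonneg _) (LocData.nrm_nonneg _)) (LocData.nrm_nonneg _)
  refine wordSpan_nrm_le (fun w hw => ?_) h
  obtain ⟨i, j, j', hij, hc⟩ := CP.of_word_three (n := n) hw
  obtain ⟨C, hC, hb⟩ := hc.nrm_le
  refine ⟨C, hC, fun D y hy => (hb D y hy).trans (mul_le_mul_of_nonneg_left ?_ hC)⟩
  rw [LocData.nrm_tprod hy, LocData.nrm_tprod hy, ← mul_assoc]
  have hm : ![i, j, j'] ∈ Finset.Nat.antidiagonalTuple 3 l := by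
    rw [Finset.Nat.mem_antidiagonalTuple]
    simpa [Fin.sum_univ_three] using hij
  exact Finset.single_le_sum (f := fun x : Fin 3 → ℕ => nrm D.G (iterCov D.G D.H (x 0)) y *
    nrm D.G (iterCov D.G D.H (x 1)) y * nrm D.G (iterCov D.G D.H (x 2)) y)
    (fun x _ => hnn D y x) hm

end Bounds

/-! ### Derivatives of inner products and the Bochner formula -/

namespace LocData

variable {n k : ℕ} {D : LocData n} {y : Coord n}

theorem pd_finprod {ι : Type*} [DecidableEq ι] (t : Finset ι) {f : ι → Coord n → ℝ}
    (hf : ∀ s ∈ t, DifferentiableAt ℝ (f s) y) (p : Fin n) :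
    pd p (fun z => ∏ s ∈ t, f s z) y = ∑ s ∈ t, (∏ r ∈ t.erase s, f r y) * pd p (f s) y := by
  rw [pd, (HasFDerivAt.finsetProd fun s hs => (hf s hs).hasFDerivAt).fderiv]
  simp [pd]

/-- The covariant derivative in the direction of a coordinate. -/
def dir (G : MetricField n) (p : Fin n) (T : Field n k) : Field n k := fun y I =>
  cov G T y (Fin.cons p I)

theorem dir_eq (G : MetricField n) (p : Fin n) (T : Field n k) (y : Coord n) :
    dir G p T y = (fun I => pd p (fun z => T z I) y) - act (chr G p y) (T y) := rfl

theorem Smooth.dir {T : Field n k} (hT : D.Smooth T) (p : Fin n) : D.Smooth (dir D.G p T) :=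
  fun I => hT.cov (Fin.cons p I)

theorem ipC_sub_right (P : Matrix (Fin n) (Fin n) ℝ) (S T T' : Comp n k) :
    ipC P S (T - T') = ipC P S T - ipC P S T' := by
  simp [ipC, ipQ, mul_sub, Finset.sum_sub_distrib]

theorem differentiableAt_prod_inv (hy : y ∈ D.U) (I J : Fin k → Fin n) :
    DifferentiableAt ℝ (fun z => ∏ s, (D.G z)⁻¹ (I s) (J s)) y :=
  (HasFDerivAt.finsetProd fun s _ =>
    (differentiableAt_inv hy (I s) (J s)).hasFDerivAt).differentiableAt

/-- The derivatives of the factors `g⁻¹` are Christoffel terms, and by `ipC_act_add` they equal the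
corrections that turn `∂_p S` and `∂_p T` into covariant derivatives. -/
theorem pd_ip {S T : Field n k} (hS : D.Smooth S) (hT : D.Smooth T) (hy : y ∈ D.U) (p : Fin n) :
    pd p (fun z => ipC (D.G z)⁻¹ (S z) (T z)) y
      = ipC (D.G y)⁻¹ (dir D.G p S y) (T y) + ipC (D.G y)⁻¹ (S y) (dir D.G p T y) := by
  have hP : ∀ I J : Fin k → Fin n, DifferentiableAt ℝ (fun z => ∏ s, (D.G z)⁻¹ (I s) (J s)) y :=
    differentiableAt_prod_inv hy
  have h1 : pd p (fun z => ipC (D.G z)⁻¹ (S z) (T z)) y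
      = ∑ I : Fin k → Fin n, ∑ J : Fin k → Fin n,
        (((∑ s, (∏ r ∈ Finset.univ.erase s, (D.G y)⁻¹ (I r) (J r))
          * pd p (fun z => (D.G z)⁻¹ (I s) (J s)) y) * S y I
          + (∏ s, (D.G y)⁻¹ (I s) (J s)) * pd p (fun z => S z I) y) * T y J
          + (∏ s, (D.G y)⁻¹ (I s) (J s)) * S y I * pd p (fun z => T z J) y) := by
    simp only [ipC, ipQ]
    rw [pd_sum _ fun I _ => DifferentiableAt.fun_sum fun J _ =>
      ((hP I J).fun_mul (hS.differentiableAt hy I)).fun_mul (hT.differentiableAt hy J)]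
    refine Finset.sum_congr rfl fun I _ => ?_
    rw [pd_sum _ fun J _ =>
      ((hP I J).fun_mul (hS.differentiableAt hy I)).fun_mul (hT.differentiableAt hy J)]
    refine Finset.sum_congr rfl fun J _ => ?_
    rw [pd_mul ((hP I J).fun_mul (hS.differentiableAt hy I)) (hT.differentiableAt hy J),
      pd_mul (hP I J) (hS.differentiableAt hy I),
      pd_finprod _ fun s _ => differentiableAt_inv hy _ _]
  have h2 := ipC_act_add (symm_inv hy) (chr D.G p y) (S y) (T y)
  have h3 : ∀ I J : Fin k → Fin n, (∑ s, (∏ r ∈ Finset.univ.erase s, (D.G y)⁻¹ (I r) (J r))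
      * pd p (fun z => (D.G z)⁻¹ (I s) (J s)) y)
      = -∑ s, (∏ r ∈ Finset.univ.erase s, (D.G y)⁻¹ (I r) (J r))
        * (∑ c, chr D.G p y (I s) c * (D.G y)⁻¹ c (J s)
          + ∑ c, chr D.G p y (J s) c * (D.G y)⁻¹ (I s) c) := by
    intro I J
    rw [← Finset.sum_neg_distrib]
    refine Finset.sum_congr rfl fun s _ => ?_
    rw [pd_inv hy]
    simp only [chr]
    ring
  rw [h1, dir_eq, dir_eq, ipC_sub_left, ipC_sub_right]
  have h4 : ∀ a b c d : ℝ, a - b + (c - d) = a + c - (b + d) := by intros; ring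
  rw [h4, h2]
  simp only [ipC, ipQ, h3, add_mul, Finset.sum_add_distrib, neg_mul, Finset.sum_neg_distrib]
  ring

theorem cov_scalar (G : MetricField n) (f : Coord n → ℝ) (p : Fin n) (z : Coord n) :
    cov G (k := 0) (fun z _ => f z) z (Fin.cons p Fin.elim0) = pd p f z := by
  rw [cov_cons]
  simp [act]

theorem cov_cov_cons (T : Field n k) (p q : Fin n) (I : Fin k → Fin n) :
    cov D.G (cov D.G T) y (Fin.cons p (Fin.cons q I)) = dir D.G p (dir D.G q T) y I
      - ∑ c, christoffel D.G c p q y * dir D.G c T y I := by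
  rw [cov_cons, act_cons]
  have h : dir D.G p (dir D.G q T) y I = pd p (fun z => dir D.G q T z I) y
      - act (chr D.G p y) (dir D.G q T y) I := cov_cons ..
  rw [h]
  change pd p (fun z => dir D.G q T z I) y
    - (∑ c, christoffel D.G c p q y * dir D.G c T y I
      + act (chr D.G p y) (dir D.G q T y) I) = _
  ring

/-- The Bochner formula for the squared norm of a tensor. -/
theorem lapFun_normSq {T : Field n k} (hT : D.Smooth T) (hy : y ∈ D.U) :
    lapFun D.G (normSq D.G T) y
      = 2 * ipC (D.G y)⁻¹ (lap D.G T y) (T y) + 2 * normSq D.G (cov D.G T) y := by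
  have h1 : ∀ q, ∀ z ∈ D.U, pd q (normSq D.G T) z
      = 2 * ipC (D.G z)⁻¹ (dir D.G q T z) (T z) := by
    intro q z hz
    have := pd_ip hT hT hz q
    rw [ipC_comm (symm_inv hz) (T z), ← two_mul] at this
    exact this
  have hdiff : ∀ q, DifferentiableAt ℝ (fun z => ipC (D.G z)⁻¹ (dir D.G q T z) (T z)) y := fun q =>
    DifferentiableAt.fun_sum fun I _ => DifferentiableAt.fun_sum fun J _ =>
      ((differentiableAt_prod_inv hy I J).fun_mul
        ((hT.dir q).differentiableAt hy I)).fun_mul (hT.differentiableAt hy J)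
  -- The Hessian of `|T|²`: differentiating `2⟨∇_q T, T⟩` once more gives the second covariant
  -- derivative of `T` and a product of first ones. The term `Γ^c_{pq} ∂_c |T|²` is the correction
  -- that makes `∇_p ∇_q T` tensorial.
  have h2 : ∀ p q, cov D.G (cov D.G (k := 0) (fun z _ => normSq D.G T z)) y
      (Fin.cons p (Fin.cons q Fin.elim0))
      = 2 * ipC (D.G y)⁻¹ (fun I => cov D.G (cov D.G T) y (Fin.cons p (Fin.cons q I))) (T y)
        + 2 * ipC (D.G y)⁻¹ (dir D.G q T y) (dir D.G p T y) := by
    intro p q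
    have e0 : cov D.G (cov D.G (k := 0) (fun z _ => normSq D.G T z)) y
        (Fin.cons p (Fin.cons q Fin.elim0)) = pd p (pd q (normSq D.G T)) y
        - ∑ c, christoffel D.G c p q y * pd c (normSq D.G T) y := by
      rw [cov_cons, act_cons]
      simp only [cov_scalar]
      simp [act, chr]
    have e1 : (fun I => cov D.G (cov D.G T) y (Fin.cons p (Fin.cons q I)))
        = dir D.G p (dir D.G q T) y - ∑ c, christoffel D.G c p q y • dir D.G c T y := by
      funext I
      rw [cov_cov_cons]
      simp
    rw [e0, pd_congr_on D.isOpen_U (h1 q) hy, pd_const_mul _ (hdiff q), pd_ip (hT.dir q) hT hy,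
      e1, ipC_sub_left, ipC_sum_left]
    simp only [ipC_smul_left, h1 _ y hy, mul_left_comm _ (2 : ℝ), ← Finset.mul_sum]
    ring
  have h3 : lapFun D.G (normSq D.G T) y = ∑ p, ∑ q, (D.G y)⁻¹ p q *
      (2 * ipC (D.G y)⁻¹ (fun I => cov D.G (cov D.G T) y (Fin.cons p (Fin.cons q I))) (T y)
        + 2 * ipC (D.G y)⁻¹ (dir D.G q T y) (dir D.G p T y)) := by
    rw [lapFun, lap]
    exact Finset.sum_congr rfl fun p _ => Finset.sum_congr rfl fun q _ => by rw [h2]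
  have h4 : lap D.G T y = ∑ p, ∑ q, (D.G y)⁻¹ p q •
      (fun I => cov D.G (cov D.G T) y (Fin.cons p (Fin.cons q I))) := by
    funext I
    simp [lap]
  have h5 : normSq D.G (cov D.G T) y
      = ∑ p, ∑ q, (D.G y)⁻¹ p q * ipC (D.G y)⁻¹ (dir D.G q T y) (dir D.G p T y) := by
    rw [normSq_eq]
    simp only [ipC, ipQ, sum_cons, Fin.prod_univ_succ, Fin.cons_zero, Fin.cons_succ,
      Finset.mul_sum]
    refine Finset.sum_congr rfl fun p _ => ?_
    rw [Finset.sum_comm]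
    refine Finset.sum_congr rfl fun q _ => ?_
    rw [Finset.sum_comm]
    refine Finset.sum_congr rfl fun I _ => Finset.sum_congr rfl fun J _ => ?_
    rw [Finset.prod_congr rfl fun s _ => symm_inv hy (J s) (I s)]
    simp only [dir]
    ring
  rw [h3, h4, h5, ipC_sum_left]
  simp only [ipC_sum_left, ipC_smul_left, Finset.mul_sum, ← Finset.sum_add_distrib]
  exact Finset.sum_congr rfl fun p _ => Finset.sum_congr rfl fun q _ => by ring

/-! ### The sign of the contribution of `h` -/

theorem hTerm_eq (G : MetricField n) (H : Field n 3) (i j : Fin n) (y : Coord n) :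
    hTerm G H i j y = ipC (G y)⁻¹ (fun X : Fin 2 → Fin n => H y ![i, X 0, X 1])
      (fun X => H y ![j, X 0, X 1]) := by
  simp only [hTerm, ipC, ipQ, sum_cons, Fintype.sum_unique, Fin.prod_univ_two, Fin.cons_zero]
  rfl

/-- The quadratic form at `x` is half the squared norm of the two-tensor `x^i H_{i··}`. -/
theorem posSemidef_formPart (hy : y ∈ D.U) :
    (Matrix.of fun i j => formPart D.G D.H y ![i, j]).PosSemidef := by
  set X : Fin n → Comp n 2 := fun i Y => D.H y ![i, Y 0, Y 1]
  have e : ∀ i j, formPart D.G D.H y ![i, j] = (1 / 2) * ipC (D.G y)⁻¹ (X i) (X j) := fun i j => by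
    rw [← hTerm_eq]; rfl
  refine Matrix.PosSemidef.of_dotProduct_mulVec_nonneg ?_ fun x => ?_
  · ext i j
    simp only [Matrix.conjTranspose_apply, Matrix.of_apply, star_trivial, e,
      ipC_comm (symm_inv hy) (X j) (X i)]
  · have h : star x ⬝ᵥ (Matrix.of fun i j => formPart D.G D.H y ![i, j]).mulVec x
        = (1 / 2) * ipC (D.G y)⁻¹ (∑ i, x i • X i) (∑ j, x j • X j) := by
      rw [ipC_sum_left]
      simp only [ipC_smul_left]
      simp only [ipC_comm (symm_inv hy) (X _) (∑ j, x j • X j), ipC_sum_left, ipC_smul_left]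
      simp only [dotProduct, Matrix.mulVec, Matrix.of_apply, e, Finset.mul_sum, Pi.star_apply,
        star_trivial]
      refine Finset.sum_congr rfl fun i _ => Finset.sum_congr rfl fun j _ => ?_
      rw [ipC_comm (symm_inv hy) (X j) (X i)]
      ring
    rw [h]
    exact mul_nonneg (by norm_num) (ipC_self_nonneg (posSemidef_inv hy) _)

/-- Slot by slot, the pairing is the one in which a single factor `P = g⁻¹` is replaced by `P h P`.
All the forms are then positive semidefinite. -/
theorem ipC_act_nonneg (hy : y ∈ D.U) {h : Matrix (Fin n) (Fin n) ℝ} (hh : h.PosSemidef)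
    (T : Comp n k) : 0 ≤ ipC (D.G y)⁻¹ (act (fun a i => ∑ b, (D.G y)⁻¹ a b * h b i) T) T := by
  set P := (D.G y)⁻¹
  have e0 : act (fun a i => ∑ b, P a b * h b i) T
      = ∑ s, slot s (fun a i => ∑ b, P a b * h b i) T := by funext I; simp [act]
  rw [e0, ipC_sum_left]
  refine Finset.sum_nonneg fun s _ => ?_
  have hPt : Matrix.conjTranspose P = P := (posSemidef_inv hy).isHermitian
  have hQ : (P * h * P).PosSemidef := by
    have := hh.conjTranspose_mul_mul_same P
    rwa [hPt] at this
  set Q : Fin k → Matrix (Fin n) (Fin n) ℝ := Function.update (fun _ => P) s (P * h * P) with hQdef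
  have h1 : ipC P (slot s (fun a i => ∑ b, P a b * h b i) T) T = ipQ Q T T := by
    rw [ipC_slot]
    refine Finset.sum_congr rfl fun I _ => Finset.sum_congr rfl fun J _ => ?_
    rw [← Finset.prod_erase_mul _ _ (Finset.mem_univ s)]
    congr 3
    · refine Finset.prod_congr rfl fun r hr => ?_
      rw [hQdef, Function.update_of_ne (Finset.ne_of_mem_erase hr)]
    · rw [hQdef, Function.update_self]
      simp only [Matrix.mul_apply]
  rw [h1]
  refine ipQ_self_nonneg (fun r => ?_) T
  by_cases hr : r = s
  · subst hr; rw [hQdef, Function.update_self]; exact hQ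
  · rw [hQdef, Function.update_of_ne hr]; exact posSemidef_inv hy

theorem actBy_elim0_eq (G : MetricField n) (v : Field n 2) (T : Field n k) (y : Coord n) :
    Poly.actBy G (Fin.elim0 : Fin 0 → Fin k) id v T y
      = act (fun a i => ∑ b, (G y)⁻¹ a b * v y ![b, i]) (T y) := by
  have e : ∀ (b i : Fin n) (X : Fin 0 → Fin n), (Fin.cons b (Fin.cons i X) : Fin 2 → Fin n)
      = ![b, i] := by
    intro b i X
    funext s; fin_cases s <;> rfl
  funext I
  simp only [Poly.actBy, e]
  rfl

end LocData

/-! ### The evolution of the squared norms -/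

namespace LocFlow

variable {n k : ℕ} {F : LocFlow n} {t : ℝ} {y : Coord n}

/-- The two equal contributions of `∂_t T` give the factor `2`; every factor `g⁻¹` contributes `-g⁻¹
(∂_t g) g⁻¹`, which is minus the action of the velocity on that slot. -/
theorem hasDeriv_normSq {T : ℝ → Field n k} {T' : Comp n k} (ht : t ∈ F.J) (hy : y ∈ F.U)
    (hT : ∀ I, HasDerivWithinAt (fun s => T s y I) (T' I) F.J t) :
    HasDerivWithinAt (fun s => normSq (F.G s) (T s) y)
      (2 * ipC (F.G t y)⁻¹ T' (T t y) - ipC (F.G t y)⁻¹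
        (Poly.actBy (F.G t) (Fin.elim0 : Fin 0 → Fin k) id (F.vel t) (T t) y) (T t y)) F.J t := by
  have hsymm : ∀ a b, (F.G t y)⁻¹ a b = (F.G t y)⁻¹ b a :=
    LocData.symm_inv (D := F.slice t ht) hy
  have h1 := HasDerivWithinAt.fun_sum (u := Finset.univ) fun (I : Fin k → Fin n) _ =>
    HasDerivWithinAt.fun_sum (u := Finset.univ) fun (J : Fin k → Fin n) _ =>
      ((HasDerivWithinAt.fun_finsetProd (u := Finset.univ) fun (s : Fin k) _ =>
        hasDeriv_inv (F := F) ht hy (I s) (J s)).fun_mul (hT I)).fun_mul (hT J)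
  refine h1.congr_deriv ?_
  set P := (F.G t y)⁻¹
  set M : Fin n → Fin n → ℝ := fun a i => ∑ b, P a b * F.vel t y ![b, i] with hM
  have h2 := ipC_act_add hsymm M (T t y) (T t y)
  rw [ipC_comm hsymm (T t y), ← two_mul] at h2
  -- The derivative of `g⁻¹` is written as half of a sum symmetric in both indices, to match the
  -- shape of `ipC_act_add`.
  have h3 : ∀ i j, -∑ a, ∑ b, P i a * F.vel t y ![a, b] * P b j
      = -(1 / 2) * (∑ c, M i c * P c j + ∑ c, M j c * P i c) := by
    intro i j
    have e1 : ∑ c, M i c * P c j = ∑ a, ∑ b, P i a * F.vel t y ![a, b] * P b j := by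
      simp only [hM, Finset.sum_mul]
      rw [Finset.sum_comm]
    have e2 : ∑ c, M j c * P i c = ∑ a, ∑ b, P i a * F.vel t y ![a, b] * P b j := by
      simp only [hM, Finset.sum_mul]
      refine Finset.sum_congr rfl fun a _ => Finset.sum_congr rfl fun b _ => ?_
      rw [vel_symm ht hy, hsymm j b]
      ring
    rw [e1, e2]
    ring
  rw [LocData.actBy_elim0_eq]
  have h4 : ipC P T' (T t y) = ∑ I, ∑ J, (∏ s, P (I s) (J s)) * T' I * T t y J := rfl
  have h5 : ipC P T' (T t y) = ∑ I, ∑ J, (∏ s, P (I s) (J s)) * T t y I * T' J := by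
    rw [ipC_comm hsymm]; rfl
  have h6 : ∑ I : Fin k → Fin n, ∑ J : Fin k → Fin n,
      (∑ s, (∏ r ∈ Finset.univ.erase s, P (I r) (J r)) •
        -∑ a, ∑ b, P (I s) a * F.vel t y ![a, b] * P b (J s)) * T t y I * T t y J
      = -ipC P (act M (T t y)) (T t y) := by
    simp only [h3, smul_eq_mul]
    have : ∀ a : ℝ, -a = -(1 / 2) * (2 * a) := fun a => by ring
    rw [this (ipC P (act M (T t y)) (T t y)), h2, Finset.mul_sum]
    refine Finset.sum_congr rfl fun I _ => ?_
    rw [Finset.mul_sum]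
    refine Finset.sum_congr rfl fun J _ => ?_
    rw [← mul_assoc, ← mul_assoc, Finset.mul_sum]
    congr 2
    exact Finset.sum_congr rfl fun s _ => by ring
  simp only [add_mul, Finset.sum_add_distrib]
  rw [h6, ← h4, ← h5]
  ring

/-- The error terms of `∂_t ∇^l H` are grouped with the part of `∂_t g` of the same type: twice the
`Rm ∗ H` error with the Ricci part, twice the cubic error with the `H ∗ H` part. Each group is one
universal tensor paired with `∇^l H`. -/
theorem exists_normSq_evolution (n l : ℕ) : ∃ C : ℝ, ∀ (F : LocFlow n), ∀ t ∈ F.J, ∀ y ∈ F.U,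
    ∃ d : ℝ, HasDerivWithinAt (fun s => normSq (F.G s) (iterCov (F.G s) (F.H s) l) y) d F.J t ∧
      d ≤ lapFun (F.G t) (normSq (F.G t) (iterCov (F.G t) (F.H t) l)) y
        - 2 * normSq (F.G t) (iterCov (F.G t) (F.H t) (l + 1)) y
        + C * ∑ x ∈ Finset.HasAntidiagonal.antidiagonal l,
            nrm (F.G t) (iterCov (F.G t) (F.H t) x.1) y
              * nrm (F.G t) (iterCov (F.G t) (riem (F.G t)) x.2) y
              * nrm (F.G t) (iterCov (F.G t) (F.H t) l) y
        + C * ∑ x ∈ Finset.Nat.antidiagonalTuple 3 l,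
            nrm (F.G t) (iterCov (F.G t) (F.H t) (x 0)) y
              * nrm (F.G t) (iterCov (F.G t) (F.H t) (x 1)) y
              * nrm (F.G t) (iterCov (F.G t) (F.H t) (x 2)) y
              * nrm (F.G t) (iterCov (F.G t) (F.H t) l) y := by
  obtain ⟨A, B, hA, hB, h⟩ := exists_evolution n l
  have hH : Poly (n := n) 1 0 l (3 + l) fun D => iterCov D.G D.H l := Poly.nablaH l
  have hR := (poly_ricPart (n := n)).actBy_self hH
  have hF := (poly_formPart (n := n)).actBy_self hH
  obtain ⟨C₁, hC₁, b₁⟩ := ((hA.smul 2).sub (hR.of_eq (by omega) (by omega) (by omega))).nrm_le_two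
  obtain ⟨C₂, hC₂, b₂⟩ :=
    ((hB.smul 2).sub (hF.of_eq (by omega) (by omega) (by omega))).nrm_le_three
  -- One constant serves for both sums, as all their terms are nonnegative.
  refine ⟨max C₁ C₂, fun F t ht y hy => ?_⟩
  refine ⟨_, hasDeriv_normSq (T := fun s => iterCov (F.G s) (F.H s) l)
    (T' := lap (F.G t) (iterCov (F.G t) (F.H t) l) y + A (F.slice t ht) y + B (F.slice t ht) y)
    ht hy (h F t ht y hy), ?_⟩
  set D := F.slice t ht with hD
  set T := iterCov (F.G t) (F.H t) l with hT
  have hTs : D.Smooth T := hH.smooth D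
  have e1 : lapFun (F.G t) (normSq (F.G t) T) y = 2 * ipC (F.G t y)⁻¹ (lap (F.G t) T y) (T y)
      + 2 * normSq (F.G t) (iterCov (F.G t) (F.H t) (l + 1)) y :=
    LocData.lapFun_normSq (D := D) hTs hy
  have e2 := actBy_add (G := F.G t) (f := (Fin.elim0 : Fin 0 → Fin (3 + l))) (h := id)
    (B := F.vel t) (B₁ := ricPart (F.G t)) (B₂ := formPart (F.G t) (F.H t)) (T := T) (y := y) rfl
  rw [e2, ipC_add_left, ipC_add_left, ipC_add_left]
  have p1 := (le_abs_self _).trans (LocData.abs_ip_le (D := D) hy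
    ((2 : ℝ) • A D - Poly.actBy (F.G t) Fin.elim0 id (ricPart (F.G t)) T) T)
  have p2 := (le_abs_self _).trans (LocData.abs_ip_le (D := D) hy
    ((2 : ℝ) • B D - Poly.actBy (F.G t) Fin.elim0 id (formPart (F.G t) (F.H t)) T) T)
  have q1 := p1.trans (mul_le_mul_of_nonneg_right (b₁ D y hy) (LocData.nrm_nonneg (D := D) T))
  have q2 := p2.trans (mul_le_mul_of_nonneg_right (b₂ D y hy) (LocData.nrm_nonneg (D := D) T))
  rw [Pi.sub_apply, Pi.smul_apply, ipC_sub_left, ipC_smul_left, mul_assoc, Finset.sum_mul] at q1 q2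
  have r1 := q1.trans (mul_le_mul_of_nonneg_right (le_max_left C₁ C₂)
    (Finset.sum_nonneg fun x _ => mul_nonneg (mul_nonneg (LocData.nrm_nonneg _)
      (LocData.nrm_nonneg _)) (LocData.nrm_nonneg _)))
  have r2 := q2.trans (mul_le_mul_of_nonneg_right (le_max_right C₁ C₂)
    (Finset.sum_nonneg fun x _ => mul_nonneg (mul_nonneg (mul_nonneg (LocData.nrm_nonneg _)
      (LocData.nrm_nonneg _)) (LocData.nrm_nonneg _)) (LocData.nrm_nonneg _)))
  rw [e1]
  change 2 * ipC (F.G t y)⁻¹ (A D y) (T y) - ipC (F.G t y)⁻¹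
    (Poly.actBy (F.G t) Fin.elim0 id (ricPart (F.G t)) T y) (T y) ≤ _ at r1
  change 2 * ipC (F.G t y)⁻¹ (B D y) (T y) - ipC (F.G t y)⁻¹
    (Poly.actBy (F.G t) Fin.elim0 id (formPart (F.G t) (F.H t)) T y) (T y) ≤ _ at r2
  refine le_trans (le_of_eq ?_) (add_le_add (add_le_add (le_of_eq (rfl : 2 * ipC (F.G t y)⁻¹
    (lap (F.G t) T y) (T y) + 2 * normSq (F.G t) (iterCov (F.G t) (F.H t) (l + 1)) y
    - 2 * normSq (F.G t) (iterCov (F.G t) (F.H t) (l + 1)) y = _)) r1) r2)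
  ring

/-- At level zero the equation for `H` itself has no cubic error, so the `H ∗ H` part of `∂_t g` is
the only source of a quartic term, and its sign is favourable. -/
theorem exists_normSq_evolution_zero (n : ℕ) : ∃ C : ℝ, ∀ (F : LocFlow n), ∀ t ∈ F.J, ∀ y ∈ F.U,
    ∃ d : ℝ, HasDerivWithinAt (fun s => normSq (F.G s) (F.H s) y) d F.J t ∧
      d ≤ lapFun (F.G t) (normSq (F.G t) (F.H t)) y
        - 2 * normSq (F.G t) (iterCov (F.G t) (F.H t) 1) y
        + C * nrm (F.G t) (riem (F.G t)) y * normSq (F.G t) (F.H t) y := by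
  obtain ⟨P, hP, h⟩ := exists_box_eq (n := n)
  have hH : Poly (n := n) 1 0 0 3 fun D => D.H := Poly.nablaH 0
  have hR := (poly_ricPart (n := n)).actBy_self hH
  obtain ⟨C, -, b⟩ := ((hP.smul 2).sub (hR.of_eq (by omega) (by omega) (by omega))).nrm_le_two
  refine ⟨C, fun F t ht y hy => ⟨_, hasDeriv_normSq (T := F.H)
    (T' := box (F.G t) (F.H t) y) ht hy (F.form_eq t ht y hy), ?_⟩⟩
  set D := F.slice t ht with hD
  set T := F.H t with hT
  have hTs : D.Smooth T := hH.smooth D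
  have e0 : box (F.G t) T y = lap (F.G t) T y + P D y := h D y hy
  have e1 : lapFun (F.G t) (normSq (F.G t) T) y = 2 * ipC (F.G t y)⁻¹ (lap (F.G t) T y) (T y)
      + 2 * normSq (F.G t) (iterCov (F.G t) T 1) y :=
    LocData.lapFun_normSq (D := D) hTs hy
  have e2 := actBy_add (G := F.G t) (f := (Fin.elim0 : Fin 0 → Fin 3)) (h := id)
    (B := F.vel t) (B₁ := ricPart (F.G t)) (B₂ := formPart (F.G t) T) (T := T) (y := y) rfl
  -- This quantity is subtracted in the derivative of `|H|²` and can therefore be dropped.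
  have e3 : 0 ≤ ipC (F.G t y)⁻¹
      (Poly.actBy (F.G t) (Fin.elim0 : Fin 0 → Fin 3) id (formPart (F.G t) T) T y) (T y) := by
    rw [LocData.actBy_elim0_eq]
    exact LocData.ipC_act_nonneg (D := D) hy (LocData.posSemidef_formPart (D := D) hy) (T y)
  have p1 := (le_abs_self _).trans (LocData.abs_ip_le (D := D) hy
    ((2 : ℝ) • P D - Poly.actBy (F.G t) Fin.elim0 id (ricPart (F.G t)) T) T)
  have q1 := p1.trans (mul_le_mul_of_nonneg_right (b D y hy) (LocData.nrm_nonneg (D := D) T))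
  rw [Pi.sub_apply, Pi.smul_apply, ipC_sub_left, ipC_smul_left] at q1
  have e4 : (∑ x ∈ Finset.HasAntidiagonal.antidiagonal 0, nrm D.G (iterCov D.G D.H x.1) y
      * nrm D.G (iterCov D.G (riem D.G) x.2) y)
      = nrm (F.G t) T y * nrm (F.G t) (riem (F.G t)) y := by
    rw [Finset.HasAntidiagonal.antidiagonal_zero, Finset.sum_singleton]
    rfl
  have e5 : nrm (F.G t) T y * nrm (F.G t) T y = normSq (F.G t) T y :=
    LocData.nrm_mul_self (D := D) hy T
  rw [e4] at q1
  change 2 * ipC (F.G t y)⁻¹ (P D y) (T y) - ipC (F.G t y)⁻¹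
    (Poly.actBy (F.G t) Fin.elim0 id (ricPart (F.G t)) T y) (T y)
    ≤ C * (nrm (F.G t) T y * nrm (F.G t) (riem (F.G t)) y) * nrm (F.G t) T y at q1
  rw [e0, e2, ipC_add_left, ipC_add_left, e1, ← e5]
  linarith

end LocFlow

/-! ### From the manifold to coordinates -/

section Charts

variable {n : ℕ} {M : Type*} [TopologicalSpace M] [ChartedSpace (Coord n) M]
  {e : Chart n M} {y : Coord n}

theorem mfderiv_symm_injective (he : e ∈ IsManifold.maximalAtlas (𝓡 n) ∞ M) (hy : y ∈ e.target) :
    Function.Injective (mfderiv 𝓘(ℝ, Coord n) (𝓡 n) e.symm y) := by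
  have hm : e.MDifferentiable (𝓡 n) 𝓘(ℝ, Coord n) :=
    ⟨(contMDiffOn_of_mem_maximalAtlas he).mdifferentiableOn (by simp),
      (contMDiffOn_symm_of_mem_maximalAtlas he).mdifferentiableOn (by simp)⟩
  exact hm.symm.mfderiv_injective hy

theorem isAlt_formIn (H : ThreeForm n M) (e : Chart n M) (y : Coord n) :
    IsAlt (formIn H e y) := fun I _ _ hrs =>
  (H (e.symm y)).toAlternatingMap.map_swap (fun s => coordVec e (I s) y) hrs

variable [IsManifold (𝓡 n) ∞ M]

/-- The coordinate vectors are linearly independent because the differential of the inverse chart is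
injective, so positivity of `g` passes to its matrix of components. -/
theorem posDef_metricIn (g : Metric n M) (he : e ∈ IsManifold.maximalAtlas (𝓡 n) ∞ M)
    (hy : y ∈ e.target) : (metricIn g e y).PosDef := by
  refine Matrix.PosDef.of_dotProduct_mulVec_pos ?_ fun x hx => ?_
  · ext i j
    exact g.symm _ _ _
  · have hv : mfderiv 𝓘(ℝ, Coord n) (𝓡 n) e.symm y (WithLp.toLp 2 x)
        = ∑ i, x i • coordVec e i y := by
      have : (WithLp.toLp 2 x : Coord n) = ∑ i, x i • EuclideanSpace.single i (1 : ℝ) := by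
        ext j
        simp [Pi.single_apply]
      rw [this]
      simp only [coordVec]
      exact (map_sum _ _ _).trans (Finset.sum_congr rfl fun i _ => map_smul _ _ _)
    have hne : ∑ i, x i • coordVec e i y ≠ 0 := by
      rw [← hv]
      intro h
      apply hx
      have := mfderiv_symm_injective he hy (h.trans (map_zero _).symm)
      exact congrArg WithLp.ofLp this
    have := g.pos (e.symm y) _ hne
    simp only [map_sum, map_smul, sum_apply, smul_apply, smul_eq_mul, Finset.mul_sum] at this
    rw [Finset.sum_comm] at this
    simpa [dotProduct, Matrix.mulVec, metricIn, Finset.mul_sum, mul_comm, mul_left_comm] using this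

/-- A solution of the flow in the coordinates of a chart. -/
def IsSolution.locFlow {J : Set ℝ} {g : ℝ → Metric n M} {H : ℝ → ThreeForm n M}
    (h : IsSolution J g H) (hJ : J.OrdConnected) (hJ' : J.Nontrivial)
    (he : e ∈ IsManifold.maximalAtlas (𝓡 n) ∞ M) : LocFlow n where
  J := J
  ordConnected := hJ
  nontrivial := hJ'
  U := e.target
  isOpen_U := e.open_target
  G t := metricIn (g t) e
  H t := formIn (H t) e
  smooth_G := h.smooth_metric e he
  smooth_H := h.smooth_form e he
  posDef t _ _ hy := posDef_metricIn (g t) he hy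
  alt_H t _ y _ := isAlt_formIn (H t) e y
  metric_eq := h.metric_eq e he
  form_eq := h.form_eq e he

end Charts

end GRF

end

theorem proposition4p3 (n : ℕ) :
    -- the evolution equation of `∇^l H`
    (∀ l : ℕ, 1 ≤ l →
      ∃ (a : (i j : ℕ) → GRF.Coeffs ((3 + i) + (4 + j)) (3 + l) 2)
        (b : (i j k : ℕ) → GRF.Coeffs ((3 + i) + ((3 + j) + (3 + k))) (3 + l) 3),
      ∀ (M : Type u) [TopologicalSpace M] [T2Space M] [CompactSpace M]
        [ChartedSpace (GRF.Coord n) M] [IsManifold (𝓡 n) ∞ M]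
        (J : Set ℝ) (g : ℝ → GRF.Metric n M) (H : ℝ → GRF.ThreeForm n M),
        J.OrdConnected → J.Nontrivial → GRF.IsSolution J g H →
        ∀ e ∈ IsManifold.maximalAtlas (𝓡 n) ∞ M, ∀ t ∈ J, ∀ y ∈ e.target,
        ∀ I : Fin (3 + l) → Fin n,
          HasDerivWithinAt (fun s => GRF.nablaH (g s) (H s) e l y I)
            (GRF.lap (GRF.metricIn (g t) e) (GRF.nablaH (g t) (H t) e l) y I
              + ∑ x ∈ Finset.HasAntidiagonal.antidiagonal l,
                  GRF.star2 (GRF.metricIn (g t) e) (a x.1 x.2)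
                    (GRF.nablaH (g t) (H t) e x.1) (GRF.nablaRm (g t) e x.2) y I
              + ∑ x ∈ Finset.Nat.antidiagonalTuple 3 l,
                  GRF.star3 (GRF.metricIn (g t) e) (b (x 0) (x 1) (x 2))
                    (GRF.nablaH (g t) (H t) e (x 0)) (GRF.nablaH (g t) (H t) e (x 1))
                    (GRF.nablaH (g t) (H t) e (x 2)) y I) J t)
    ∧
    -- the evolution inequality of `|∇^l H|²`
    (∀ l : ℕ, 1 ≤ l → ∃ C : ℝ,
      ∀ (M : Type u) [TopologicalSpace M] [T2Space M] [CompactSpace M]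
        [ChartedSpace (GRF.Coord n) M] [IsManifold (𝓡 n) ∞ M]
        (J : Set ℝ) (g : ℝ → GRF.Metric n M) (H : ℝ → GRF.ThreeForm n M),
        J.OrdConnected → J.Nontrivial → GRF.IsSolution J g H →
        ∀ e ∈ IsManifold.maximalAtlas (𝓡 n) ∞ M, ∀ t ∈ J, ∀ y ∈ e.target,
        ∃ d : ℝ,
          HasDerivWithinAt
            (fun s => GRF.normSq (GRF.metricIn (g s) e) (GRF.nablaH (g s) (H s) e l) y) d J t ∧
          d ≤ GRF.lapFun (GRF.metricIn (g t) e)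
                (GRF.normSq (GRF.metricIn (g t) e) (GRF.nablaH (g t) (H t) e l)) y
              - 2 * GRF.normSq (GRF.metricIn (g t) e) (GRF.nablaH (g t) (H t) e (l + 1)) y
              + C * ∑ x ∈ Finset.HasAntidiagonal.antidiagonal l,
                  GRF.nrm (GRF.metricIn (g t) e) (GRF.nablaH (g t) (H t) e x.1) y
                    * GRF.nrm (GRF.metricIn (g t) e) (GRF.nablaRm (g t) e x.2) y
                    * GRF.nrm (GRF.metricIn (g t) e) (GRF.nablaH (g t) (H t) e l) y
              + C * ∑ x ∈ Finset.Nat.antidiagonalTuple 3 l,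
                  GRF.nrm (GRF.metricIn (g t) e) (GRF.nablaH (g t) (H t) e (x 0)) y
                    * GRF.nrm (GRF.metricIn (g t) e) (GRF.nablaH (g t) (H t) e (x 1)) y
                    * GRF.nrm (GRF.metricIn (g t) e) (GRF.nablaH (g t) (H t) e (x 2)) y
                    * GRF.nrm (GRF.metricIn (g t) e) (GRF.nablaH (g t) (H t) e l) y)
    ∧
    -- the evolution inequality of `|H|²`
    (∃ C : ℝ,
      ∀ (M : Type u) [TopologicalSpace M] [T2Space M] [CompactSpace M]
        [ChartedSpace (GRF.Coord n) M] [IsManifold (𝓡 n) ∞ M]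
        (J : Set ℝ) (g : ℝ → GRF.Metric n M) (H : ℝ → GRF.ThreeForm n M),
        J.OrdConnected → J.Nontrivial → GRF.IsSolution J g H →
        ∀ e ∈ IsManifold.maximalAtlas (𝓡 n) ∞ M, ∀ t ∈ J, ∀ y ∈ e.target,
        ∃ d : ℝ,
          HasDerivWithinAt
            (fun s => GRF.normSq (GRF.metricIn (g s) e) (GRF.formIn (H s) e) y) d J t ∧
          d ≤ GRF.lapFun (GRF.metricIn (g t) e)
                (GRF.normSq (GRF.metricIn (g t) e) (GRF.formIn (H t) e)) y
              - 2 * GRF.normSq (GRF.metricIn (g t) e) (GRF.nablaH (g t) (H t) e 1) y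
              + C * GRF.nrm (GRF.metricIn (g t) e) (GRF.riem (GRF.metricIn (g t) e)) y
                  * GRF.normSq (GRF.metricIn (g t) e) (GRF.formIn (H t) e) y) := by
  refine ⟨fun l _ => ?_, fun l _ => ?_, ?_⟩
  · obtain ⟨A, B, hA, hB, h⟩ := GRF.LocFlow.exists_evolution n l
    -- The numbers of contracted pairs come from comparing ranks: `7 + l = (3 + l) + 2·2` here, and
    -- `9 + l = (3 + l) + 2·3` for the cubic term.
    obtain ⟨a, ha⟩ := hA.exists_star2 (m := 2) (by omega)
    obtain ⟨b, hb⟩ := hB.exists_star3 (m := 3) (by omega)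
    refine ⟨a, b, fun M _ _ _ _ _ J g H hJ hJ' hs e he t ht y hy I => ?_⟩
    have key := h (hs.locFlow hJ hJ' he) t ht y hy I
    rw [ha _ y hy, hb _ y hy] at key
    exact key
  · obtain ⟨C, h⟩ := GRF.LocFlow.exists_normSq_evolution n l
    exact ⟨C, fun M _ _ _ _ _ J g H hJ hJ' hs e he t ht y hy =>
      h (hs.locFlow hJ hJ' he) t ht y hy⟩
  · obtain ⟨C, h⟩ := GRF.LocFlow.exists_normSq_evolution_zero n
    exact ⟨C, fun M _ _ _ _ _ J g H hJ hJ' hs e he t ht y hy =>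
      h (hs.locFlow hJ hJ' he) t ht y hy⟩
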